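/- Let $A$ be a Noetherian commutative unital ring containing $\mathbb Q$, and let $C_A$ be the category of non-positively graded differential graded commutative unital $A$-algebras $E=\bigoplus_{i\le 0}E^i$ (differential of degree $+1$) whose components $E^i$ are finitely generated $A$-modules. For a graded $A$-module $P$, $\mathrm{Sym}_A(P)$ is the quotient of the tensor algebra by $ab=(-1)^{\deg a\deg b}ba$. An algebra $E$ is semi-free if it is isomorphic, as a graded algebra, to $\mathrm{Sym}_A(P)$ for some projective graded module $P=\bigoplus_{i<0}P^i$; such a $P$ is called a module of generators of $E$. Let $C\in C_A$ be concentrated in degree $0$. A Tate resolution of $C$ is a quasi-isomorphism $p_E\colon E\to C$ with $E\in C_A$ semi-free; a morphism $f\colon E\to F$ of Tate resolutions is a morphism of differential graded $A$-algebras with $p_F\circ f=p_E$. For a graded $A$-module $V$, $\mathrm{Sym}_A(V\oplus V[1])$ has generators $V^i\oplus V^{i+1}$ in degree $i$ and differential $d(v\oplus w)=w\oplus 0$. All $V$, $W$ below are concentrated in negative degrees. Let $p_E\colon E\to C$ and $p_F\colon F\to C$ be Tate resolutions. (1) Let $d\ge 0$ and let $f\colon E\to F$ be a morphism of Tate resolutions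 which is an isomorphism in degrees $\ge -d+1$. Then there are projective graded $A$-modules $V,W$, finitely generated in each degree and concentrated in degrees $\le -d$, and an isomorphism in $C_A$ $$E\otimes_A\mathrm{Sym}_A(V\oplus V[1])\;\cong\;F\otimes_A\mathrm{Sym}_A(W\oplus W[1])$$ which restricts to $f$ in degrees $\ge -d+1$. If $E$ and $F$ have modules of generators that are free in all degrees $\le -d$, then $V,W$ can be chosen free of finite rank in each degree. In all cases there is such an isomorphism of differential graded commutative algebras (not necessarily in $C_A$) with $V,W$ free, possibly of infinite rank. (2) Let $d>0$ and let $f\colon E\to F$ be a morphism of Tate resolutions which restricts to an isomorphism $E_{\ge -(d-1)}\to F_{\ge -(d-1)}$ of the subalgebras generated by the elements of degree $\ge -(d-1)$. Then there are finitely generated projective $A$-modules $V,W$ placed in degree $-d$ such that $E\otimes_A\mathrm{Sym}_A(V\oplus V[1])$ and $F\otimes_A\mathrm{Sym}_A(W\oplus W[1])$, mapped to $C$ by $p_E$, $p_F$ and by sending $V\oplus V[1]$, $W\oplus W[1]$ to zero, are Tate resolutions of $C$, and a morphism of Tate resolutions $$E\otimes_A\mathrm{Sym}_A(V\oplus V[1])\to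 F\otimes_A\mathrm{Sym}_A(W\oplus W[1])$$ which is an isomorphism in degrees $\ge -d$ and coincides with $f$ on $E_{\ge -(d-1)}$. If $E$ and $F$ have modules of generators that are free in degree $-d$, then $V,W$ can be chosen free of finite rank. (3) Any two Tate resolutions $E,F$ of $C$ are stably isomorphic: there are projective $V,W$, finitely generated in each degree, and an isomorphism $E\otimes_A\mathrm{Sym}_A(V\oplus V[1])\cong F\otimes_A\mathrm{Sym}_A(W\oplus W[1])$ in $C_A$. If $E$ and $F$ have free modules of generators, $V,W$ can be chosen free of finite rank in each degree; in all cases there is such an isomorphism of differential graded commutative algebras with $V,W$ free, possibly of infinite rank. (4) Let moreover $\delta\colon T\to A$ be an $A$-linear map and suppose that $E$ and $F$ extend $\delta$, i.e. isomorphisms $T\cong E^{-1}$ and $T\cong F^{-1}$ are given which identify the differentials $E^{-1}\to A$ and $F^{-1}\to A$ with $\delta$. Then the isomorphisms in (3) can be chosen, with $V,W$ concentrated in degrees $\le -2$, to be the identity of $T$ in degree $-1$ (and of $A$ in degree $0$); here $V,W$ can be chosen free of finite rank in each degree if $E$ and $F$ have modules of generators that are free in all degrees $\le -2$. -/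

import Mathlib

open scoped DirectSum TensorProduct

universe u

/-- A commutative differential `ℤ`-graded unital algebra over `A`: an associative unital algebra
with a direct sum decomposition `comp i`, graded commutative, with an `A`-linear differential of
degree `1` obeying the graded Leibniz rule. -/
structure CDGA (A : Type u) [CommRing A] where
  carrier : Type u
  [ring : Ring carrier]
  [algebra : Algebra A carrier]
  comp : ℤ → Submodule A carrier
  [graded : GradedAlgebra comp]
  d : carrier →ₗ[A] carrier
  graded_comm : ∀ {i j : ℤ} {x y : carrier}, x ∈ comp i → y ∈ comp j →
    x * y = (i * j).negOnePow • (y * x)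
  d_mem : ∀ {i : ℤ} {x : carrier}, x ∈ comp i → d x ∈ comp (i + 1)
  leibniz : ∀ {i : ℤ} {x : carrier} (y : carrier), x ∈ comp i →
    d (x * y) = d x * y + i.negOnePow • (x * d y)
  d_d : ∀ x : carrier, d (d x) = 0

attribute [instance] CDGA.ring CDGA.algebra CDGA.graded

namespace CDGA

variable {A : Type u} [CommRing A]

theorem d_one (E : CDGA A) : E.d 1 = 0 := by
  have h := E.leibniz (i := 0) (x := 1) 1 SetLike.GradedOne.one_mem
  simpa using h

/-- Morphisms: algebra homomorphisms preserving degrees and commuting with the differentials. -/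
structure Hom (E F : CDGA A) where
  toAlgHom : E.carrier →ₐ[A] F.carrier
  map_mem : ∀ {i : ℤ} {x : E.carrier}, x ∈ E.comp i → toAlgHom x ∈ F.comp i
  map_d : ∀ x : E.carrier, toAlgHom (E.d x) = F.d (toAlgHom x)

instance (E F : CDGA A) : CoeFun (Hom E F) (fun _ => E.carrier → F.carrier) :=
  ⟨fun f => f.toAlgHom⟩

/-- Isomorphisms: pairs of mutually inverse morphisms. -/
structure Iso (E F : CDGA A) where
  hom : Hom E F
  inv : Hom F E
  inv_hom : ∀ x, inv (hom x) = x
  hom_inv : ∀ y, hom (inv y) = y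

/-- Cocycles of degree `i`. -/
def cocycles (E : CDGA A) (i : ℤ) : Submodule A E.carrier := E.comp i ⊓ LinearMap.ker E.d

/-- Coboundaries of degree `i`. -/
def coboundaries (E : CDGA A) (i : ℤ) : Submodule A E.carrier := (E.comp (i - 1)).map E.d

/-- The cohomology in degree `i`. -/
abbrev cohomology (E : CDGA A) (i : ℤ) : Type u :=
  E.cocycles i ⧸ (E.coboundaries i).submoduleOf (E.cocycles i)

/-- The map of cocycles induced by a morphism. -/
def Hom.cocyclesMap {E F : CDGA A} (f : Hom E F) (i : ℤ) : E.cocycles i →ₗ[A] F.cocycles i :=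
  f.toAlgHom.toLinearMap.restrict (by
    rintro x ⟨h1, h2⟩
    refine ⟨f.map_mem h1, ?_⟩
    have h2' : E.d x = 0 := h2
    change F.d (f x) = 0
    rw [← f.map_d, h2', map_zero])

/-- The map induced on cohomology by a morphism. -/
def Hom.cohomologyMap {E F : CDGA A} (f : Hom E F) (i : ℤ) :
    E.cohomology i →ₗ[A] F.cohomology i :=
  Submodule.mapQ _ _ (f.cocyclesMap i) (by
    rintro ⟨x, hx⟩ ⟨y, hy, hxy⟩
    exact ⟨f y, f.map_mem hy, by
      change F.d (f y) = f x
      rw [← f.map_d]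
      exact congrArg f hxy⟩)

/-- A quasi-isomorphism induces isomorphisms on cohomology in all degrees. -/
def Hom.IsQuasiIso {E F : CDGA A} (f : Hom E F) : Prop :=
  ∀ i, Function.Bijective (f.cohomologyMap i)

/-- The objects of the category `C_A`: non-positively graded, with components that are finitely
generated `A`-modules. -/
structure InCA (E : CDGA A) : Prop where
  nonpos : ∀ i, 0 < i → E.comp i = ⊥
  finite : ∀ i, Module.Finite A (E.comp i)

/-- All components of non-zero degree vanish. -/
def ConcentratedInDegreeZero (E : CDGA A) : Prop := ∀ i, i ≠ 0 → E.comp i = ⊥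

/-- The subalgebra generated by the elements of degree `≥ m`. -/
def subalgebraGE (E : CDGA A) (m : ℤ) : Subalgebra A E.carrier :=
  Algebra.adjoin A {x | ∃ i, m ≤ i ∧ x ∈ E.comp i}

end CDGA

/-! ### The graded symmetric algebra -/

section GSym

variable (A : Type u) [CommRing A] (V : ℤ → Type u) [∀ i, AddCommGroup (V i)]
  [∀ i, Module A (V i)]

/-- The relations `a b = (-1)^{deg a deg b} b a` for homogeneous `a, b` in `⨁ i, V i`. -/
inductive GSymRel : TensorAlgebra A (⨁ i, V i) → TensorAlgebra A (⨁ i, V i) → Prop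
  | swap (i j : ℤ) (v : V i) (w : V j) :
    GSymRel
      (TensorAlgebra.ι A (DirectSum.lof A ℤ V i v) * TensorAlgebra.ι A (DirectSum.lof A ℤ V j w))
      ((i * j).negOnePow •
        (TensorAlgebra.ι A (DirectSum.lof A ℤ V j w) * TensorAlgebra.ι A (DirectSum.lof A ℤ V i v)))

/-- The symmetric algebra of the graded module `⨁ i, V i`: the quotient of the tensor algebra by
the relations `GSymRel`. -/
def GSym : Type u := RingQuot (GSymRel A V)

noncomputable instance : Ring (GSym A V) := inferInstanceAs (Ring (RingQuot (GSymRel A V)))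

noncomputable instance : Algebra A (GSym A V) :=
  inferInstanceAs (Algebra A (RingQuot (GSymRel A V)))

end GSym

namespace GSym

variable {A : Type u} [CommRing A] {V : ℤ → Type u} [∀ i, AddCommGroup (V i)]
  [∀ i, Module A (V i)]

variable (A V) in
/-- The inclusion of the generators of degree `i`. -/
noncomputable def gen (i : ℤ) : V i →ₗ[A] GSym A V :=
  (RingQuot.mkAlgHom A (GSymRel A V)).toLinearMap ∘ₗ TensorAlgebra.ι A ∘ₗ DirectSum.lof A ℤ V i

theorem gen_mul_gen (i j : ℤ) (v : V i) (w : V j) :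
    gen A V i v * gen A V j w = (i * j).negOnePow • (gen A V j w * gen A V i v) := by
  have h := RingQuot.mkAlgHom_rel A (GSymRel.swap (A := A) i j v w)
  rw [map_mul, Units.smul_def, map_zsmul, map_mul, ← Units.smul_def] at h
  exact h

/-- Algebra homomorphisms out of the symmetric algebra. -/
noncomputable def lift {B : Type u} [Ring B] [Algebra A B] (f : ∀ i, V i →ₗ[A] B)
    (hf : ∀ i j v w, f i v * f j w = (i * j).negOnePow • (f j w * f i v)) : GSym A V →ₐ[A] B :=
  RingQuot.liftAlgHom A ⟨TensorAlgebra.lift A (DirectSum.toModule A ℤ B f), by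
    rintro _ _ ⟨i, j, v, w⟩
    rw [Units.smul_def, map_zsmul, ← Units.smul_def]
    simpa using hf i j v w⟩

@[simp]
theorem lift_gen {B : Type u} [Ring B] [Algebra A B] (f : ∀ i, V i →ₗ[A] B)
    (hf : ∀ i j v w, f i v * f j w = (i * j).negOnePow • (f j w * f i v)) (i : ℤ) (v : V i) :
    lift f hf (gen A V i v) = f i v := by
  have : lift f hf (gen A V i v)
      = TensorAlgebra.lift A (DirectSum.toModule A ℤ B f)
          (TensorAlgebra.ι A (DirectSum.lof A ℤ V i v)) :=
    RingQuot.liftAlgHom_mkAlgHom_apply _ _ _ _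
  rw [this]
  simp

theorem algHom_ext {B : Type u} [Ring B] [Algebra A B] {f g : GSym A V →ₐ[A] B}
    (h : ∀ i v, f (gen A V i v) = g (gen A V i v)) : f = g := by
  refine RingQuot.ringQuot_ext' A f g ?_
  refine TensorAlgebra.hom_ext ?_
  refine DirectSum.linearMap_ext A fun i => ?_
  ext v
  exact h i v

/-- The product of a word in homogeneous generators. -/
noncomputable def word (l : List (Σ i, V i)) : GSym A V :=
  (l.map fun p => gen A V p.1 p.2).prod

/-- The degree of a word. -/
def wordDeg (l : List (Σ i, V i)) : ℤ := (l.map Sigma.fst).sum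

variable (A V) in
/-- The component of degree `n`: spanned by the words of total degree `n`. -/
noncomputable def comp (n : ℤ) : Submodule A (GSym A V) :=
  Submodule.span A {x | ∃ l : List (Σ i, V i), wordDeg l = n ∧ word l = x}

theorem word_nil : (word [] : GSym A V) = 1 := rfl

theorem word_cons (p : Σ i, V i) (l : List (Σ i, V i)) :
    (word (p :: l) : GSym A V) = gen A V p.1 p.2 * word l := by
  simp [word]

theorem wordDeg_cons {V : ℤ → Type u} (p : Σ i, V i) (l : List (Σ i, V i)) :
    wordDeg (p :: l) = p.1 + wordDeg l := by
  simp [wordDeg]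

theorem word_append (l m : List (Σ i, V i)) :
    (word (l ++ m) : GSym A V) = word l * word m := by
  simp [word]

theorem wordDeg_append {V : ℤ → Type u} (l m : List (Σ i, V i)) : wordDeg (l ++ m) = wordDeg l + wordDeg m := by
  simp [wordDeg]

theorem word_mem (l : List (Σ i, V i)) : word l ∈ comp A V (wordDeg l) :=
  Submodule.subset_span ⟨l, rfl, rfl⟩

theorem gen_mem (i : ℤ) (v : V i) : gen A V i v ∈ comp A V i :=
  Submodule.subset_span ⟨[⟨i, v⟩], by simp [wordDeg], by simp [word]⟩

theorem comp_induction {n : ℤ} {P : GSym A V → Prop}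
    (hw : ∀ l : List (Σ i, V i), wordDeg l = n → P (word l)) (h0 : P 0)
    (ha : ∀ x y, P x → P y → P (x + y)) (hs : ∀ (a : A) x, P x → P (a • x))
    {x : GSym A V} (hx : x ∈ comp A V n) : P x := by
  induction hx using Submodule.span_induction with
  | mem x h => obtain ⟨l, hl, rfl⟩ := h; exact hw l hl
  | zero => exact h0
  | add x y _ _ hx hy => exact ha x y hx hy
  | smul a x _ hx => exact hs a x hx

instance : SetLike.GradedMonoid (comp A V) where
  one_mem := Submodule.subset_span ⟨[], rfl, rfl⟩
  mul_mem := by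
    intro i j x y hx hy
    refine comp_induction (P := fun x => x * y ∈ comp A V (i + j)) ?_ ?_ ?_ ?_ hx
    · intro l hl
      refine comp_induction (P := fun y => word l * y ∈ comp A V (i + j)) ?_ ?_ ?_ ?_ hy
      · intro m hm
        rw [← word_append, ← hl, ← hm, ← wordDeg_append]
        exact word_mem _
      · simp
      · intro x y hx hy
        rw [mul_add]
        exact add_mem hx hy
      · intro a x hx
        rw [mul_smul_comm]
        exact Submodule.smul_mem _ _ hx
    · simp
    · intro x y hx hy
      rw [add_mul]
      exact add_mem hx hy
    · intro a x hx
      rw [smul_mul_assoc]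
      exact Submodule.smul_mem _ _ hx

/-- Auxiliary map for the decomposition into homogeneous components. -/
noncomputable def decomposeAux : GSym A V →ₐ[A] ⨁ n, comp A V n :=
  lift (B := ⨁ n, comp A V n) (fun i => DirectSum.lof A ℤ (fun n => comp A V n) i ∘ₗ
      (gen A V i).codRestrict _ (gen_mem i)) (by
    intro i j v w
    rw [Units.smul_def]
    simp only [LinearMap.comp_apply, DirectSum.lof_eq_of, DirectSum.of_mul_of]
    have hz : ∀ (n : ℤ) (y : comp A V (j + i)),
        n • DirectSum.of (fun n => comp A V n) (j + i) y
          = DirectSum.of (fun n => comp A V n) (j + i) (n • y) :=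
      fun n y => (map_zsmul (DirectSum.of (fun n => comp A V n) (j + i)) n y).symm
    rw [hz]
    refine DirectSum.of_eq_of_gradedMonoid_eq (Sigma.subtype_ext (add_comm _ _) ?_)
    exact gen_mul_gen i j v w)

theorem decomposeAux_word (l : List (Σ i, V i)) :
    decomposeAux (word l : GSym A V)
      = DirectSum.of (fun n => comp A V n) (wordDeg l) ⟨word l, word_mem l⟩ := by
  induction l with
  | nil => exact map_one (decomposeAux (A := A) (V := V))
  | cons p l ih =>
    have h : decomposeAux (word (p :: l) : GSym A V)
        = decomposeAux (gen A V p.1 p.2) * decomposeAux (word l) := by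
      rw [word_cons, map_mul]
    rw [h, ih, decomposeAux, lift_gen]
    simp only [LinearMap.comp_apply, DirectSum.lof_eq_of, DirectSum.of_mul_of]
    refine DirectSum.of_eq_of_gradedMonoid_eq (Sigma.subtype_ext (wordDeg_cons p l).symm ?_)
    exact (word_cons p l).symm

theorem decomposeAux_mem {n : ℤ} {x : GSym A V} (hx : x ∈ comp A V n) :
    ∃ h : x ∈ comp A V n, decomposeAux x = DirectSum.of (fun n => comp A V n) n ⟨x, h⟩ := by
  refine comp_induction (P := fun x => ∃ h : x ∈ comp A V n,
    decomposeAux x = DirectSum.of (fun n => comp A V n) n ⟨x, h⟩) ?_ ?_ ?_ ?_ hx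
  · rintro l rfl
    exact ⟨word_mem l, decomposeAux_word l⟩
  · exact ⟨zero_mem _, by rw [map_zero]; exact (map_zero _).symm⟩
  · rintro x y ⟨hx, ex⟩ ⟨hy, ey⟩
    exact ⟨add_mem hx hy, by rw [map_add, ex, ey, ← map_add]; rfl⟩
  · rintro a x ⟨hx, ex⟩
    refine ⟨Submodule.smul_mem _ _ hx, ?_⟩
    rw [map_smul, ex, ← DirectSum.lof_eq_of A, ← map_smul]
    rfl

noncomputable instance : GradedAlgebra (comp A V) :=
  GradedAlgebra.ofAlgHom _ decomposeAux
    (by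
      refine algHom_ext fun i v => ?_
      simp only [AlgHom.comp_apply, AlgHom.id_apply]
      rw [decomposeAux, lift_gen]
      simp only [LinearMap.comp_apply, DirectSum.lof_eq_of, DirectSum.coeAlgHom_of]
      rfl)
    (by
      rintro i ⟨x, hx⟩
      obtain ⟨h, e⟩ := decomposeAux_mem hx
      exact e)

theorem graded_comm {i j : ℤ} {x y : GSym A V} (hx : x ∈ comp A V i) (hy : y ∈ comp A V j) :
    x * y = (i * j).negOnePow • (y * x) := by
  have h1 : ∀ (p : ℤ) (v : V p) (l : List (Σ i, V i)),
      gen A V p v * word l = (p * wordDeg l).negOnePow • (word l * gen A V p v) := by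
    intro p v l
    induction l with
    | nil => simp [word, wordDeg]
    | cons q l ih =>
      rw [word_cons, ← mul_assoc, gen_mul_gen, smul_mul_assoc, mul_assoc, ih, mul_smul_comm,
        smul_smul, wordDeg_cons, mul_add, Int.negOnePow_add, mul_assoc]
  have h2 : ∀ l m : List (Σ i, V i),
      (word l : GSym A V) * word m = (wordDeg l * wordDeg m).negOnePow • (word m * word l) := by
    intro l m
    induction l with
    | nil => simp [word, wordDeg]
    | cons p l ih =>
      rw [word_cons, mul_assoc, ih, mul_smul_comm, ← mul_assoc, h1, smul_mul_assoc, smul_smul,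
        wordDeg_cons, add_mul, Int.negOnePow_add, mul_assoc, mul_comm (Int.negOnePow _)]
  refine comp_induction (P := fun x => x * y = (i * j).negOnePow • (y * x)) ?_ ?_ ?_ ?_ hx
  · rintro l rfl
    refine comp_induction
      (P := fun y => word l * y = (wordDeg l * j).negOnePow • (y * word l)) ?_ ?_ ?_ ?_ hy
    · rintro m rfl
      exact h2 l m
    · simp
    · intro x y hx hy
      rw [mul_add, hx, hy, add_mul, smul_add]
    · intro a x hx
      rw [mul_smul_comm, hx, smul_mul_assoc, smul_comm]
  · simp
  · intro x z hx hz
    rw [add_mul, hx, hz, mul_add, smul_add]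
  · intro a x hx
    rw [smul_mul_assoc, hx, mul_smul_comm, smul_comm]

/-- The parity automorphism, equal to `(-1)^n` in degree `n`. -/
noncomputable def parity : GSym A V →ₐ[A] GSym A V :=
  lift (fun i => (i.negOnePow : ℤ) • gen A V i) (by
    intro i j v w
    simp only [LinearMap.smul_apply, smul_mul_assoc, mul_smul_comm]
    rw [gen_mul_gen, smul_comm (i.negOnePow : ℤ) (j.negOnePow : ℤ)]
    simp only [Units.smul_def]
    rw [smul_comm (i.negOnePow : ℤ) (((i * j).negOnePow : ℤˣ) : ℤ),
      smul_comm (j.negOnePow : ℤ) (((i * j).negOnePow : ℤˣ) : ℤ)])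

theorem parity_gen (i : ℤ) (v : V i) :
    parity (gen A V i v) = i.negOnePow • gen A V i v := by
  rw [parity, lift_gen]
  rfl

theorem parity_of_mem {n : ℤ} {x : GSym A V} (hx : x ∈ comp A V n) :
    parity x = n.negOnePow • x := by
  refine comp_induction (P := fun x => parity x = n.negOnePow • x) ?_ ?_ ?_ ?_ hx
  · rintro l rfl
    clear hx
    induction l with
    | nil => simp [word, wordDeg]
    | cons p l ih =>
      rw [word_cons, map_mul, parity_gen, ih, wordDeg_cons, Int.negOnePow_add,
        smul_mul_smul_comm]
  · simp
  · intro x y hx hy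
    rw [map_add, hx, hy, smul_add]
  · intro a x hx
    rw [map_smul, hx, smul_comm]

section Differential

variable (dV : ∀ i, V i →ₗ[A] V (i + 1))

/-- The homomorphism `x ↦ (parity x, d x; 0, x)` encoding the derivation `d` extending `dV`. -/
noncomputable def dMatrix : GSym A V →ₐ[A] Matrix (Fin 2) (Fin 2) (GSym A V) :=
  lift (fun i =>
    { toFun := fun v => !![i.negOnePow • gen A V i v, gen A V (i + 1) (dV i v); 0, gen A V i v]
      map_add' := by
        intro v w
        ext a b
        fin_cases a <;> fin_cases b <;> simp
      map_smul' := by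
        intro a v
        ext a b
        fin_cases a <;> fin_cases b
        · simpa using smul_comm _ _ _
        · simp
        · simp
        · simp }) (by
    intro i j v w
    have e1 : gen A V (i + 1) (dV i v) * gen A V j w
        = ((i * j).negOnePow * j.negOnePow) • (gen A V j w * gen A V (i + 1) (dV i v)) := by
      rw [gen_mul_gen, add_mul, one_mul, Int.negOnePow_add]
    have e2 : gen A V i v * gen A V (j + 1) (dV j w)
        = ((i * j).negOnePow * i.negOnePow) • (gen A V (j + 1) (dV j w) * gen A V i v) := by
      rw [gen_mul_gen, mul_add, mul_one, Int.negOnePow_add]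
    have e3 : i.negOnePow * ((i * j).negOnePow * i.negOnePow) = (i * j).negOnePow := by
      rw [mul_left_comm, Int.units_mul_self, mul_one]
    ext a b
    fin_cases a <;> fin_cases b
    · simp [Matrix.mul_apply, smul_mul_assoc, mul_smul_comm]
      rw [gen_mul_gen i j]
      simp only [smul_smul]
      congr 1
      ac_rfl
    · simp [Matrix.mul_apply, smul_mul_assoc, mul_smul_comm]
      rw [e1, e2, smul_smul, e3, smul_smul, add_comm]
    · simp [Matrix.mul_apply]
    · simp [Matrix.mul_apply]
      exact gen_mul_gen i j v w)

/-- The differential of the symmetric algebra: the derivation extending `dV`. -/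
noncomputable def diff : GSym A V →ₗ[A] GSym A V where
  toFun x := dMatrix dV x 0 1
  map_add' x y := by simp
  map_smul' a x := by simp

theorem dMatrix_gen (i : ℤ) (v : V i) :
    dMatrix dV (gen A V i v)
      = !![i.negOnePow • gen A V i v, gen A V (i + 1) (dV i v); 0, gen A V i v] := by
  rw [dMatrix, lift_gen]
  rfl

theorem diff_gen (i : ℤ) (v : V i) :
    diff dV (gen A V i v) = gen A V (i + 1) (dV i v) := by
  change dMatrix dV _ 0 1 = _
  rw [dMatrix_gen]
  rfl

theorem span_word (x : GSym A V) : x ∈ Submodule.span A (Set.range (word (A := A) (V := V))) := by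
  classical
  rw [← DirectSum.sum_support_decompose (comp A V) x]
  refine Submodule.sum_mem _ fun i _ => ?_
  refine Submodule.span_mono ?_ (DirectSum.decompose (comp A V) x i).2
  rintro _ ⟨l, -, rfl⟩
  exact ⟨l, rfl⟩

theorem word_induction {P : GSym A V → Prop} (hw : ∀ l, P (word l)) (h0 : P 0)
    (ha : ∀ x y, P x → P y → P (x + y)) (hs : ∀ (a : A) x, P x → P (a • x)) (x : GSym A V) :
    P x := by
  induction span_word x using Submodule.span_induction with
  | mem x h => obtain ⟨l, rfl⟩ := h; exact hw l
  | zero => exact h0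
  | add x y _ _ hx hy => exact ha x y hx hy
  | smul a x _ hx => exact hs a x hx

theorem dMatrix_eq (x : GSym A V) : dMatrix dV x = !![parity x, diff dV x; 0, x] := by
  have key : dMatrix dV x 0 0 = parity x ∧ dMatrix dV x 1 0 = 0 ∧ dMatrix dV x 1 1 = x := by
    refine word_induction (P := fun x => dMatrix dV x 0 0 = parity x ∧ dMatrix dV x 1 0 = 0 ∧
      dMatrix dV x 1 1 = x) ?_ ?_ ?_ ?_ x
    · intro l
      induction l with
      | nil => simp [word_nil]
      | cons p l ih =>
        obtain ⟨i1, i2, i3⟩ := ih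
        simp [word_cons, map_mul, Matrix.mul_apply, dMatrix_gen, parity_gen, i1, i2, i3]
    · simp
    · rintro x y ⟨h1, h2, h3⟩ ⟨k1, k2, k3⟩
      simp [h1, h2, h3, k1, k2, k3]
    · rintro a x ⟨h1, h2, h3⟩
      simp [h1, h2, h3]
  obtain ⟨h1, h2, h3⟩ := key
  ext a b
  fin_cases a <;> fin_cases b
  · simpa using h1
  · rfl
  · simpa using h2
  · simpa using h3

theorem diff_mul (x y : GSym A V) : diff dV (x * y) = diff dV x * y + parity x * diff dV y := by
  change dMatrix dV (x * y) 0 1 = _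
  rw [map_mul, dMatrix_eq, dMatrix_eq]
  simp [Matrix.mul_apply, add_comm]

theorem diff_one : diff dV (1 : GSym A V) = 0 := by
  change dMatrix dV 1 0 1 = 0
  simp

theorem diff_mem {n : ℤ} {x : GSym A V} (hx : x ∈ comp A V n) :
    diff dV x ∈ comp A V (n + 1) := by
  refine comp_induction (P := fun x => diff dV x ∈ comp A V (n + 1)) ?_ ?_ ?_ ?_ hx
  · rintro l rfl
    clear hx
    induction l with
    | nil => rw [word_nil, diff_one]; exact zero_mem _
    | cons p l ih =>
      rw [word_cons, diff_mul, diff_gen, parity_gen, wordDeg_cons]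
      refine add_mem ?_ ?_
      · have := SetLike.mul_mem_graded (gen_mem (A := A) _ (dV p.1 p.2)) (word_mem (A := A) l)
        rwa [add_right_comm] at this
      · have := SetLike.mul_mem_graded (gen_mem (A := A) _ p.2) ih
        rw [smul_mul_assoc, Units.smul_def, add_assoc]
        exact zsmul_mem this _
  · simp
  · intro x y hx hy
    rw [map_add]
    exact add_mem hx hy
  · intro a x hx
    rw [map_smul]
    exact Submodule.smul_mem _ _ hx

theorem diff_diff (hd : ∀ i v, dV (i + 1) (dV i v) = 0) (x : GSym A V) :
    diff dV (diff dV x) = 0 := by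
  refine word_induction (P := fun x => diff dV (diff dV x) = 0) ?_ ?_ ?_ ?_ x
  · intro l
    induction l with
    | nil => rw [word_nil, diff_one, map_zero]
    | cons p l ih =>
      rw [word_cons, diff_mul, diff_gen, parity_gen, map_add, diff_mul, diff_gen, hd, map_zero,
        zero_mul, zero_add, parity_gen, smul_mul_assoc, smul_mul_assoc, Units.smul_def,
        Units.smul_def, map_zsmul, diff_mul, ih, mul_zero, add_zero, diff_gen, Int.negOnePow_succ,
        Units.val_neg, neg_smul, neg_add_cancel]
  · simp
  · intro x y hx hy
    rw [map_add, map_add, hx, hy, add_zero]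
  · intro a x hx
    rw [map_smul, map_smul, hx, smul_zero]

end Differential

end GSym

namespace CDGA

variable {A : Type u} [CommRing A]

/-- The symmetric algebra of a cochain complex `(V, dV)`, with the differential extending `dV`. -/
noncomputable def sym (V : ℤ → Type u) [∀ i, AddCommGroup (V i)] [∀ i, Module A (V i)]
    (dV : ∀ i, V i →ₗ[A] V (i + 1)) (hd : ∀ i v, dV (i + 1) (dV i v) = 0) : CDGA A where
  carrier := GSym A V
  comp := GSym.comp A V
  d := GSym.diff dV
  graded_comm := GSym.graded_comm
  d_mem := GSym.diff_mem dV
  leibniz := by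
    intro i x y hx
    rw [GSym.diff_mul, GSym.parity_of_mem hx, smul_mul_assoc]
  d_d := GSym.diff_diff dV hd

/-- The acyclic algebra `Sym_A (V ⊕ V[1])`: its generators of degree `i` are `V i ⊕ V (i + 1)` and
`d (v ⊕ w) = w ⊕ 0`. -/
noncomputable def acyclicSym (V : ℤ → Type u) [∀ i, AddCommGroup (V i)] [∀ i, Module A (V i)] :
    CDGA A :=
  sym (fun i => V i × V (i + 1))
    (fun i => LinearMap.inl A (V (i + 1)) (V (i + 1 + 1)) ∘ₗ LinearMap.snd A (V i) (V (i + 1)))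
    (by intro i v; simp)

/-- The morphism from `Sym` of a complex to `C` which sends all generators to zero. -/
noncomputable def symZero (V : ℤ → Type u) [∀ i, AddCommGroup (V i)] [∀ i, Module A (V i)]
    (dV : ∀ i, V i →ₗ[A] V (i + 1)) (hd : ∀ i v, dV (i + 1) (dV i v) = 0) (C : CDGA A) :
    Hom (sym V dV hd) C where
  toAlgHom := GSym.lift (fun _ => 0) (by simp)
  map_mem := by
    intro n x hx
    refine GSym.comp_induction (P := fun x => GSym.lift (fun i => (0 : V i →ₗ[A] C.carrier)) _ x ∈
      C.comp n) ?_ ?_ ?_ ?_ hx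
    · rintro l rfl
      cases l with
      | nil => rw [GSym.word_nil, map_one]; exact SetLike.GradedOne.one_mem
      | cons p l => rw [GSym.word_cons, map_mul, GSym.lift_gen]; simp
    · simp
    · intro x y hx hy
      rw [map_add]
      exact add_mem hx hy
    · intro a x hx
      rw [map_smul]
      exact Submodule.smul_mem _ _ hx
  map_d := by
    intro x
    refine GSym.word_induction (P := fun x => GSym.lift (fun i => (0 : V i →ₗ[A] C.carrier)) _
      (GSym.diff dV x) = C.d (GSym.lift (fun i => (0 : V i →ₗ[A] C.carrier)) _ x)) ?_ ?_ ?_ ?_ x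
    · intro l
      cases l with
      | nil => rw [GSym.word_nil, GSym.diff_one, map_one, map_zero, C.d_one]
      | cons p l =>
        rw [GSym.word_cons, GSym.diff_mul, GSym.diff_gen, GSym.parity_gen, smul_mul_assoc,
          Units.smul_def, map_add, map_zsmul, map_mul, map_mul, map_mul, GSym.lift_gen,
          GSym.lift_gen]
        simp
    · simp
    · intro x y hx hy
      rw [map_add, map_add, map_add, map_add, hx, hy]
    · intro a x hx
      rw [map_smul, map_smul, map_smul, map_smul, hx]

end CDGA

/-! ### Tensor products -/

namespace CDGA

variable {A : Type u} [CommRing A]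

/-- The parity involution, equal to `(-1)^i` in degree `i`. -/
noncomputable def parity (E : CDGA A) : E.carrier →ₗ[A] E.carrier :=
  DirectSum.toModule A ℤ E.carrier (fun i => (i.negOnePow : ℤ) • (E.comp i).subtype) ∘ₗ
    (DirectSum.decomposeLinearEquiv E.comp).toLinearMap

theorem parity_of_mem (E : CDGA A) {i : ℤ} {x : E.carrier} (hx : x ∈ E.comp i) :
    E.parity x = i.negOnePow • x := by
  simp only [parity, LinearMap.comp_apply, LinearEquiv.coe_coe,
    DirectSum.decomposeLinearEquiv_apply]
  rw [DirectSum.decompose_of_mem _ hx, ← DirectSum.lof_eq_of A, DirectSum.toModule_lof]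
  rfl

/-- The graded tensor product algebra over `A`, with `(x ⊗ y)(x' ⊗ y') =
(-1)^{deg y deg x'} x x' ⊗ y y'`. -/
abbrev Tens (E F : CDGA A) : Type u := GradedTensorProduct A E.comp F.comp

/-- The tensor `x ⊗ y`. -/
noncomputable abbrev tmul (E F : CDGA A) (x : E.carrier) (y : F.carrier) : Tens E F :=
  GradedTensorProduct.tmul A x y

/-- The component of degree `n` of the tensor product. -/
noncomputable def tensorComp (E F : CDGA A) (n : ℤ) : Submodule A (Tens E F) :=
  Submodule.span A {z | ∃ i j x y, x ∈ E.comp i ∧ y ∈ F.comp j ∧ i + j = n ∧ tmul E F x y = z}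

section

variable {E F : CDGA A}

theorem tmul_mem {i j : ℤ} {x : E.carrier} {y : F.carrier} (hx : x ∈ E.comp i)
    (hy : y ∈ F.comp j) : tmul E F x y ∈ tensorComp E F (i + j) :=
  Submodule.subset_span ⟨i, j, x, y, hx, hy, rfl, rfl⟩

theorem tmul_mul_tmul {j k : ℤ} (x : E.carrier) {y : F.carrier} {x' : E.carrier} (y' : F.carrier)
    (hy : y ∈ F.comp j) (hx' : x' ∈ E.comp k) :
    tmul E F x y * tmul E F x' y' = (j * k).negOnePow • tmul E F (x * x') (y * y') :=
  GradedTensorProduct.tmul_coe_mul_coe_tmul E.comp F.comp x ⟨y, hy⟩ ⟨x', hx'⟩ y'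

theorem tmul_add_left (x x' : E.carrier) (y : F.carrier) :
    tmul E F (x + x') y = tmul E F x y + tmul E F x' y := by
  simp [tmul, GradedTensorProduct.tmul, TensorProduct.add_tmul]

theorem tmul_add_right (x : E.carrier) (y y' : F.carrier) :
    tmul E F x (y + y') = tmul E F x y + tmul E F x y' := by
  simp [tmul, GradedTensorProduct.tmul, TensorProduct.tmul_add]

theorem tmul_units_smul (u v : ℤˣ) (x : E.carrier) (y : F.carrier) :
    tmul E F (u • x) (v • y) = (u * v) • tmul E F x y := by
  rcases Int.units_eq_one_or u with rfl | rfl <;> rcases Int.units_eq_one_or v with rfl | rfl <;>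
    simp [tmul, GradedTensorProduct.tmul, TensorProduct.neg_tmul, TensorProduct.tmul_neg]

theorem tensorComp_induction {n : ℤ} {P : Tens E F → Prop}
    (ht : ∀ i j x y, x ∈ E.comp i → y ∈ F.comp j → i + j = n → P (tmul E F x y)) (h0 : P 0)
    (ha : ∀ x y, P x → P y → P (x + y)) (hs : ∀ (a : A) x, P x → P (a • x))
    {z : Tens E F} (hz : z ∈ tensorComp E F n) : P z := by
  induction hz using Submodule.span_induction with
  | mem x h => obtain ⟨i, j, x, y, hx, hy, hn, rfl⟩ := h; exact ht i j x y hx hy hn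
  | zero => exact h0
  | add x y _ _ hx hy => exact ha x y hx hy
  | smul a x _ hx => exact hs a x hx

theorem tens_induction {P : Tens E F → Prop}
    (ht : ∀ i j x y, x ∈ E.comp i → y ∈ F.comp j → P (tmul E F x y)) (h0 : P 0)
    (ha : ∀ x y, P x → P y → P (x + y)) (z : Tens E F) : P z := by
  have h1 : ∀ (x : E.carrier) (y : F.carrier), P (tmul E F x y) := by
    intro x y
    induction x using DirectSum.Decomposition.inductionOn E.comp with
    | zero => simpa [tmul, GradedTensorProduct.tmul] using h0
    | add x x' hx hx' =>
      rw [tmul_add_left]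
      exact ha _ _ hx hx'
    | @homogeneous i x =>
      induction y using DirectSum.Decomposition.inductionOn F.comp with
      | zero => simpa [tmul, GradedTensorProduct.tmul] using h0
      | add y y' hy hy' =>
        rw [tmul_add_right]
        exact ha _ _ hy hy'
      | @homogeneous j y => exact ht i j x y x.2 y.2
  exact TensorProduct.induction_on (motive := fun z => P (GradedTensorProduct.of A E.comp F.comp z))
    z h0 h1 ha

instance tensorGradedMonoid (E F : CDGA A) : SetLike.GradedMonoid (tensorComp E F) where
  one_mem := by
    have := tmul_mem (E := E) (F := F) (i := 0) (j := 0) SetLike.GradedOne.one_mem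
      SetLike.GradedOne.one_mem
    exact this
  mul_mem := by
    intro m n z w hz hw
    refine tensorComp_induction (P := fun z => z * w ∈ tensorComp E F (m + n)) ?_ ?_ ?_ ?_ hz
    · rintro i j x y hx hy rfl
      refine tensorComp_induction
        (P := fun w => tmul E F x y * w ∈ tensorComp E F (i + j + n)) ?_ ?_ ?_ ?_ hw
      · rintro k l x' y' hx' hy' rfl
        rw [tmul_mul_tmul _ _ hy hx', Units.smul_def]
        have := tmul_mem (SetLike.mul_mem_graded hx hx') (SetLike.mul_mem_graded hy hy')
        rw [add_add_add_comm] at this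
        exact zsmul_mem this _
      · simp
      · intro x y hx hy
        rw [mul_add]
        exact add_mem hx hy
      · intro a x hx
        rw [mul_smul_comm]
        exact Submodule.smul_mem _ _ hx
    · simp
    · intro x y hx hy
      rw [add_mul]
      exact add_mem hx hy
    · intro a x hx
      rw [smul_mul_assoc]
      exact Submodule.smul_mem _ _ hx

/-- Auxiliary bilinear map for the decomposition of the tensor product. -/
noncomputable def tensorDecomposeAux₂ (E F : CDGA A) (i j : ℤ) :
    E.comp i →ₗ[A] F.comp j →ₗ[A] ⨁ n, tensorComp E F n :=
  LinearMap.mk₂ A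
    (fun x y => DirectSum.lof A ℤ (fun n => tensorComp E F n) (i + j)
      ⟨tmul E F x y, tmul_mem x.2 y.2⟩)
    (by
      intro x x' y
      rw [← map_add]
      congr 1
      exact Subtype.ext (by simp [tmul, GradedTensorProduct.tmul, TensorProduct.add_tmul]))
    (by
      intro a x y
      rw [← map_smul]
      congr 1)
    (by
      intro x y y'
      rw [← map_add]
      congr 1
      exact Subtype.ext (by simp [tmul, GradedTensorProduct.tmul, TensorProduct.tmul_add]))
    (by
      intro a x y
      rw [← map_smul]
      congr 1
      exact Subtype.ext (by simp [tmul, GradedTensorProduct.tmul]))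

/-- Auxiliary map for the decomposition of the tensor product. -/
noncomputable def tensorDecomposeAux (E F : CDGA A) :
    Tens E F →ₗ[A] ⨁ n, tensorComp E F n :=
  TensorProduct.lift (DirectSum.toModule A ℤ _ fun i =>
      (DirectSum.toModule A ℤ _ fun j => (tensorDecomposeAux₂ E F i j).flip).flip) ∘ₗ
    (GradedTensorProduct.auxEquiv A E.comp F.comp).toLinearMap

theorem tensorDecomposeAux_tmul {i j : ℤ} {x : E.carrier} {y : F.carrier} (hx : x ∈ E.comp i)
    (hy : y ∈ F.comp j) : tensorDecomposeAux E F (tmul E F x y)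
      = DirectSum.lof A ℤ (fun n => tensorComp E F n) (i + j) ⟨tmul E F x y, tmul_mem hx hy⟩ := by
  rw [tensorDecomposeAux, LinearMap.comp_apply, LinearEquiv.coe_coe,
    GradedTensorProduct.auxEquiv_tmul, DirectSum.decompose_of_mem _ hx,
    DirectSum.decompose_of_mem _ hy, ← DirectSum.lof_eq_of A, ← DirectSum.lof_eq_of A,
    TensorProduct.lift.tmul, DirectSum.toModule_lof, LinearMap.flip_apply, DirectSum.toModule_lof]
  rfl

theorem tensorDecomposeAux_mem {n : ℤ} {z : Tens E F} (hz : z ∈ tensorComp E F n) :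
    ∃ h : z ∈ tensorComp E F n,
      tensorDecomposeAux E F z = DirectSum.lof A ℤ (fun n => tensorComp E F n) n ⟨z, h⟩ := by
  refine tensorComp_induction (P := fun z => ∃ h : z ∈ tensorComp E F n,
      tensorDecomposeAux E F z = DirectSum.lof A ℤ (fun n => tensorComp E F n) n ⟨z, h⟩)
      ?_ ?_ ?_ ?_ hz
  · rintro i j x y hx hy rfl
    exact ⟨tmul_mem hx hy, tensorDecomposeAux_tmul hx hy⟩
  · exact ⟨zero_mem _, by rw [map_zero]; exact (map_zero _).symm⟩
  · rintro x y ⟨hx, ex⟩ ⟨hy, ey⟩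
    exact ⟨add_mem hx hy, by rw [map_add, ex, ey, ← map_add]; rfl⟩
  · rintro a x ⟨hx, ex⟩
    refine ⟨Submodule.smul_mem _ _ hx, ?_⟩
    rw [map_smul, ex, ← map_smul]
    rfl

noncomputable instance tensorDecomposition (E F : CDGA A) :
    DirectSum.Decomposition (tensorComp E F) where
  decompose' := tensorDecomposeAux E F
  left_inv := by
    intro z
    refine tens_induction (P := fun z => DirectSum.coeAddMonoidHom (tensorComp E F)
      (tensorDecomposeAux E F z) = z) ?_ ?_ ?_ z
    · intro i j x y hx hy
      rw [tensorDecomposeAux_tmul hx hy, DirectSum.lof_eq_of, DirectSum.coeAddMonoidHom_of]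
    · simp
    · intro x y hx hy
      rw [map_add, map_add, hx, hy]
  right_inv := by
    intro z
    induction z using DirectSum.induction_on with
    | zero => simp
    | of i x =>
      rw [DirectSum.coeAddMonoidHom_of]
      obtain ⟨h, e⟩ := tensorDecomposeAux_mem x.2
      exact e
    | add x y hx hy => rw [map_add, map_add, hx, hy]

noncomputable instance tensorGradedAlgebra (E F : CDGA A) : GradedAlgebra (tensorComp E F) where

/-- The differential `d (x ⊗ y) = d x ⊗ y + (-1)^{deg x} x ⊗ d y`. -/
noncomputable def tensorD (E F : CDGA A) : Tens E F →ₗ[A] Tens E F :=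
  (GradedTensorProduct.of A E.comp F.comp).toLinearMap ∘ₗ
    (TensorProduct.map E.d LinearMap.id + TensorProduct.map E.parity F.d) ∘ₗ
      (GradedTensorProduct.of A E.comp F.comp).symm.toLinearMap

theorem tensorD_tmul {i : ℤ} {x : E.carrier} (hx : x ∈ E.comp i) (y : F.carrier) :
    tensorD E F (tmul E F x y) = tmul E F (E.d x) y + i.negOnePow • tmul E F x (F.d y) := by
  have h : tensorD E F (tmul E F x y)
      = tmul E F (E.d x) y + tmul E F (E.parity x) (F.d y) := rfl
  rw [h, E.parity_of_mem hx]
  congr 1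

theorem tensor_graded_comm {m n : ℤ} {z w : Tens E F} (hz : z ∈ tensorComp E F m)
    (hw : w ∈ tensorComp E F n) : z * w = (m * n).negOnePow • (w * z) := by
  refine tensorComp_induction (P := fun z => z * w = (m * n).negOnePow • (w * z)) ?_ ?_ ?_ ?_ hz
  · rintro i j x y hx hy rfl
    refine tensorComp_induction (P := fun w => tmul E F x y * w
      = ((i + j) * n).negOnePow • (w * tmul E F x y)) ?_ ?_ ?_ ?_ hw
    · rintro k l x' y' hx' hy' rfl
      rw [tmul_mul_tmul _ _ hy hx', tmul_mul_tmul _ _ hy' hx, E.graded_comm hx hx',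
        F.graded_comm hy hy', tmul_units_smul, smul_smul, smul_smul]
      congr 1
      rw [← Int.negOnePow_add, ← Int.negOnePow_add, ← Int.negOnePow_add, Int.negOnePow_eq_iff]
      exact ⟨-(l * i), by ring⟩
    · simp
    · intro x y hx hy
      rw [mul_add, hx, hy, add_mul x y, smul_add]
    · intro a x hx
      rw [mul_smul_comm, hx, smul_mul_assoc, smul_comm]
  · simp
  · intro x z hx hz
    rw [add_mul, hx, hz, mul_add, smul_add]
  · intro a x hx
    rw [smul_mul_assoc, hx, mul_smul_comm, smul_comm]

theorem tensorD_mem {n : ℤ} {z : Tens E F} (hz : z ∈ tensorComp E F n) :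
    tensorD E F z ∈ tensorComp E F (n + 1) := by
  refine tensorComp_induction (P := fun z => tensorD E F z ∈ tensorComp E F (n + 1))
    ?_ ?_ ?_ ?_ hz
  · rintro i j x y hx hy rfl
    rw [tensorD_tmul hx, Units.smul_def]
    refine add_mem ?_ (zsmul_mem ?_ _)
    · have := tmul_mem (E.d_mem hx) hy
      rwa [add_right_comm] at this
    · have := tmul_mem hx (F.d_mem hy)
      rwa [← add_assoc] at this
  · simp
  · intro x y hx hy
    rw [map_add]
    exact add_mem hx hy
  · intro a x hx
    rw [map_smul]
    exact Submodule.smul_mem _ _ hx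

theorem tensorD_leibniz {n : ℤ} {z : Tens E F} (w : Tens E F) (hz : z ∈ tensorComp E F n) :
    tensorD E F (z * w) = tensorD E F z * w + n.negOnePow • (z * tensorD E F w) := by
  refine tensorComp_induction (P := fun z => tensorD E F (z * w)
    = tensorD E F z * w + n.negOnePow • (z * tensorD E F w)) ?_ ?_ ?_ ?_ hz
  · rintro i j x y hx hy rfl
    refine tens_induction (P := fun w => tensorD E F (tmul E F x y * w)
      = tensorD E F (tmul E F x y) * w + (i + j).negOnePow • (tmul E F x y * tensorD E F w))
      ?_ ?_ ?_ w
    · intro k l x' y' hx' hy'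
      have e1 : tensorD E F ((j * k).negOnePow • tmul E F (x * x') (y * y'))
          = (j * k).negOnePow • tensorD E F (tmul E F (x * x') (y * y')) := by
        rw [Units.smul_def, map_zsmul, ← Units.smul_def]
      have hm : tmul E F x y * (k.negOnePow • tmul E F x' (F.d y'))
          = k.negOnePow • (tmul E F x y * tmul E F x' (F.d y')) := by
        rcases Int.units_eq_one_or k.negOnePow with h | h
        · rw [h, one_smul, one_smul]
        · rw [h, Units.neg_smul, Units.neg_smul, one_smul, one_smul]
          exact (AddMonoidHom.mulLeft (tmul E F x y)).map_neg (tmul E F x' (F.d y'))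
      rw [tmul_mul_tmul _ _ hy hx', e1, tensorD_tmul (SetLike.mul_mem_graded hx hx'),
        E.leibniz x' hx, F.leibniz y' hy, tensorD_tmul hx, tensorD_tmul hx', add_mul, mul_add,
        smul_mul_assoc, hm, tmul_mul_tmul _ _ hy hx',
        tmul_mul_tmul _ _ (F.d_mem hy) hx', tmul_mul_tmul _ _ hy (E.d_mem hx'),
        tmul_mul_tmul _ _ hy hx', tmul_add_left, tmul_add_right]
      have f1 := tmul_units_smul (E := E) (F := F) i.negOnePow 1 (x * E.d x') (y * y')
      have f2 := tmul_units_smul (E := E) (F := F) 1 j.negOnePow (x * x') (y * F.d y')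
      rw [one_smul] at f1 f2
      rw [f1, f2]
      simp only [smul_add, smul_smul]
      have g1 : (j * k).negOnePow * (i + k).negOnePow
          = i.negOnePow * ((j + 1) * k).negOnePow := by
        rw [← Int.negOnePow_add, ← Int.negOnePow_add]
        congr 1
        ring
      have g2 : (j * k).negOnePow * (i.negOnePow * 1)
          = (i + j).negOnePow * (j * (k + 1)).negOnePow := by
        rw [mul_one, ← Int.negOnePow_add, ← Int.negOnePow_add, Int.negOnePow_eq_iff]
        exact ⟨-j, by ring⟩
      have g3 : (j * k).negOnePow * ((i + k).negOnePow * (1 * j.negOnePow))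
          = (i + j).negOnePow * (k.negOnePow * (j * k).negOnePow) := by
        rw [one_mul, ← Int.negOnePow_add, ← Int.negOnePow_add, ← Int.negOnePow_add,
          ← Int.negOnePow_add]
        congr 1
        ring
      rw [g1, g2, g3]
      abel
    · simp
    · intro x y hx hy
      rw [mul_add, map_add, hx, hy, mul_add, map_add, mul_add, smul_add]
      abel
  · simp
  · intro x y hx hy
    rw [add_mul, map_add, hx, hy, map_add, add_mul, add_mul, smul_add]
    abel
  · intro a x hx
    rw [smul_mul_assoc, map_smul, hx, map_smul, smul_mul_assoc, smul_mul_assoc, smul_add,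
      smul_comm a]

theorem tensorD_tensorD (z : Tens E F) : tensorD E F (tensorD E F z) = 0 := by
  refine tens_induction (P := fun z => tensorD E F (tensorD E F z) = 0) ?_ ?_ ?_ z
  · intro i j x y hx hy
    rw [tensorD_tmul hx, map_add, tensorD_tmul (E.d_mem hx), Units.smul_def, Units.smul_def,
      map_zsmul, tensorD_tmul hx, E.d_d, F.d_d, Int.negOnePow_succ]
    simp [tmul, GradedTensorProduct.tmul]
  · simp
  · intro x y hx hy
    rw [map_add, map_add, hx, hy, add_zero]

end

/-- The tensor product over `A` of commutative differential graded algebras. -/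
noncomputable def tensor (E F : CDGA A) : CDGA A where
  carrier := Tens E F
  comp := tensorComp E F
  d := tensorD E F
  graded_comm := tensor_graded_comm
  d_mem := tensorD_mem
  leibniz := tensorD_leibniz
  d_d := tensorD_tensorD

end CDGA

namespace CDGA

variable {A : Type u} [CommRing A]

/-- The inclusion `E → E ⊗ F`, `x ↦ x ⊗ 1`. -/
noncomputable def inclLeft (E F : CDGA A) : Hom E (tensor E F) where
  toAlgHom := GradedTensorProduct.includeLeft E.comp F.comp
  map_mem := by
    intro i x hx
    have := tmul_mem (F := F) hx SetLike.GradedOne.one_mem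
    rwa [add_zero] at this
  map_d := by
    intro x
    change tmul E F (E.d x) 1
      = tmul E F (E.d x) 1 + tmul E F (E.parity x) (F.d 1)
    rw [F.d_one]
    simp [tmul, GradedTensorProduct.tmul]

/-- The morphism `E ⊗ F → C`, `x ⊗ y ↦ f x * g y`. -/
noncomputable def tensorLift {E F C : CDGA A} (f : Hom E C) (g : Hom F C) :
    Hom (tensor E F) C where
  toAlgHom := GradedTensorProduct.lift E.comp F.comp f.toAlgHom g.toAlgHom (by
    intro i j a b
    have := C.graded_comm (f.map_mem a.2) (g.map_mem b.2)
    rw [mul_comm] at this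
    exact this)
  map_mem := by
    intro n z hz
    refine tensorComp_induction (P := fun z =>
      GradedTensorProduct.lift E.comp F.comp f.toAlgHom g.toAlgHom _ z ∈ C.comp n) ?_ ?_ ?_ ?_ hz
    · rintro i j x y hx hy rfl
      exact SetLike.mul_mem_graded (f.map_mem hx) (g.map_mem hy)
    · simp
    · intro x y hx hy
      rw [map_add]
      exact add_mem hx hy
    · intro a x hx
      rw [map_smul]
      exact Submodule.smul_mem _ _ hx
  map_d := by
    intro z
    refine tens_induction (P := fun z =>
      GradedTensorProduct.lift E.comp F.comp f.toAlgHom g.toAlgHom _ (tensorD E F z)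
        = C.d (GradedTensorProduct.lift E.comp F.comp f.toAlgHom g.toAlgHom _ z)) ?_ ?_ ?_ z
    · intro i j x y hx hy
      rw [tensorD_tmul hx, Units.smul_def, map_add, map_zsmul]
      change f (E.d x) * g y + (i.negOnePow : ℤ) • (f x * g (F.d y)) = C.d (f x * g y)
      rw [C.leibniz _ (f.map_mem hx), f.map_d, g.map_d, Units.smul_def]
    · simp
    · intro x y hx hy
      rw [map_add, map_add, map_add, map_add, hx, hy]

/-- `E ⊗ Sym_A (V ⊕ V[1])`. -/
noncomputable def stab (E : CDGA A) (V : ℤ → Type u) [∀ i, AddCommGroup (V i)]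
    [∀ i, Module A (V i)] : CDGA A :=
  tensor E (acyclicSym V)

/-- The inclusion `E → E ⊗ Sym_A (V ⊕ V[1])`, `x ↦ x ⊗ 1`. -/
noncomputable def stabIncl (E : CDGA A) (V : ℤ → Type u) [∀ i, AddCommGroup (V i)]
    [∀ i, Module A (V i)] : Hom E (E.stab V) :=
  inclLeft E (acyclicSym V)

/-- The extension of `p : E → C` to `E ⊗ Sym_A (V ⊕ V[1])` sending `V ⊕ V[1]` to zero. -/
noncomputable def stabProj {E C : CDGA A} (p : Hom E C) (V : ℤ → Type u)
    [∀ i, AddCommGroup (V i)] [∀ i, Module A (V i)] : Hom (E.stab V) C :=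
  tensorLift p (symZero _ _ _ C)

/-! ### Tate resolutions -/

/-- `E` is, as a graded algebra, isomorphic to the symmetric algebra of the negatively graded
projective module `⨁ i, P i`. -/
structure IsSemiFreeOn (E : CDGA A) (P : ℤ → Type u) [∀ i, AddCommGroup (P i)]
    [∀ i, Module A (P i)] : Prop where
  negative : ∀ i, 0 ≤ i → Subsingleton (P i)
  projective : ∀ i, Module.Projective A (P i)
  exists_equiv : ∃ e : GSym A P ≃ₐ[A] E.carrier, ∀ i x, x ∈ GSym.comp A P i ↔ e x ∈ E.comp i

/-- Semi-free algebras. -/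
def IsSemiFree (E : CDGA A) : Prop :=
  ∃ (P : ℤ → Type u) (_ : ∀ i, AddCommGroup (P i)) (_ : ∀ i, Module A (P i)), E.IsSemiFreeOn P

/-- `p : E → C` is a Tate resolution: a quasi-isomorphism from a semi-free object of `C_A`. -/
structure IsTateResolution {E C : CDGA A} (p : Hom E C) : Prop where
  inCA : E.InCA
  semiFree : E.IsSemiFree
  quasiIso : p.IsQuasiIso

/-- A morphism of Tate resolutions is a morphism of algebras compatible with the maps to `C`. -/
def IsOver {E F C : CDGA A} (pE : Hom E C) (pF : Hom F C) (f : Hom E F) : Prop :=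
  ∀ x, pF (f x) = pE x

/-- `f` restricts to isomorphisms `E^i → F^i` in all degrees `i ≥ m`. -/
def Hom.IsIsoGE {E F : CDGA A} (f : Hom E F) (m : ℤ) : Prop :=
  ∀ i, m ≤ i → Set.BijOn f (E.comp i) (F.comp i)

/-- The graph of `f` on homogeneous elements of degree `≥ m`. -/
def Hom.graphGE {E F : CDGA A} (f : Hom E F) (m : ℤ) (x : E.carrier) (y : F.carrier) : Prop :=
  ∃ i, m ≤ i ∧ x ∈ E.comp i ∧ y = f x

/-- An isomorphism `E ⊗ Sym_A (V ⊕ V[1]) ≅ F ⊗ Sym_A (W ⊕ W[1])` which maps `x ⊗ 1` to `y ⊗ 1`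
for all pairs `(x, y)` in the relation `r`, where `V` and `W` are concentrated in degrees `≤ n`
and `< 0`. -/
def StableIso (E F : CDGA A) (n : ℤ) (r : E.carrier → F.carrier → Prop)
    (V W : ℤ → Type u) [∀ i, AddCommGroup (V i)] [∀ i, Module A (V i)]
    [∀ i, AddCommGroup (W i)] [∀ i, Module A (W i)] : Prop :=
  (∀ i, n < i ∨ 0 ≤ i → Subsingleton (V i) ∧ Subsingleton (W i)) ∧
  ∃ Φ : Iso (E.stab V) (F.stab W), ∀ x y, r x y → Φ.hom (E.stabIncl V x) = F.stabIncl W y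

/-- Existence of a stable isomorphism with projective `V` and `W` of finite rank in each degree,
both sides being objects of `C_A`. -/
def StablyIsoProjective (E F : CDGA A) (n : ℤ) (r : E.carrier → F.carrier → Prop) : Prop :=
  ∃ (V : ℤ → Type u) (_ : ∀ i, AddCommGroup (V i)) (_ : ∀ i, Module A (V i))
    (W : ℤ → Type u) (_ : ∀ i, AddCommGroup (W i)) (_ : ∀ i, Module A (W i)),
    (∀ i, Module.Projective A (V i) ∧ Module.Finite A (V i)) ∧
    (∀ i, Module.Projective A (W i) ∧ Module.Finite A (W i)) ∧
    (E.stab V).InCA ∧ (F.stab W).InCA ∧ StableIso E F n r V W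

/-- Existence of a stable isomorphism with free `V` and `W` of finite rank in each degree, both
sides being objects of `C_A`. -/
def StablyIsoFiniteFree (E F : CDGA A) (n : ℤ) (r : E.carrier → F.carrier → Prop) : Prop :=
  ∃ (V : ℤ → Type u) (_ : ∀ i, AddCommGroup (V i)) (_ : ∀ i, Module A (V i))
    (W : ℤ → Type u) (_ : ∀ i, AddCommGroup (W i)) (_ : ∀ i, Module A (W i)),
    (∀ i, Module.Free A (V i) ∧ Module.Finite A (V i)) ∧
    (∀ i, Module.Free A (W i) ∧ Module.Finite A (W i)) ∧
    (E.stab V).InCA ∧ (F.stab W).InCA ∧ StableIso E F n r V W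

/-- Existence of a stable isomorphism with free `V` and `W`, not necessarily of finite rank. -/
def StablyIsoFree (E F : CDGA A) (n : ℤ) (r : E.carrier → F.carrier → Prop) : Prop :=
  ∃ (V : ℤ → Type u) (_ : ∀ i, AddCommGroup (V i)) (_ : ∀ i, Module A (V i))
    (W : ℤ → Type u) (_ : ∀ i, AddCommGroup (W i)) (_ : ∀ i, Module A (W i)),
    (∀ i, Module.Free A (V i)) ∧ (∀ i, Module.Free A (W i)) ∧ StableIso E F n r V W

/-- `E` and `F` can be presented as symmetric algebras on negatively graded projective modules
whose components of degrees `i` with `S i` are free. -/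
def HaveFreeGenerators (E F : CDGA A) (S : ℤ → Prop) : Prop :=
  ∃ (P : ℤ → Type u) (_ : ∀ i, AddCommGroup (P i)) (_ : ∀ i, Module A (P i))
    (Q : ℤ → Type u) (_ : ∀ i, AddCommGroup (Q i)) (_ : ∀ i, Module A (Q i)),
    E.IsSemiFreeOn P ∧ F.IsSemiFreeOn Q ∧ ∀ i, S i → Module.Free A (P i) ∧ Module.Free A (Q i)

/-- For `V`, `W` concentrated in degree `-d`: the algebras `E ⊗ Sym_A (V ⊕ V[1])` and
`F ⊗ Sym_A (W ⊕ W[1])` are Tate resolutions of `C`, and there is a morphism of Tate resolutions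
between them which is an isomorphism in degrees `≥ -d` and coincides with `f` on the subalgebra
generated by the elements of degree `≥ -(d - 1)`. -/
def ExtendsInDegree {E F C : CDGA A} (pE : Hom E C) (pF : Hom F C) (f : Hom E F) (d : ℕ)
    (V W : ℤ → Type u) [∀ i, AddCommGroup (V i)] [∀ i, Module A (V i)]
    [∀ i, AddCommGroup (W i)] [∀ i, Module A (W i)] : Prop :=
  (∀ i, i ≠ -(d : ℤ) → Subsingleton (V i) ∧ Subsingleton (W i)) ∧
  IsTateResolution (stabProj pE V) ∧ IsTateResolution (stabProj pF W) ∧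
  ∃ g : Hom (E.stab V) (F.stab W), IsOver (stabProj pE V) (stabProj pF W) g ∧
    g.IsIsoGE (-(d : ℤ)) ∧
    ∀ x ∈ E.subalgebraGE (-((d : ℤ) - 1)), g (E.stabIncl V x) = F.stabIncl W (f x)

end CDGA

/-! The proof builds an isomorphism of semi-free algebras by descending induction on the degree. It
keeps a pair of graded homomorphisms `f`, `g` between `X` and `Y` which commute with the
differentials and are mutually inverse in all degrees above `k`; below, nothing is required of them.
Such a pair can be carried to degree `k` if the generators of degree `k` of both algebras are the
same module `W × V`, where `V` consists of cocycles in `X` and `W` of cocycles in `Y`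
(`InverseGE.exists_step`). Indeed `f ∘ d` on the `W`-generators of `X` takes values in cocycles of
`Y` killed by the map to `C`, hence in boundaries, and lifts to some `f0` because `W` is projective;
likewise `g ∘ d` on the `V`-generators of `Y` lifts to some `h0`. Modulo decomposable elements the
new `f` is the product of the two unipotent matrices with off-diagonal entries `f0` and `-h0`, and
the new `g` is the inverse product. This is the mechanism of Schanuel's lemma. The decomposable
parts of `f0` and `h0` are kept under control by algebra endomorphisms which kill one summand of the
generators.

Stabilization produces such a common splitting. The generators of degree `i` become `P i × V i × V
(i+1)` on one side and `Q i × W i × W (i+1)` on the other, with `V i` and `W i` closed. If `V i ≅ (Q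
i × W (i+1)) × L i` and `W i ≅ (P i × V (i+1)) × L i`, then both modules are `W i × (Q i × W
(i+1))`, with the second factor closed on the left and the first factor closed on the right
(`exists_iso_stab`). For `L = 0` these equations are a recursion which preserves projectivity,
finiteness and freeness (`exists_alternating`). A large free module which absorbs all `P i` and `Q
i` solves them by an Eilenberg swindle (`exists_absorbing`).

Stabilization does not change cohomology: `Sym (V ⊕ V[1])` has a derivation `s` such that `d s + s
d` multiplies words by their length, and over `ℚ` one can divide by positive lengths
(`exists_contraction`). Compatibility with the maps to `C` is automatic, because a semi-free algebra
is generated by `A` in degree zero and `C` has no other degrees (`Generators.isOver`).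

The statements (1), (3) and (4) differ only in the degree in which the induction starts. Statement
(2) is a single step of the induction, after which the map is continued to lower degrees as a mere
morphism by obstruction theory (`Generators.exists_hom`). -/

namespace GSym

/-! ### Graded homomorphisms out of semi-free algebras, controlled degree by degree. -/

variable {A : Type u} [CommRing A] {V : ℤ → Type u} [∀ i, AddCommGroup (V i)]
  [∀ i, Module A (V i)]

theorem lift_mem {X : CDGA A} {f : ∀ i, V i →ₗ[A] X.carrier}
    (hf : ∀ i v, f i v ∈ X.comp i)
    (hc : ∀ i j v w, f i v * f j w = (i * j).negOnePow • (f j w * f i v)) {n : ℤ} {x : GSym A V}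
    (hx : x ∈ comp A V n) : lift f hc x ∈ X.comp n := by
  refine comp_induction (P := fun x => lift f hc x ∈ X.comp n) ?_ ?_ ?_ ?_ hx
  · rintro l rfl
    clear hx
    induction l with
    | nil => rw [word_nil, map_one]; exact SetLike.GradedOne.one_mem
    | cons p l ih =>
      rw [word_cons, map_mul, lift_gen, wordDeg_cons]
      exact SetLike.mul_mem_graded (hf _ _) ih
  · rw [map_zero]
    exact zero_mem _
  · intro x y hx hy
    rw [map_add]
    exact add_mem hx hy
  · intro a x hx
    rw [map_smul]
    exact Submodule.smul_mem _ _ hx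

/-- If the generators have negative degrees, then the component of degree `n` is built from words
in generators of degrees at least `n`. -/
theorem comp_induction_ge (hV : ∀ i, 0 ≤ i → Subsingleton (V i)) {m : ℤ} {P : GSym A V → Prop}
    (h1 : P 1) (hmul : ∀ j, m ≤ j → j < 0 → ∀ (v : V j) x, P x → P (gen A V j v * x)) (h0 : P 0)
    (ha : ∀ x y, P x → P y → P (x + y)) (hs : ∀ (a : A) x, P x → P (a • x))
    {n : ℤ} (hn : m ≤ n) {x : GSym A V} (hx : x ∈ comp A V n) : P x := by
  -- A word with a letter of non-negative degree vanishes. In all other words every letter and every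
  -- tail has degree at most zero, so neither can have smaller degree than the whole word.
  have key : ∀ l : List (Σ i, V i), (word l : GSym A V) = 0 ∨
      (wordDeg l ≤ 0 ∧ (m ≤ wordDeg l → P (word l))) := by
    intro l
    induction l with
    | nil => exact Or.inr ⟨le_rfl, fun _ => h1⟩
    | cons p l ih =>
      rcases le_or_gt 0 p.1 with hp | hp
      · have := hV _ hp
        left
        rw [word_cons, Subsingleton.elim p.2 0, map_zero, zero_mul]
      · rcases ih with ih | ⟨ih1, ih2⟩
        · left
          rw [word_cons, ih, mul_zero]
        · right
          rw [wordDeg_cons, word_cons]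
          exact ⟨by omega, fun h => hmul _ (by omega) hp _ _ (ih2 (by omega))⟩
  refine comp_induction (P := P) ?_ h0 ha hs hx
  rintro l rfl
  rcases key l with h | ⟨-, h⟩
  · rw [h]
    exact h0
  · exact h hn

theorem eq_zero_of_mem_pos (hV : ∀ i, 0 ≤ i → Subsingleton (V i)) {n : ℤ} (hn : 0 < n)
    {x : GSym A V} (hx : x ∈ comp A V n) : x = 0 := by
  have h : ∀ l : List (Σ i, V i), (word l : GSym A V) = 0 ∨ wordDeg l ≤ 0 := by
    intro l
    induction l with
    | nil => exact Or.inr le_rfl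
    | cons p l ih =>
      rcases le_or_gt 0 p.1 with hp | hp
      · have := hV _ hp
        left
        rw [word_cons, Subsingleton.elim p.2 0, map_zero, zero_mul]
      · rcases ih with ih | ih
        · left
          rw [word_cons, ih, mul_zero]
        · right
          rw [wordDeg_cons]
          omega
  refine comp_induction (P := fun x => x = (0 : GSym A V)) ?_ rfl ?_ ?_ hx
  · rintro l rfl
    rcases h l with h | h
    · exact h
    · omega
  · rintro _ _ rfl rfl
    exact add_zero _
  · rintro a _ rfl
    exact smul_zero a

end GSym

namespace CDGA

variable {A : Type u} [CommRing A]

/-- Homomorphisms of the underlying graded algebras. -/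
structure GradedHom (X Y : CDGA A) where
  toAlgHom : X.carrier →ₐ[A] Y.carrier
  map_mem : ∀ {i : ℤ} {x : X.carrier}, x ∈ X.comp i → toAlgHom x ∈ Y.comp i

instance (X Y : CDGA A) : CoeFun (GradedHom X Y) (fun _ => X.carrier → Y.carrier) :=
  ⟨fun f => f.toAlgHom⟩

/-- The homomorphism of graded algebras underlying a morphism. -/
def Hom.toGradedHom {X Y : CDGA A} (f : Hom X Y) : GradedHom X Y := ⟨f.toAlgHom, f.map_mem⟩

/-- The composition of homomorphisms of graded algebras. -/
def GradedHom.comp {X Y Z : CDGA A} (g : GradedHom Y Z) (f : GradedHom X Y) : GradedHom X Z where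
  toAlgHom := g.toAlgHom.comp f.toAlgHom
  map_mem hx := g.map_mem (f.map_mem hx)

variable (A) in
/-- The identity. -/
def GradedHom.id (X : CDGA A) : GradedHom X X := ⟨AlgHom.id A _, fun h => h⟩

theorem GradedHom.comp_apply {X Y Z : CDGA A} (g : GradedHom Y Z) (f : GradedHom X Y)
    (x : X.carrier) : g.comp f x = g (f x) := rfl

/-- A presentation of the graded algebra underlying `X` as a symmetric algebra on negatively graded
generators. -/
structure Generators (X : CDGA A) (P : ℤ → Type u) [∀ i, AddCommGroup (P i)]
    [∀ i, Module A (P i)] where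
  equiv : GSym A P ≃ₐ[A] X.carrier
  mem_iff : ∀ i x, x ∈ GSym.comp A P i ↔ equiv x ∈ X.comp i
  negative : ∀ i, 0 ≤ i → Subsingleton (P i)

theorem IsSemiFreeOn.nonempty_generators {X : CDGA A} {P : ℤ → Type u} [∀ i, AddCommGroup (P i)]
    [∀ i, Module A (P i)] (h : X.IsSemiFreeOn P) : Nonempty (X.Generators P) := by
  obtain ⟨e, he⟩ := h.exists_equiv
  exact ⟨⟨e, he, h.negative⟩⟩

namespace Generators

variable {X Y : CDGA A} {P : ℤ → Type u} [∀ i, AddCommGroup (P i)] [∀ i, Module A (P i)]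
  (G : X.Generators P)

/-- The inclusion of the generators of degree `i`. -/
noncomputable def ι (i : ℤ) : P i →ₗ[A] X.carrier :=
  G.equiv.toLinearMap ∘ₗ GSym.gen A P i

theorem ι_mem (i : ℤ) (p : P i) : G.ι i p ∈ X.comp i := (G.mem_iff _ _).1 (GSym.gen_mem i p)

/-- The homomorphism with given values on the generators. -/
noncomputable def lift (f : ∀ i, P i →ₗ[A] Y.carrier) (hf : ∀ i p, f i p ∈ Y.comp i) :
    GradedHom X Y where
  toAlgHom := (GSym.lift f fun i j v w => Y.graded_comm (hf i v) (hf j w)).comp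
    G.equiv.symm.toAlgHom
  map_mem := by
    intro i x hx
    refine GSym.lift_mem hf _ ((G.mem_iff _ _).2 ?_)
    simpa using hx

@[simp]
theorem lift_ι (f : ∀ i, P i →ₗ[A] Y.carrier) (hf : ∀ i p, f i p ∈ Y.comp i) (i : ℤ) (p : P i) :
    G.lift f hf (G.ι i p) = f i p := by
  change GSym.lift f _ (G.equiv.symm (G.equiv (GSym.gen A P i p))) = _
  rw [AlgEquiv.symm_apply_apply, GSym.lift_gen]

theorem induction {m : ℤ} {Q : X.carrier → Prop}
    (h1 : Q 1) (hmul : ∀ j, m ≤ j → j < 0 → ∀ (p : P j) x, Q x → Q (G.ι j p * x)) (h0 : Q 0)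
    (ha : ∀ x y, Q x → Q y → Q (x + y)) (hs : ∀ (a : A) x, Q x → Q (a • x))
    {n : ℤ} (hn : m ≤ n) {x : X.carrier} (hx : x ∈ X.comp n) : Q x := by
  obtain ⟨y, rfl⟩ := G.equiv.surjective x
  refine GSym.comp_induction_ge G.negative (m := m) (P := fun y => Q (G.equiv y)) ?_ ?_ ?_ ?_ ?_ hn
    ((G.mem_iff _ _).2 hx)
  · rw [map_one]; exact h1
  · intro j hj hj' v x hx
    rw [map_mul]
    exact hmul j hj hj' v _ hx
  · rw [map_zero]; exact h0
  · intro x y hx hy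
    rw [map_add]
    exact ha _ _ hx hy
  · intro a x hx
    rw [map_smul]
    exact hs _ _ hx

include G in
theorem comp_pos (n : ℤ) (hn : 0 < n) : X.comp n = ⊥ := by
  rw [eq_bot_iff]
  intro x hx
  obtain ⟨y, rfl⟩ := G.equiv.surjective x
  rw [GSym.eq_zero_of_mem_pos G.negative hn ((G.mem_iff _ _).2 hx), map_zero]
  exact zero_mem _

include G in
theorem mem_comp_zero {x : X.carrier} (hx : x ∈ X.comp 0) : ∃ a : A, x = algebraMap A _ a := by
  refine G.induction (m := 0) (Q := fun x => ∃ a : A, x = algebraMap A _ a) ?_ ?_ ?_ ?_ ?_ le_rfl hx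
  · exact ⟨1, (map_one _).symm⟩
  · intro j h1 h2
    omega
  · exact ⟨0, (map_zero _).symm⟩
  · rintro _ _ ⟨a, rfl⟩ ⟨b, rfl⟩
    exact ⟨a + b, (map_add _ _ _).symm⟩
  · rintro a _ ⟨b, rfl⟩
    exact ⟨a * b, by rw [map_mul, Algebra.smul_def]⟩

/-- Homomorphisms which agree on the generators of degree at least `m` agree in all degrees at
least `m`. -/
theorem ext {f g : GradedHom X Y} {m : ℤ}
    (h : ∀ j, m ≤ j → j < 0 → ∀ p, f (G.ι j p) = g (G.ι j p)) {n : ℤ} (hn : m ≤ n) {x : X.carrier}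
    (hx : x ∈ X.comp n) : f x = g x := by
  refine G.induction (m := m) (Q := fun x => f x = g x) ?_ ?_ ?_ ?_ ?_ hn hx
  · rw [map_one, map_one]
  · intro j hj hj' p x hx
    rw [map_mul, map_mul, h j hj hj', hx]
  · rw [map_zero, map_zero]
  · intro x y hx hy
    rw [map_add, map_add, hx, hy]
  · intro a x hx
    rw [map_smul, map_smul, hx]

/-- A homomorphism commutes with the differential in degrees at least `m` if it does so on the
generators. -/
theorem map_d {f : GradedHom X Y} {m : ℤ}
    (h : ∀ j, m ≤ j → j < 0 → ∀ p, f (X.d (G.ι j p)) = Y.d (f (G.ι j p))) {n : ℤ} (hn : m ≤ n)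
    {x : X.carrier} (hx : x ∈ X.comp n) : f (X.d x) = Y.d (f x) := by
  refine G.induction (m := m) (Q := fun x => f (X.d x) = Y.d (f x)) ?_ ?_ ?_ ?_ ?_ hn hx
  · rw [X.d_one, map_zero, map_one, Y.d_one]
  · intro j hj hj' p x hx
    rw [X.leibniz _ (G.ι_mem j p), map_mul f.toAlgHom (G.ι j p) x,
      Y.leibniz _ (f.map_mem (G.ι_mem j p)), map_add, map_mul, h j hj hj', Units.smul_def,
      Units.smul_def, map_zsmul, map_mul, hx]
  · rw [map_zero, map_zero, map_zero]
  · intro x y hx hy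
    rw [map_add, map_add, map_add, map_add, hx, hy]
  · intro a x hx
    rw [map_smul, map_smul, map_smul, map_smul, hx]

include G in
/-- A homomorphism is compatible with morphisms to an algebra concentrated in degree zero. -/
theorem isOver {C : CDGA A} (hC : C.ConcentratedInDegreeZero) (pX : Hom X C) (pY : Hom Y C)
    (f : GradedHom X Y) (x : X.carrier) : pY (f x) = pX x := by
  induction x using DirectSum.Decomposition.inductionOn X.comp with
  | zero => rw [map_zero, map_zero, map_zero]
  | add x y hx hy => rw [map_add, map_add, map_add, hx, hy]
  | @homogeneous i x =>
    by_cases hi : i = 0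
    · subst hi
      obtain ⟨a, ha⟩ := G.mem_comp_zero x.2
      rw [ha, AlgHom.commutes, AlgHom.commutes, AlgHom.commutes]
    · have h1 := pY.map_mem (f.map_mem x.2)
      have h2 := pX.map_mem x.2
      rw [hC i hi, Submodule.mem_bot] at h1 h2
      rw [h1, h2]

end Generators

/-- The gluing of a sequence of homomorphisms which stabilizes in each degree. -/
theorem Generators.exists_limit {X Y : CDGA A} {P : ℤ → Type u} [∀ i, AddCommGroup (P i)]
    [∀ i, Module A (P i)] (G : X.Generators P) (k : ℤ) (f : ℕ → GradedHom X Y)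
    (hf : ∀ (n : ℕ) i x, k - n ≤ i → x ∈ X.comp i → f (n + 1) x = f n x) :
    ∃ g : GradedHom X Y, ∀ (n : ℕ) i x, k - n ≤ i → x ∈ X.comp i → g x = f n x := by
  have key : ∀ m n : ℕ, m ≤ n → ∀ i x, k - m ≤ i → x ∈ X.comp i → f n x = f m x := by
    intro m n hmn
    induction n, hmn using Nat.le_induction with
    | base => intros; rfl
    | succ n hn ih =>
      intro i x hi hx
      rw [hf n i x (by omega) hx, ih i x hi hx]
  -- `(k - i).toNat` is the first stage `n` with `k - n ≤ i`, from which on the values in degree `i`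
  -- no longer change.
  refine ⟨G.lift (fun i => (f (k - i).toNat).toAlgHom.toLinearMap ∘ₗ G.ι i)
    (fun i p => (f _).map_mem (G.ι_mem i p)), ?_⟩
  intro n i x hi hx
  refine G.ext (m := k - n) ?_ hi hx
  intro j hj _ p
  exact (G.lift_ι _ _ j p).trans (key _ n (by omega) j _ (by omega) (G.ι_mem j p)).symm

end CDGA

/-! ### Obstruction theory: lifting through differentials and extending homomorphisms by one degree.
-/

namespace CDGA

variable {A : Type u} [CommRing A]

/-- Every cocycle killed by `p` is a coboundary. -/
def Hom.KernelAcyclic {X C : CDGA A} (p : Hom X C) : Prop :=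
  ∀ i x, x ∈ X.comp i → X.d x = 0 → p x = 0 → ∃ y ∈ X.comp (i - 1), X.d y = x

/-- Injectivity on cohomology is enough: a cocycle killed by `p` has class zero in `C`. The
construction of homomorphisms uses quasi-isomorphisms only in this form. -/
theorem Hom.IsQuasiIso.kernelAcyclic {X C : CDGA A} {p : Hom X C} (h : p.IsQuasiIso) :
    p.KernelAcyclic := by
  intro i x hx hd hp
  have hx' : x ∈ X.cocycles i := ⟨hx, hd⟩
  have h0 : p.cohomologyMap i (Submodule.Quotient.mk ⟨x, hx'⟩) = 0 := by
    rw [Hom.cohomologyMap, Submodule.mapQ_apply]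
    have : p.cocyclesMap i ⟨x, hx'⟩ = 0 := Subtype.ext hp
    rw [this]
    rfl
  have h1 := (h i).1 (h0.trans (map_zero _).symm)
  rw [Submodule.Quotient.mk_eq_zero] at h1
  obtain ⟨y, hy, hxy⟩ := h1
  exact ⟨y, hy, hxy⟩

/-- Acyclicity makes each single value of `φ` a boundary; projectivity of `M` lets the preimages be
chosen linearly. -/
theorem Hom.KernelAcyclic.exists_lift {Y C : CDGA A} {p : Hom Y C} (hp : p.KernelAcyclic)
    {M : Type u} [AddCommGroup M] [Module A M] [Module.Projective A M] (φ : M →ₗ[A] Y.carrier)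
    {k : ℤ} (h1 : ∀ m, φ m ∈ Y.comp (k + 1)) (h2 : ∀ m, Y.d (φ m) = 0) (h3 : ∀ m, p (φ m) = 0) :
    ∃ f : M →ₗ[A] Y.carrier, ∀ m, f m ∈ Y.comp k ∧ Y.d (f m) = φ m := by
  let D : Y.comp k →ₗ[A] (Y.comp k).map Y.d :=
    (Y.d.domRestrict (Y.comp k)).codRestrict _ fun y => ⟨y, y.2, rfl⟩
  have hD : Function.Surjective D := by
    rintro ⟨_, y, hy, rfl⟩
    exact ⟨⟨y, hy⟩, rfl⟩
  have hφ : ∀ m, φ m ∈ (Y.comp k).map Y.d := by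
    intro m
    obtain ⟨y, hy, e⟩ := hp _ _ (h1 m) (h2 m) (h3 m)
    rw [add_sub_cancel_right] at hy
    exact ⟨y, hy, e⟩
  obtain ⟨f, hf⟩ := Module.projective_lifting_property D (φ.codRestrict _ hφ) hD
  refine ⟨(Y.comp k).subtype ∘ₗ f, fun m => ⟨(f m).2, ?_⟩⟩
  exact congrArg Subtype.val (LinearMap.congr_fun hf m)

namespace Generators

variable {X Y : CDGA A} {P Q : ℤ → Type u} [∀ i, AddCommGroup (P i)] [∀ i, Module A (P i)]
  [∀ i, AddCommGroup (Q i)] [∀ i, Module A (Q i)]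

/-- A homomorphism can be changed arbitrarily on the generators of degree `k` without changing it in
higher degrees. -/
theorem exists_extension (G : X.Generators P) (f : GradedHom X Y) (k : ℤ)
    (φ : P k →ₗ[A] Y.carrier) (hφ : ∀ p, φ p ∈ Y.comp k) :
    ∃ g : GradedHom X Y, (∀ i x, k < i → x ∈ X.comp i → g x = f x) ∧
      ∀ p, g (G.ι k p) = φ p := by
  classical
  let ψ : ∀ i, P i →ₗ[A] Y.carrier :=
    Function.update (fun i => f.toAlgHom.toLinearMap ∘ₗ G.ι i) k φ
  have hψk : ψ k = φ := Function.update_self ..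
  have hψ : ∀ i, i ≠ k → ψ i = f.toAlgHom.toLinearMap ∘ₗ G.ι i :=
    fun i hi => Function.update_of_ne hi ..
  have hm : ∀ i p, ψ i p ∈ Y.comp i := by
    intro i p
    by_cases hi : i = k
    · subst hi
      rw [hψk]
      exact hφ p
    · rw [hψ i hi]
      exact f.map_mem (G.ι_mem i p)
  refine ⟨G.lift ψ hm, ?_, ?_⟩
  · intro i x hi hx
    refine G.ext (m := k + 1) ?_ hi hx
    intro j hj _ p
    rw [lift_ι, hψ j (by omega)]
    rfl
  · intro p
    rw [lift_ι, hψk]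

/-- By the Leibniz rule only generators have to be tested, and those of degree greater than `k` are
covered by `h`. -/
theorem map_d_of_step (G : X.Generators P) {f : GradedHom X Y} {k : ℤ}
    (h : ∀ i x, k < i → x ∈ X.comp i → f (X.d x) = Y.d (f x))
    (hk : ∀ p, f (X.d (G.ι k p)) = Y.d (f (G.ι k p))) {i : ℤ} {x : X.carrier} (hi : k ≤ i)
    (hx : x ∈ X.comp i) : f (X.d x) = Y.d (f x) := by
  refine G.map_d (m := k) ?_ hi hx
  intro j hj _ p
  rcases hj.eq_or_lt with rfl | hj
  · exact hk p
  · exact h j _ hj (G.ι_mem j p)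

/-- Lifts of the images of the differentials of elements of degree `k`. -/
theorem exists_lift_d {C : CDGA A} (hC : C.ConcentratedInDegreeZero) (G : X.Generators P)
    (pX : Hom X C) {pY : Hom Y C} (hpY : pY.KernelAcyclic) {M : Type u} [AddCommGroup M]
    [Module A M] [Module.Projective A M] {k : ℤ} {f : GradedHom X Y}
    (hf : ∀ i x, k < i → x ∈ X.comp i → f (X.d x) = Y.d (f x)) {φ : M →ₗ[A] X.carrier}
    (hφ : ∀ m, φ m ∈ X.comp k) :
    ∃ f0 : M →ₗ[A] Y.carrier, ∀ m, f0 m ∈ Y.comp k ∧ Y.d (f0 m) = f (X.d (φ m)) := by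
  refine hpY.exists_lift (f.toAlgHom.toLinearMap ∘ₗ X.d ∘ₗ φ) (fun m => ?_) (fun m => ?_)
    (fun m => ?_)
  · exact f.map_mem (X.d_mem (hφ m))
  · change Y.d (f (X.d (φ m))) = 0
    rw [← hf _ _ (lt_add_one k) (X.d_mem (hφ m)), X.d_d, map_zero]
  -- Since `f` is compatible with the maps to `C`, this element is the differential of `pX (φ m)`,
  -- which lies in degree `k` of `C`. That component is zero unless `k = 0`, and for `k = 0` the
  -- differential lands in degree `1`, where `C` vanishes as well.
  · change pY (f (X.d (φ m))) = 0
    rw [G.isOver hC pX pY, pX.map_d]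
    have h1 := C.d_mem (pX.map_mem (hφ m))
    by_cases hk : k = 0
    · rw [hC _ (by omega), Submodule.mem_bot] at h1
      exact h1
    · have h1 := pX.map_mem (hφ m)
      rw [hC _ hk, Submodule.mem_bot] at h1
      rw [h1, map_zero]

/-- A homomorphism which is compatible with the differentials in degrees greater than `k` can be
changed in degree `k` to become compatible with them there as well. -/
theorem exists_map_d_step {C : CDGA A} (hC : C.ConcentratedInDegreeZero) (G : X.Generators P)
    (pX : Hom X C) {pY : Hom Y C} (hpY : pY.KernelAcyclic) {k : ℤ} [Module.Projective A (P k)]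
    (f : GradedHom X Y) (h : ∀ i x, k < i → x ∈ X.comp i → f (X.d x) = Y.d (f x)) :
    ∃ g : GradedHom X Y, (∀ i x, k < i → x ∈ X.comp i → g x = f x) ∧
      ∀ i x, k ≤ i → x ∈ X.comp i → g (X.d x) = Y.d (g x) := by
  obtain ⟨φ, hφ⟩ := exists_lift_d hC G pX hpY h (G.ι_mem k)
  obtain ⟨g, hg, hgk⟩ := G.exists_extension f k φ fun p => (hφ p).1
  refine ⟨g, hg, ?_⟩
  intro i x hi hx
  refine G.map_d_of_step (fun i x hi hx => ?_) (fun p => ?_) hi hx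
  · rw [hg _ _ (by omega) (X.d_mem hx), hg _ _ hi hx, h _ _ hi hx]
  · rw [hg (k + 1) _ (by omega) (X.d_mem (G.ι_mem k p)), hgk, (hφ p).2]

/-- A homomorphism which is compatible with the differentials in degrees at least `k` agrees in
these degrees with a morphism. -/
theorem exists_hom {C : CDGA A} (hC : C.ConcentratedInDegreeZero) (G : X.Generators P)
    [∀ i, Module.Projective A (P i)] (pX : Hom X C) {pY : Hom Y C} (hpY : pY.KernelAcyclic) {k : ℤ}
    (f : GradedHom X Y) (h : ∀ i x, k ≤ i → x ∈ X.comp i → f (X.d x) = Y.d (f x)) :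
    ∃ g : Hom X Y, ∀ i x, k ≤ i → x ∈ X.comp i → g x = f x := by
  -- Stage `n` commutes with the differentials in degrees at least `k - n`. The property is part of
  -- the data because the choice of the next stage depends on it.
  let T : ℕ → Type u := fun n =>
    {f : GradedHom X Y // ∀ i x, k - n ≤ i → x ∈ X.comp i → f (X.d x) = Y.d (f x)}
  have step : ∀ n (f : T n), ∃ g : T (n + 1), ∀ i x, k - n ≤ i → x ∈ X.comp i →
      g.1 x = f.1 x := by
    rintro n ⟨f, hf⟩
    obtain ⟨g, h1, h2⟩ := G.exists_map_d_step hC pX hpY (k := k - (n + 1 : ℕ)) f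
      (fun i x hi hx => hf i x (by push_cast at hi; omega) hx)
    exact ⟨⟨g, h2⟩, fun i x hi hx => h1 i x (by push_cast; omega) hx⟩
  choose s hs using step
  let F : ∀ n, T n := fun n => Nat.rec ⟨f, by simpa using h⟩ (fun n g => s n g) n
  obtain ⟨g, hg⟩ := G.exists_limit k (fun n => (F n).1) (fun n i x hi hx => hs n (F n) i x hi hx)
  have hd : ∀ x, g (X.d x) = Y.d (g x) := by
    intro x
    induction x using DirectSum.Decomposition.inductionOn X.comp with
    | zero => rw [map_zero, map_zero, map_zero]
    | add x y hx hy => rw [map_add, map_add, map_add, map_add, hx, hy]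
    | @homogeneous i x =>
      rw [hg (k - i).toNat (i + 1) _ (by omega) (X.d_mem x.2), hg (k - i).toNat i _ (by omega) x.2]
      exact (F _).2 i x (by omega) x.2
  refine ⟨⟨g.toAlgHom, g.map_mem, hd⟩, ?_⟩
  intro i x hi hx
  exact hg 0 i x (by simpa using hi) hx

end Generators

/-! ### The inductive step: inverse pairs of unipotent matrices. -/

/-- `f` and `g` are compatible with the differentials and mutually inverse in degrees at least
`k`. -/
structure InverseGE {X Y : CDGA A} (f : GradedHom X Y) (g : GradedHom Y X) (k : ℤ) : Prop where
  map_d : ∀ i x, k ≤ i → x ∈ X.comp i → f (X.d x) = Y.d (f x)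
  map_d' : ∀ i y, k ≤ i → y ∈ Y.comp i → g (Y.d y) = X.d (g y)
  left_inv : ∀ i x, k ≤ i → x ∈ X.comp i → g (f x) = x
  right_inv : ∀ i y, k ≤ i → y ∈ Y.comp i → f (g y) = y

section Step

variable {X Y : CDGA A} {P Q : ℤ → Type u} [∀ i, AddCommGroup (P i)] [∀ i, Module A (P i)]
  [∀ i, AddCommGroup (Q i)] [∀ i, Module A (Q i)] {V W : Type u} [AddCommGroup V] [Module A V]
  [AddCommGroup W] [Module A W]

/-- The projection which kills the summand `V` of the generators of degree `k`. -/
theorem Generators.exists_projection (G : X.Generators P) {k : ℤ} (xw : W →ₗ[A] X.carrier)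
    (xv : V →ₗ[A] X.carrier) (a : P k →ₗ[A] W) (b : P k →ₗ[A] V)
    (hab : ∀ p, G.ι k p = xw (a p) + xv (b p)) (hxw : ∀ w, xw w ∈ X.comp k)
    (hd : ∀ v, X.d (xv v) = 0) :
    ∃ π : GradedHom X X, (∀ i x, k < i → x ∈ X.comp i → π x = x) ∧
      (∀ p, π (G.ι k p) = xw (a p)) ∧ ∀ x ∈ X.comp k, X.d (π x) = X.d x := by
  obtain ⟨π, h1, h2⟩ := G.exists_extension (GradedHom.id A X) k (xw ∘ₗ a) fun p => hxw _
  have h1' : ∀ i x, k < i → x ∈ X.comp i → π x = x := h1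
  refine ⟨π, h1', h2, ?_⟩
  intro x hx
  -- The endomorphism `π` commutes with `d` in degrees at least `k` because the generators which it
  -- kills are cocycles; and it fixes `d x`, whose degree is `k + 1`.
  rw [← G.map_d_of_step (f := π) (fun i x hi hx => ?_) (fun p => ?_) le_rfl hx,
    h1' _ _ (lt_add_one k) (X.d_mem hx)]
  · rw [h1' _ _ hi hx, h1' _ _ (by omega) (X.d_mem hx)]
  · rw [h1' _ _ (lt_add_one k) (X.d_mem (G.ι_mem k p)), h2, hab, map_add, hd, add_zero]
    rfl

/-- The computation behind the inductive step. -/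
theorem right_inv_step (H : Y.Generators Q) {k : ℤ}
    (xw : W →ₗ[A] X.carrier) (xv : V →ₗ[A] X.carrier)
    (yw : W →ₗ[A] Y.carrier) (yv : V →ₗ[A] Y.carrier) (a : Q k →ₗ[A] W) (b : Q k →ₗ[A] V)
    (hab : ∀ p, H.ι k p = yw (a p) + yv (b p))
    (f0 : W →ₗ[A] Y.carrier) (h0 : V →ₗ[A] X.carrier)
    (hf0 : ∀ w, f0 w ∈ Y.comp k) (hh0 : ∀ v, h0 v ∈ X.comp k)
    (πX : GradedHom X X) (πY : GradedHom Y Y) (f f1 : GradedHom X Y) (g g1 : GradedHom Y X)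
    (hinv : ∀ i y, k < i → y ∈ Y.comp i → f (g y) = y)
    (hfπ : ∀ x ∈ X.comp k, f (πX x) = f1 x) (hgπ : ∀ y ∈ Y.comp k, g (πY y) = g1 y)
    (hfv : ∀ v, f (xv v) = yv v - f1 (h0 v)) (hgv : ∀ v, g (yv v) = xv v + πX (h0 v))
    (hfw : ∀ w, f (xw w) = yw w + πY (f0 w)) (hgw : ∀ w, g (yw w) = xw w - g1 (f0 w))
    (hπ : ∀ i y, k < i → y ∈ Y.comp i → πY y = y) (hπk : ∀ p, πY (H.ι k p) = yv (b p))
    {i : ℤ} {y : Y.carrier} (hi : k ≤ i) (hy : y ∈ Y.comp i) : f (g y) = y := by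
  -- The term `- f1 (h0 v)` of `f (xv v)` cancels `f (πX (h0 v))`, which comes from the second term
  -- of `g (yv v)`.
  have hv : ∀ v, f (g (yv v)) = yv v := by
    intro v
    rw [hgv, map_add, hfv, hfπ _ (hh0 v), sub_add_cancel]
  -- The image under `πY` of an element of degree `k` involves only the generators `yv` and
  -- generators of degree above `k`, on which `f ∘ g` is already known to be the identity. So `f ∘
  -- g` can be evaluated on `πY (f0 w)`, decomposable terms included, before it is known on the
  -- generators `yw`.
  have hπfg : ∀ y ∈ Y.comp k, f (g (πY y)) = πY y := by
    intro y hy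
    refine H.ext (f := (f.comp g).comp πY) (g := πY) (m := k) ?_ le_rfl hy
    intro j hj _ p
    rw [GradedHom.comp_apply, GradedHom.comp_apply]
    rcases hj.eq_or_lt with rfl | hj
    · rw [hπk, hv]
    · rw [hπ j _ hj (H.ι_mem j p), hinv j _ hj (H.ι_mem j p)]
  have hw : ∀ w, f (g (yw w)) = yw w := by
    intro w
    rw [hgw, map_sub, hfw, ← hgπ _ (hf0 w), hπfg _ (hf0 w), add_sub_cancel_right]
  refine H.ext (f := f.comp g) (g := GradedHom.id A Y) (m := k) ?_ hi hy
  intro j hj _ p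
  change f (g _) = H.ι j p
  rcases hj.eq_or_lt with rfl | hj
  · rw [hab, map_add, map_add, hw, hv]
  · exact hinv j _ hj (H.ι_mem j p)

/-- In the application `f1` is the auxiliary map which ignores the summand killed by `π`. The
identity is needed on elements such as `h0 v`, which may contain products of generators, and not
just on the generators of degree `k`. -/
theorem Generators.comp_projection_eq (G : X.Generators P) {k : ℤ} {π : GradedHom X X}
    {f f1 : GradedHom X Y} (hπ : ∀ i x, k < i → x ∈ X.comp i → π x = x)
    (hf : ∀ i x, k < i → x ∈ X.comp i → f x = f1 x)
    (hk : ∀ p, f (π (G.ι k p)) = f1 (G.ι k p)) : ∀ x ∈ X.comp k, f (π x) = f1 x := by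
  intro x hx
  refine G.ext (f := f.comp π) (g := f1) (m := k) ?_ le_rfl hx
  intro j hj _ p
  rw [GradedHom.comp_apply]
  rcases hj.eq_or_lt with rfl | hj
  · exact hk p
  · rw [hπ j _ hj (G.ι_mem j p), hf j _ hj (G.ι_mem j p)]

end Step

end CDGA

namespace CDGA

variable {A : Type u} [CommRing A]

section Step

variable {X Y : CDGA A} {P Q : ℤ → Type u} [∀ i, AddCommGroup (P i)] [∀ i, Module A (P i)]
  [∀ i, AddCommGroup (Q i)] [∀ i, Module A (Q i)] {V W : Type u} [AddCommGroup V] [Module A V]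
  [AddCommGroup W] [Module A W]

/-- The unipotent factor with entry `f0` gives `f1`, which kills the `V`-generators of `X`; the
factor with entry `-h0` then corrects it to `f'`. Both commute with `d`, because `V` is closed in
`X` and `W` is closed in `Y`. The lemma is applied twice, the second time with `X`, `W` and `Y`, `V`
exchanged, and yields the two maps of an inverse pair. The formulas are part of the conclusion
because the proof of inverseness consists in comparing them. -/
theorem exists_step_half (G : X.Generators P) {k : ℤ} (e : P k ≃ₗ[A] W × V)
    (f : GradedHom X Y) (hf : ∀ i x, k < i → x ∈ X.comp i → f (X.d x) = Y.d (f x))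
    (hV : ∀ v, X.d (G.ι k (e.symm (0, v))) = 0)
    (yw : W →ₗ[A] Y.carrier) (yv : V →ₗ[A] Y.carrier) (hyw : ∀ w, yw w ∈ Y.comp k)
    (hyv : ∀ v, yv v ∈ Y.comp k) (hW : ∀ w, Y.d (yw w) = 0)
    (f0 : W →ₗ[A] Y.carrier) (hf0 : ∀ w, f0 w ∈ Y.comp k)
    (hdf0 : ∀ w, Y.d (f0 w) = f (X.d (G.ι k (e.symm (w, 0)))))
    (h0 : V →ₗ[A] X.carrier) (hh0 : ∀ v, h0 v ∈ X.comp k)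
    (hdh0 : ∀ v, f (X.d (h0 v)) = Y.d (yv v))
    (πY : GradedHom Y Y) (hπ : ∀ y ∈ Y.comp k, Y.d (πY y) = Y.d y) :
    ∃ f' f1 : GradedHom X Y, (∀ i x, k < i → x ∈ X.comp i → f' x = f x) ∧
      (∀ i x, k < i → x ∈ X.comp i → f1 x = f x) ∧
      (∀ i x, k ≤ i → x ∈ X.comp i → f' (X.d x) = Y.d (f' x)) ∧
      (∀ p, f1 (G.ι k p) = yw (e p).1 + πY (f0 (e p).1)) ∧
      (∀ w, f' (G.ι k (e.symm (w, 0))) = yw w + πY (f0 w)) ∧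
      (∀ v, f' (G.ι k (e.symm (0, v))) = yv v - f1 (h0 v)) := by
  have hdι : ∀ p, X.d (G.ι k p) = X.d (G.ι k (e.symm ((e p).1, 0))) := by
    intro p
    conv_lhs => rw [← e.symm_apply_apply p]
    have : e p = ((e p).1, 0) + (0, (e p).2) := by simp
    rw [this, map_add, map_add, map_add, hV, add_zero]
    simp
  obtain ⟨f1, hf1, hf1k⟩ := G.exists_extension f k
    ((yw + πY.toAlgHom.toLinearMap ∘ₗ f0) ∘ₗ LinearMap.fst A W V ∘ₗ e.toLinearMap)
    (fun p => add_mem (hyw _) (πY.map_mem (hf0 _)))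
  have hf1k' : ∀ p, f1 (G.ι k p) = yw (e p).1 + πY (f0 (e p).1) := hf1k
  have hf1d : ∀ i x, k ≤ i → x ∈ X.comp i → f1 (X.d x) = Y.d (f1 x) := by
    intro i x hi hx
    refine G.map_d_of_step (fun i x hi hx => ?_) (fun p => ?_) hi hx
    · rw [hf1 _ _ (by omega) (X.d_mem hx), hf1 _ _ hi hx, hf _ _ hi hx]
    · rw [hf1 _ _ (lt_add_one k) (X.d_mem (G.ι_mem k p)), hf1k', map_add, hW, zero_add,
        hπ _ (hf0 _), hdf0, hdι]
  -- The added term `yv - f1 ∘ h0` consists of cocycles: `f1` commutes with `d`, and `f` carries `d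
  -- (h0 v)` to `d (yv v)`. Hence `f'` still commutes with `d`.
  obtain ⟨f', hf', hfk⟩ := G.exists_extension f k
    (f1.toAlgHom.toLinearMap ∘ₗ G.ι k +
      (yv - f1.toAlgHom.toLinearMap ∘ₗ h0) ∘ₗ LinearMap.snd A W V ∘ₗ e.toLinearMap)
    (fun p => add_mem (f1.map_mem (G.ι_mem k p)) (sub_mem (hyv _) (f1.map_mem (hh0 _))))
  have hfk' : ∀ p, f' (G.ι k p) = f1 (G.ι k p) + (yv (e p).2 - f1 (h0 (e p).2)) := hfk
  refine ⟨f', f1, hf', hf1, ?_, hf1k', ?_, ?_⟩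
  · intro i x hi hx
    refine G.map_d_of_step (fun i x hi hx => ?_) (fun p => ?_) hi hx
    · rw [hf' _ _ (by omega) (X.d_mem hx), hf' _ _ hi hx, hf _ _ hi hx]
    · rw [hf' _ _ (lt_add_one k) (X.d_mem (G.ι_mem k p)), hfk', map_add, map_sub,
        ← hf1d _ _ le_rfl (hh0 _), hf1 _ _ (lt_add_one k) (X.d_mem (hh0 _)), hdh0, sub_self,
        add_zero, ← hf1d _ _ le_rfl (G.ι_mem k p),
        hf1 _ _ (lt_add_one k) (X.d_mem (G.ι_mem k p))]
  · intro w
    rw [hfk', hf1k']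
    simp
  · intro v
    rw [hfk', hf1k']
    simp

/-- With `V` closed in `X` and `W` closed in `Y`, the only differentials to be matched are those of
the `W`-generators of `X` and of the `V`-generators of `Y`. Each of the two families is taken care
of by one unipotent factor, so the resulting matrices are invertible whatever the lifts are. -/
theorem InverseGE.exists_step {C : CDGA A} (hC : C.ConcentratedInDegreeZero)
    (G : X.Generators P) (H : Y.Generators Q) {pX : Hom X C} {pY : Hom Y C}
    (hpX : pX.KernelAcyclic) (hpY : pY.KernelAcyclic) [Module.Projective A V]
    [Module.Projective A W] {k : ℤ} {f : GradedHom X Y} {g : GradedHom Y X}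
    (h : InverseGE f g (k + 1)) (eX : P k ≃ₗ[A] W × V) (eY : Q k ≃ₗ[A] W × V)
    (hV : ∀ v, X.d (G.ι k (eX.symm (0, v))) = 0) (hW : ∀ w, Y.d (H.ι k (eY.symm (w, 0))) = 0) :
    ∃ (f' : GradedHom X Y) (g' : GradedHom Y X), InverseGE f' g' k ∧
      (∀ i x, k < i → x ∈ X.comp i → f' x = f x) ∧
      (∀ i y, k < i → y ∈ Y.comp i → g' y = g y) := by
  obtain ⟨xw, hxw'⟩ : ∃ φ : W →ₗ[A] X.carrier, ∀ w, φ w = G.ι k (eX.symm (w, 0)) :=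
    ⟨G.ι k ∘ₗ eX.symm.toLinearMap ∘ₗ LinearMap.inl A W V, fun _ => rfl⟩
  obtain ⟨xv, hxv'⟩ : ∃ φ : V →ₗ[A] X.carrier, ∀ v, φ v = G.ι k (eX.symm (0, v)) :=
    ⟨G.ι k ∘ₗ eX.symm.toLinearMap ∘ₗ LinearMap.inr A W V, fun _ => rfl⟩
  obtain ⟨yw, hyw'⟩ : ∃ φ : W →ₗ[A] Y.carrier, ∀ w, φ w = H.ι k (eY.symm (w, 0)) :=
    ⟨H.ι k ∘ₗ eY.symm.toLinearMap ∘ₗ LinearMap.inl A W V, fun _ => rfl⟩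
  obtain ⟨yv, hyv'⟩ : ∃ φ : V →ₗ[A] Y.carrier, ∀ v, φ v = H.ι k (eY.symm (0, v)) :=
    ⟨H.ι k ∘ₗ eY.symm.toLinearMap ∘ₗ LinearMap.inr A W V, fun _ => rfl⟩
  obtain ⟨aX, haX⟩ : ∃ φ : P k →ₗ[A] W, ∀ p, φ p = (eX p).1 :=
    ⟨LinearMap.fst A W V ∘ₗ eX.toLinearMap, fun _ => rfl⟩
  obtain ⟨bX, hbX⟩ : ∃ φ : P k →ₗ[A] V, ∀ p, φ p = (eX p).2 :=
    ⟨LinearMap.snd A W V ∘ₗ eX.toLinearMap, fun _ => rfl⟩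
  obtain ⟨aY, haY⟩ : ∃ φ : Q k →ₗ[A] W, ∀ p, φ p = (eY p).1 :=
    ⟨LinearMap.fst A W V ∘ₗ eY.toLinearMap, fun _ => rfl⟩
  obtain ⟨bY, hbY⟩ : ∃ φ : Q k →ₗ[A] V, ∀ p, φ p = (eY p).2 :=
    ⟨LinearMap.snd A W V ∘ₗ eY.toLinearMap, fun _ => rfl⟩
  have hxw : ∀ w, xw w ∈ X.comp k := fun w => hxw' w ▸ G.ι_mem k _
  have hxv : ∀ v, xv v ∈ X.comp k := fun v => hxv' v ▸ G.ι_mem k _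
  have hyw : ∀ w, yw w ∈ Y.comp k := fun w => hyw' w ▸ H.ι_mem k _
  have hyv : ∀ v, yv v ∈ Y.comp k := fun v => hyv' v ▸ H.ι_mem k _
  have hdV : ∀ v, X.d (xv v) = 0 := fun v => hxv' v ▸ hV v
  have hdW : ∀ w, Y.d (yw w) = 0 := fun w => hyw' w ▸ hW w
  have hX : ∀ p, G.ι k p = xw (aX p) + xv (bX p) := by
    intro p
    rw [hxw', hxv', haX, hbX, ← map_add, ← map_add]
    simp
  have hX' : ∀ p, G.ι k p = xv (bX p) + xw (aX p) := fun p => (hX p).trans (add_comm _ _)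
  have hY : ∀ p, H.ι k p = yw (aY p) + yv (bY p) := by
    intro p
    rw [hyw', hyv', haY, hbY, ← map_add, ← map_add]
    simp
  have hY' : ∀ p, H.ι k p = yv (bY p) + yw (aY p) := fun p => (hY p).trans (add_comm _ _)
  -- `f0` lifts `f ∘ d` on the `W`-generators of `X`, and `h0` lifts `g ∘ d` on the `V`-generators
  -- of `Y`.
  obtain ⟨f0, hf0⟩ := Generators.exists_lift_d hC G pX hpY (fun i x hi hx => h.map_d i x hi hx) hxw
  obtain ⟨h0, hh0⟩ := Generators.exists_lift_d hC H pY hpX (fun i x hi hx => h.map_d' i x hi hx) hyv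
  -- Each projection kills the closed summand, `V` in `X` and `W` in `Y`. Therefore it does not
  -- change differentials in degree `k`.
  obtain ⟨πX, hπX, hπXk, hπXd⟩ := G.exists_projection xw xv aX bX hX hxw hdV
  obtain ⟨πY, hπY, hπYk, hπYd⟩ := H.exists_projection yv yw bY aY hY' hyv hdW
  obtain ⟨f', f1, hf', hf1, hfd, hf1k, hfw, hfv⟩ := exists_step_half G eX f
    (fun i x hi hx => h.map_d i x hi hx) hV yw yv hyw hyv hdW f0 (fun w => (hf0 w).1)
    (fun w => by rw [(hf0 w).2, hxw']) h0 (fun v => (hh0 v).1)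
    (fun v => by rw [(hh0 v).2, h.right_inv _ _ le_rfl (Y.d_mem (hyv v))]) πY hπYd
  -- The same construction with the roles exchanged: `g'` adds `πX ∘ h0` on the `V`-generators and
  -- subtracts `g1 ∘ f0` on the `W`-generators, as the inverse of the product matrix demands.
  obtain ⟨g', g1, hg', hg1, hgd, hg1k, hgv, hgw⟩ := exists_step_half H
    (eY.trans (LinearEquiv.prodComm A W V)) g (fun i x hi hx => h.map_d' i x hi hx) hW xv xw hxv hxw
    hdV h0 (fun v => (hh0 v).1) (fun v => (hh0 v).2.trans (by rw [hyv']; rfl)) f0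
    (fun w => (hf0 w).1)
    (fun w => by rw [(hf0 w).2, h.left_inv _ _ le_rfl (X.d_mem (hxw w))]) πX hπXd
  have hg1k' : ∀ p, g1 (H.ι k p) = xv (bY p) + πX (h0 (bY p)) := by
    intro p
    rw [hbY]
    exact hg1k p
  have hfw' : ∀ w, f' (xw w) = yw w + πY (f0 w) := fun w => by rw [hxw', hfw]
  have hfv' : ∀ v, f' (xv v) = yv v - f1 (h0 v) := fun v => by rw [hxv', hfv]
  have hgv' : ∀ v, g' (yv v) = xv v + πX (h0 v) := fun v => by rw [hyv']; exact hgv v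
  have hgw' : ∀ w, g' (yw w) = xw w - g1 (f0 w) := fun w => by rw [hyw']; exact hgw w
  have hfπ := G.comp_projection_eq hπX (f := f') (f1 := f1)
    (fun i x hi hx => (hf' i x hi hx).trans (hf1 i x hi hx).symm)
    (fun p => by rw [hπXk, hf1k, hfw', haX])
  have hgπ := H.comp_projection_eq hπY (f := g') (f1 := g1)
    (fun i x hi hx => (hg' i x hi hx).trans (hg1 i x hi hx).symm)
    (fun p => by rw [hπYk, hg1k', hgv'])
  have hfg : ∀ i y, k < i → y ∈ Y.comp i → f' (g' y) = y := by
    intro i y hi hy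
    rw [hg' i y hi hy, hf' i _ hi (g.map_mem hy), h.right_inv i y hi hy]
  have hgf : ∀ i x, k < i → x ∈ X.comp i → g' (f' x) = x := by
    intro i x hi hx
    rw [hf' i x hi hx, hg' i _ hi (f.map_mem hx), h.left_inv i x hi hx]
  refine ⟨f', g', ⟨hfd, hgd, ?_, ?_⟩, hf', hg'⟩
  -- The formulas for `f'` and `g'` go over into each other when `X`, `W` and `Y`, `V` are
  -- exchanged, so one computation gives both inverse laws.
  · intro i x hi hx
    exact right_inv_step G yv yw xv xw bX aX hX' h0 f0
      (fun v => (hh0 v).1) (fun w => (hf0 w).1) πY πX g' g1 f' f1 hgf hgπ hfπ hgw' hfw' hgv' hfv'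
      hπX hπXk hi hx
  · intro i y hi hy
    exact right_inv_step H xw xv yw yv aY bY hY f0 h0
      (fun w => (hf0 w).1) (fun v => (hh0 v).1) πX πY f' f1 g' g1 hfg hfπ hgπ hfv' hgv' hfw' hgw'
      hπY hπYk hi hy

end Step

/-- The tower of inductive steps: an isomorphism in degrees at least `k` extends to an
isomorphism. -/
theorem InverseGE.exists_iso {C : CDGA A} (hC : C.ConcentratedInDegreeZero) {X Y : CDGA A}
    {P Q V W : ℤ → Type u} [∀ i, AddCommGroup (P i)] [∀ i, Module A (P i)]
    [∀ i, AddCommGroup (Q i)] [∀ i, Module A (Q i)] [∀ i, AddCommGroup (V i)]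
    [∀ i, Module A (V i)] [∀ i, AddCommGroup (W i)] [∀ i, Module A (W i)]
    [∀ i, Module.Projective A (V i)] [∀ i, Module.Projective A (W i)]
    (G : X.Generators P) (H : Y.Generators Q) {pX : Hom X C} {pY : Hom Y C}
    (hpX : pX.KernelAcyclic) (hpY : pY.KernelAcyclic) {k : ℤ} {f : GradedHom X Y}
    {g : GradedHom Y X} (h : InverseGE f g k) (eX : ∀ i, i < k → P i ≃ₗ[A] W i × V i)
    (eY : ∀ i, i < k → Q i ≃ₗ[A] W i × V i)
    (hV : ∀ i hi v, X.d (G.ι i ((eX i hi).symm (0, v))) = 0)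
    (hW : ∀ i hi w, Y.d (H.ι i ((eY i hi).symm (w, 0))) = 0) :
    ∃ Φ : Iso X Y, ∀ i x, k ≤ i → x ∈ X.comp i → Φ.hom x = f x := by
  let T : ℕ → Type u := fun n =>
    {p : GradedHom X Y × GradedHom Y X // InverseGE p.1 p.2 (k - n)}
  have step : ∀ n (p : T n), ∃ q : T (n + 1),
      (∀ i x, k - n ≤ i → x ∈ X.comp i → q.1.1 x = p.1.1 x) ∧
      (∀ i y, k - n ≤ i → y ∈ Y.comp i → q.1.2 y = p.1.2 y) := by
    rintro n ⟨⟨f, g⟩, hp⟩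
    have hk : k - (n + 1 : ℕ) < k := by omega
    have e : k - (n : ℤ) = k - (n + 1 : ℕ) + 1 := by push_cast; ring
    dsimp only at hp
    rw [e] at hp
    obtain ⟨f', g', h1, h2, h3⟩ := hp.exists_step hC G H hpX hpY (eX _ hk) (eY _ hk)
      (hV _ hk) (hW _ hk)
    exact ⟨⟨⟨f', g'⟩, h1⟩, fun i x hi hx => h2 i x (by omega) hx,
      fun i x hi hx => h3 i x (by omega) hx⟩
  choose s hs using step
  let F : ∀ n, T n := fun n => Nat.rec ⟨⟨f, g⟩, by simpa using h⟩ (fun n p => s n p) n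
  obtain ⟨f', hf'⟩ := G.exists_limit k (fun n => (F n).1.1)
    (fun n i x hi hx => (hs n (F n)).1 i x hi hx)
  obtain ⟨g', hg'⟩ := H.exists_limit k (fun n => (F n).1.2)
    (fun n i x hi hx => (hs n (F n)).2 i x hi hx)
  have key : ∀ i, InverseGE f' g' i := by
    intro i
    constructor
    · intro j x hj hx
      rw [hf' (k - j).toNat (j + 1) _ (by omega) (X.d_mem hx), hf' (k - j).toNat j _ (by omega) hx]
      exact (F _).2.map_d j x (by omega) hx
    · intro j x hj hx
      rw [hg' (k - j).toNat (j + 1) _ (by omega) (Y.d_mem hx), hg' (k - j).toNat j _ (by omega) hx]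
      exact (F _).2.map_d' j x (by omega) hx
    · intro j x hj hx
      rw [hg' (k - j).toNat j _ (by omega) (f'.map_mem hx), hf' (k - j).toNat j _ (by omega) hx]
      exact (F _).2.left_inv j x (by omega) hx
    · intro j x hj hx
      rw [hf' (k - j).toNat j _ (by omega) (g'.map_mem hx), hg' (k - j).toNat j _ (by omega) hx]
      exact (F _).2.right_inv j x (by omega) hx
  have hfd : ∀ x, f' (X.d x) = Y.d (f' x) := by
    intro x
    induction x using DirectSum.Decomposition.inductionOn X.comp with
    | zero => rw [map_zero, map_zero, map_zero]
    | add x y hx hy => rw [map_add, map_add, map_add, map_add, hx, hy]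
    | @homogeneous i x => exact (key i).map_d i x le_rfl x.2
  have hgd : ∀ x, g' (Y.d x) = X.d (g' x) := by
    intro x
    induction x using DirectSum.Decomposition.inductionOn Y.comp with
    | zero => rw [map_zero, map_zero, map_zero]
    | add x y hx hy => rw [map_add, map_add, map_add, map_add, hx, hy]
    | @homogeneous i x => exact (key i).map_d' i x le_rfl x.2
  have hgf : ∀ x, g' (f' x) = x := by
    intro x
    induction x using DirectSum.Decomposition.inductionOn X.comp with
    | zero => rw [map_zero, map_zero]
    | add x y hx hy => rw [map_add, map_add, hx, hy]
    | @homogeneous i x => exact (key i).left_inv i x le_rfl x.2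
  have hfg : ∀ x, f' (g' x) = x := by
    intro x
    induction x using DirectSum.Decomposition.inductionOn Y.comp with
    | zero => rw [map_zero, map_zero]
    | add x y hx hy => rw [map_add, map_add, hx, hy]
    | @homogeneous i x => exact (key i).right_inv i x le_rfl x.2
  refine ⟨⟨⟨f'.toAlgHom, f'.map_mem, hfd⟩, ⟨g'.toAlgHom, g'.map_mem, hgd⟩, hgf, hfg⟩, ?_⟩
  intro i x hi hx
  exact hf' 0 i x (by simpa using hi) hx

end CDGA

/-! ### Generators of symmetric algebras and of tensor products. -/

namespace CDGA

variable {A : Type u} [CommRing A]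

/-- The tautological generators of a symmetric algebra. -/
noncomputable def symGenerators (V : ℤ → Type u) [∀ i, AddCommGroup (V i)] [∀ i, Module A (V i)]
    (dV : ∀ i, V i →ₗ[A] V (i + 1)) (hd : ∀ i v, dV (i + 1) (dV i v) = 0)
    (hV : ∀ i, 0 ≤ i → Subsingleton (V i)) : (sym V dV hd).Generators V where
  equiv := AlgEquiv.refl
  mem_iff _ _ := Iff.rfl
  negative := hV

/-- The inclusion `F → E ⊗ F`, `y ↦ 1 ⊗ y`. -/
noncomputable def inclRight (E F : CDGA A) : Hom F (tensor E F) where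
  toAlgHom := GradedTensorProduct.includeRight E.comp F.comp
  map_mem := by
    intro i x hx
    have := tmul_mem (E := E) SetLike.GradedOne.one_mem hx
    rwa [zero_add] at this
  map_d := by
    intro y
    have h := tensorD_tmul (E := E) (F := F) (i := 0) SetLike.GradedOne.one_mem y
    rw [E.d_one] at h
    refine Eq.trans ?_ h.symm
    simp [tmul, GradedTensorProduct.tmul]
    rfl

theorem inclLeft_mul_inclRight (E F : CDGA A) (x : E.carrier) (y : F.carrier) :
    inclLeft E F x * inclRight E F y = tmul E F x y :=
  GradedTensorProduct.tmul_one_mul_one_tmul E.comp F.comp x y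

theorem tensor_comp_induction {E F : CDGA A} {n : ℤ} {Q : (tensor E F).carrier → Prop}
    (ht : ∀ i j x y, x ∈ E.comp i → y ∈ F.comp j → i + j = n →
      Q (inclLeft E F x * inclRight E F y)) (h0 : Q 0)
    (ha : ∀ x y, Q x → Q y → Q (x + y)) (hs : ∀ (a : A) x, Q x → Q (a • x))
    {z : (tensor E F).carrier} (hz : z ∈ (tensor E F).comp n) : Q z :=
  tensorComp_induction (P := Q)
    (fun i j x y hx hy h => inclLeft_mul_inclRight E F x y ▸ ht i j x y hx hy h) h0 ha hs hz

section

variable {E F : CDGA A} {P Q : ℤ → Type u} [∀ i, AddCommGroup (P i)] [∀ i, Module A (P i)]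
  [∀ i, AddCommGroup (Q i)] [∀ i, Module A (Q i)]

/-- Generators of a tensor product. -/
theorem exists_tensorGenerators (G : E.Generators P) (H : F.Generators Q) :
    ∃ K : (tensor E F).Generators (fun i => P i × Q i),
      ∀ i p, K.ι i p = inclLeft E F (G.ι i p.1) + inclRight E F (H.ι i p.2) := by
  have hn : ∀ i, 0 ≤ i → Subsingleton (P i × Q i) := by
    intro i hi
    have := G.negative i hi
    have := H.negative i hi
    infer_instance
  -- Only the underlying graded algebra of `Z` matters, so it is given the zero differential.
  let Z : CDGA A := sym (fun i => P i × Q i) (fun _ => 0) (fun _ _ => rfl)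
  let GZ : Z.Generators (fun i => P i × Q i) := symGenerators _ _ _ hn
  let f1 : GradedHom E Z := G.lift (fun i => GZ.ι i ∘ₗ LinearMap.inl A (P i) (Q i))
    (fun i p => GZ.ι_mem i _)
  let f2 : GradedHom F Z := H.lift (fun i => GZ.ι i ∘ₗ LinearMap.inr A (P i) (Q i))
    (fun i p => GZ.ι_mem i _)
  let b : (tensor E F).carrier →ₐ[A] Z.carrier :=
    GradedTensorProduct.lift E.comp F.comp f1.toAlgHom f2.toAlgHom (by
      intro i j x y
      have := Z.graded_comm (f1.map_mem x.2) (f2.map_mem y.2)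
      rw [mul_comm] at this
      exact this)
  have hb : ∀ x y, b (tmul E F x y) = f1 x * f2 y := fun _ _ => rfl
  let a : GradedHom Z (tensor E F) := GZ.lift
    (fun i => ((inclLeft E F).toAlgHom.toLinearMap ∘ₗ G.ι i).coprod
      ((inclRight E F).toAlgHom.toLinearMap ∘ₗ H.ι i))
    (fun i p => add_mem ((inclLeft E F).map_mem (G.ι_mem i p.1))
      ((inclRight E F).map_mem (H.ι_mem i p.2)))
  have ha : ∀ i p, a (GZ.ι i p) = inclLeft E F (G.ι i p.1) + inclRight E F (H.ι i p.2) :=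
    fun i p => GZ.lift_ι _ _ i p
  have hb1 : ∀ x, b (inclLeft E F x) = f1 x := fun x => by
    refine (hb x 1).trans ?_
    rw [map_one, mul_one]
  have hb2 : ∀ x, b (inclRight E F x) = f2 x := fun x => by
    refine (hb 1 x).trans ?_
    rw [map_one, one_mul]
  have hba : ∀ x, b (a x) = x := by
    have : b.comp a.toAlgHom = AlgHom.id A _ := by
      refine GSym.algHom_ext fun i p => ?_
      change b (a (GZ.ι i p)) = GZ.ι i p
      rw [ha, map_add, hb1, hb2, G.lift_ι, H.lift_ι]
      simp only [LinearMap.comp_apply]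
      rw [← map_add]
      simp
    exact fun x => AlgHom.congr_fun this x
  have hab1 : ∀ x, a (f1 x) = inclLeft E F x := by
    intro x
    induction x using DirectSum.Decomposition.inductionOn E.comp with
    | zero => rw [map_zero, map_zero, map_zero]
    | add x y hx hy => rw [map_add, map_add, map_add, hx, hy]
    | @homogeneous i x =>
      refine G.ext (f := a.comp f1) (g := (inclLeft E F).toGradedHom) (m := i) ?_ le_rfl x.2
      intro j _ _ p
      rw [GradedHom.comp_apply, G.lift_ι]
      refine (ha _ _).trans ?_
      simp only [LinearMap.inl_apply, map_zero, add_zero]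
      rfl
  have hab2 : ∀ x, a (f2 x) = inclRight E F x := by
    intro x
    induction x using DirectSum.Decomposition.inductionOn F.comp with
    | zero => rw [map_zero, map_zero, map_zero]
    | add x y hx hy => rw [map_add, map_add, map_add, hx, hy]
    | @homogeneous i x =>
      refine H.ext (f := a.comp f2) (g := (inclRight E F).toGradedHom) (m := i) ?_ le_rfl x.2
      intro j _ _ p
      rw [GradedHom.comp_apply, H.lift_ι]
      refine (ha _ _).trans ?_
      simp only [LinearMap.inr_apply, map_zero, zero_add]
      rfl
  have hab : ∀ x, a (b x) = x := by
    have : a.toAlgHom.comp b = AlgHom.id A _ := by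
      refine GradedTensorProduct.algHom_ext E.comp F.comp ?_ ?_
      · ext x
        exact (congrArg a.toAlgHom (hb1 x)).trans (hab1 x)
      · ext x
        exact (congrArg a.toAlgHom (hb2 x)).trans (hab2 x)
    exact fun x => AlgHom.congr_fun this x
  have hbm : ∀ i x, x ∈ (tensor E F).comp i → b x ∈ Z.comp i := by
    intro i x hx
    refine tensor_comp_induction (Q := fun x => b x ∈ Z.comp i) ?_ ?_ ?_ ?_ hx
    · rintro j k u w hu hw rfl
      rw [map_mul, hb1, hb2]
      exact SetLike.mul_mem_graded (f1.map_mem hu) (f2.map_mem hw)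
    · rw [map_zero]
      exact zero_mem _
    · intro x y hx hy
      rw [map_add]
      exact add_mem hx hy
    · intro c x hx
      rw [map_smul]
      exact Submodule.smul_mem _ _ hx
  exact ⟨
    { equiv := AlgEquiv.ofAlgHom a.toAlgHom b (AlgHom.ext hab) (AlgHom.ext hba)
      mem_iff := fun i x => ⟨fun hx => a.map_mem hx, fun hx => hba x ▸ hbm i _ hx⟩
      negative := hn }, ha⟩

end

end CDGA

/-! ### The contraction of `Sym (V ⊕ V[1])` in characteristic zero. -/

namespace GSym

variable {A : Type u} [CommRing A] {V : ℤ → Type u} [∀ i, AddCommGroup (V i)]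
  [∀ i, Module A (V i)]

theorem gen_cast {i j : ℤ} (h : i = j) (v : V i) : gen A V j (h ▸ v) = gen A V i v := by
  subst h
  rfl

section Derivation

/-- The homomorphism `x ↦ (parity x, s x; 0, x)` encoding the derivation `s` of degree `-1` which
extends `σ`. -/
noncomputable def sMatrix (σ : ∀ i, V i →ₗ[A] GSym A V) (hσ : ∀ i v, σ i v ∈ comp A V (i - 1)) :
    GSym A V →ₐ[A] Matrix (Fin 2) (Fin 2) (GSym A V) :=
  lift (fun i =>
    { toFun := fun v => !![i.negOnePow • gen A V i v, σ i v; 0, gen A V i v]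
      map_add' := by
        intro v w
        ext a b
        fin_cases a <;> fin_cases b <;> simp
      map_smul' := by
        intro a v
        ext a b
        fin_cases a <;> fin_cases b
        · simpa using smul_comm _ _ _
        · simp
        · simp
        · simp }) (by
    intro i j v w
    have e1 : σ i v * gen A V j w
        = ((i * j).negOnePow * j.negOnePow) • (gen A V j w * σ i v) := by
      rw [graded_comm (hσ i v) (gen_mem j w), sub_mul, one_mul, Int.negOnePow_sub]
    have e2 : gen A V i v * σ j w
        = ((i * j).negOnePow * i.negOnePow) • (σ j w * gen A V i v) := by
      rw [graded_comm (gen_mem i v) (hσ j w), mul_sub, mul_one, Int.negOnePow_sub]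
    have e3 : i.negOnePow * ((i * j).negOnePow * i.negOnePow) = (i * j).negOnePow := by
      rw [mul_left_comm, Int.units_mul_self, mul_one]
    ext a b
    fin_cases a <;> fin_cases b
    · simp [Matrix.mul_apply, smul_mul_assoc, mul_smul_comm]
      rw [gen_mul_gen i j]
      simp only [smul_smul]
      congr 1
      ac_rfl
    · simp [Matrix.mul_apply, smul_mul_assoc, mul_smul_comm]
      rw [e1, e2, smul_smul, e3, smul_smul, add_comm]
    · simp [Matrix.mul_apply]
    · simp [Matrix.mul_apply]
      exact gen_mul_gen i j v w)

variable (σ : ∀ i, V i →ₗ[A] GSym A V) (hσ : ∀ i v, σ i v ∈ comp A V (i - 1))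

theorem sMatrix_gen (i : ℤ) (v : V i) : sMatrix σ hσ (gen A V i v)
      = !![i.negOnePow • gen A V i v, σ i v; 0, gen A V i v] := by
  rw [sMatrix, lift_gen]
  rfl

include hσ in
/-- Derivations of degree `-1` with given values on the generators. -/
theorem exists_derivation : ∃ s : GSym A V →ₗ[A] GSym A V, s 1 = 0 ∧
    (∀ i v, s (gen A V i v) = σ i v) ∧ (∀ x y, s (x * y) = s x * y + parity x * s y) ∧
    ∀ n x, x ∈ comp A V n → s x ∈ comp A V (n - 1) := by
  let s : GSym A V →ₗ[A] GSym A V :=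
    { toFun := fun x => sMatrix σ hσ x 0 1
      map_add' := fun x y => by simp
      map_smul' := fun a x => by simp }
  have hs : ∀ x, sMatrix σ hσ x 0 1 = s x := fun _ => rfl
  have h1 : s 1 = 0 := by rw [← hs]; simp
  have hg : ∀ i v, s (gen A V i v) = σ i v := fun i v => by rw [← hs, sMatrix_gen]; rfl
  have key : ∀ x, sMatrix σ hσ x 0 0 = parity x ∧ sMatrix σ hσ x 1 1 = x := by
    have h10 : ∀ x, sMatrix σ hσ x 0 0 = parity x ∧ sMatrix σ hσ x 1 0 = 0 ∧
        sMatrix σ hσ x 1 1 = x := by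
      intro x
      refine word_induction (P := fun x => sMatrix σ hσ x 0 0 = parity x ∧
        sMatrix σ hσ x 1 0 = 0 ∧ sMatrix σ hσ x 1 1 = x) ?_ ?_ ?_ ?_ x
      · intro l
        induction l with
        | nil => simp [word_nil]
        | cons p l ih =>
          obtain ⟨i1, i2, i3⟩ := ih
          simp [word_cons, map_mul, Matrix.mul_apply, sMatrix_gen, parity_gen, i1, i2, i3]
      · simp
      · rintro x y ⟨h1, h2, h3⟩ ⟨k1, k2, k3⟩
        simp [h1, h2, h3, k1, k2, k3]
      · rintro a x ⟨h1, h2, h3⟩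
        simp [h1, h2, h3]
    exact fun x => ⟨(h10 x).1, (h10 x).2.2⟩
  have hm : ∀ x y, s (x * y) = s x * y + parity x * s y := by
    intro x y
    rw [← hs, map_mul, Matrix.mul_apply, Fin.sum_univ_two, (key x).1, (key y).2, hs, hs, add_comm]
  refine ⟨s, h1, hg, hm, ?_⟩
  intro n x hx
  refine comp_induction (P := fun x => s x ∈ comp A V (n - 1)) ?_ ?_ ?_ ?_ hx
  · rintro l rfl
    clear hx
    induction l with
    | nil => rw [word_nil, h1]; exact zero_mem _
    | cons p l ih =>
      rw [word_cons, hm, hg, parity_gen, wordDeg_cons]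
      refine add_mem ?_ ?_
      · have := SetLike.mul_mem_graded (hσ p.1 p.2) (word_mem (A := A) l)
        rwa [sub_add_eq_add_sub] at this
      · have := SetLike.mul_mem_graded (gen_mem (A := A) _ p.2) ih
        rw [smul_mul_assoc, Units.smul_def, add_sub_assoc]
        exact zsmul_mem this _
  · simp
  · intro x y hx hy
    rw [map_add]
    exact add_mem hx hy
  · intro a x hx
    rw [map_smul]
    exact Submodule.smul_mem _ _ hx

end Derivation

theorem hom_ext_word {M : Type*} [AddCommGroup M] [Module A M] {f g : GSym A V →ₗ[A] M}
    (h : ∀ l, f (word l) = g (word l)) : f = g := by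
  refine LinearMap.ext fun x => ?_
  refine word_induction (P := fun x => f x = g x) h ?_ ?_ ?_ x
  · rw [map_zero, map_zero]
  · intro x y hx hy
    rw [map_add, map_add, hx, hy]
  · intro a x hx
    rw [map_smul, map_smul, hx]

/-- The operators which multiply words by a scalar depending on their lengths. -/
theorem exists_length_operator (c : ℕ → A) :
    ∃ T : GSym A V →ₗ[A] GSym A V, ∀ l, T (word l) = c l.length • word l := by
  -- The substitution `x ↦ x t` on generators respects the relations because they are homogeneous in
  -- the length of words. It separates the lengths as powers of `t`, and the coefficients can then
  -- be rescaled one by one.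
  let θ : GSym A V →ₐ[A] Polynomial (GSym A V) :=
    lift (fun i => (Polynomial.monomial (R := GSym A V) 1).restrictScalars A ∘ₗ gen A V i) (by
      intro i j v w
      simp only [LinearMap.comp_apply, LinearMap.restrictScalars_apply,
        Polynomial.monomial_mul_monomial]
      rw [gen_mul_gen, Units.smul_def, Units.smul_def, map_zsmul])
  have hθ : ∀ l, θ (word l) = Polynomial.monomial l.length (word l) := by
    intro l
    induction l with
    | nil => exact map_one θ
    | cons p l ih =>
      rw [word_cons, map_mul, ih, lift_gen]
      simp [Polynomial.monomial_mul_monomial, add_comm]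
  refine ⟨Polynomial.lsum (fun m => c m • LinearMap.id) ∘ₗ θ.toLinearMap, fun l => ?_⟩
  simp only [LinearMap.comp_apply, AlgHom.toLinearMap_apply, hθ]
  simp [Polynomial.lsum_apply, Polynomial.sum_monomial_index]

end GSym

namespace CDGA

variable {A : Type u} [CommRing A]

section Contraction

variable (V : ℤ → Type u) [∀ i, AddCommGroup (V i)] [∀ i, Module A (V i)]

/-- The total space of generators of `Sym_A (V ⊕ V[1])`. -/
abbrev Cone (V : ℤ → Type u) (i : ℤ) : Type u := V i × V (i + 1)

/-- The differential of `Sym_A (V ⊕ V[1])`. -/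
noncomputable abbrev coneD : GSym A (Cone V) →ₗ[A] GSym A (Cone V) := (acyclicSym V).d

/-- The augmentation of `Sym_A (V ⊕ V[1])`, as an endomorphism. -/
noncomputable def acyclicSymAug : Hom (acyclicSym (A := A) V) (acyclicSym V) :=
  symZero _ _ _ (acyclicSym V)

theorem acyclicSymAug_word_nil : acyclicSymAug (A := A) V (GSym.word []) = 1 := by
  rw [GSym.word_nil]
  exact map_one (acyclicSymAug (A := A) V).toAlgHom

theorem acyclicSymAug_word_cons (p : Σ i, Cone V i) (l : List (Σ i, Cone V i)) :
    acyclicSymAug (A := A) V (GSym.word (p :: l)) = 0 := by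
  rw [GSym.word_cons]
  refine (map_mul (acyclicSymAug (A := A) V).toAlgHom _ _).trans ?_
  have : (acyclicSymAug (A := A) V).toAlgHom (GSym.gen A (Cone V) p.1 p.2) = 0 :=
    GSym.lift_gen (A := A) (V := Cone V) (fun _ => 0) (by simp) p.1 p.2
  exact (congrArg (· * _) this).trans (zero_mul _)

theorem coneD_gen (i : ℤ) (v : V i) (w : V (i + 1)) :
    coneD (A := A) V (GSym.gen A (Cone V) i (v, w))
      = GSym.gen A (Cone V) (i + 1) (w, 0) :=
  GSym.diff_gen (V := Cone V) _ i (v, w)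

theorem cone_cast {V : ℤ → Type u} {i j : ℤ} (h : i = j) [∀ i, AddCommGroup (V i)] (v : V i) :
    ((h ▸ v, 0) : Cone V j) = h ▸ ((v, 0) : Cone V i) := by
  subst h
  rfl

theorem cone_cast' {V : ℤ → Type u} {i j : ℤ} (h : i = j) (h' : i + 1 = j + 1)
    [∀ i, AddCommGroup (V i)] (v : V (i + 1)) :
    ((0, h' ▸ v) : Cone V j) = h ▸ ((0, v) : Cone V i) := by
  subst h
  rfl

/-- Transport between components. -/
def castComp {V : ℤ → Type u} [∀ i, AddCommGroup (V i)] [∀ i, Module A (V i)] {i j : ℤ}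
    (h : i = j) : V i →ₗ[A] V j where
  toFun v := h ▸ v
  map_add' x y := by subst h; rfl
  map_smul' a x := by subst h; rfl

/-- Let `s` be the derivation of degree `-1` which moves `v ⊕ w` to `0 ⊕ v` one degree lower. Then
`d s + s d` is the identity on generators; as the graded commutator of two odd derivations it is a
derivation without signs, so on a word it counts the letters. -/
theorem exists_homotopy : ∃ s : GSym A (Cone V) →ₗ[A] GSym A (Cone V),
    (∀ n x, x ∈ GSym.comp A (Cone V) n → s x ∈ GSym.comp A (Cone V) (n - 1)) ∧
    ∀ l : List (Σ i, Cone V i), coneD V (s (GSym.word l)) +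
      s (coneD V (GSym.word l)) = l.length • GSym.word l := by
  let σ : ∀ i, Cone V i →ₗ[A] GSym A (Cone V) := fun i =>
    GSym.gen A (Cone V) (i - 1) ∘ₗ LinearMap.inr A (V (i - 1)) (V (i - 1 + 1)) ∘ₗ
      castComp (A := A) (V := V) (sub_add_cancel i 1).symm ∘ₗ LinearMap.fst A (V i) (V (i + 1))
  obtain ⟨s, hs1, hsg, hsm, hsc⟩ := GSym.exists_derivation σ (fun i v => GSym.gen_mem _ _)
  have hsg' : ∀ i (v : V i) (w : V (i + 1)), s (GSym.gen A (Cone V) i (v, w)) =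
      GSym.gen A (Cone V) (i - 1) (0, (sub_add_cancel i 1).symm ▸ v) := fun i v w => hsg i (v, w)
  refine ⟨s, hsc, ?_⟩
  have hgen : ∀ i (v : V i) (w : V (i + 1)),
      coneD V (s (GSym.gen A (Cone V) i (v, w))) +
      s (coneD V (GSym.gen A (Cone V) i (v, w)))
        = GSym.gen A (Cone V) i (v, w) := by
    intro i v w
    rw [hsg']
    have h1 : coneD V
        (GSym.gen A (Cone V) (i - 1) (0, (sub_add_cancel i 1).symm ▸ v))
          = GSym.gen A (Cone V) i (v, 0) := by
      rw [coneD_gen, cone_cast (V := V) (sub_add_cancel i 1).symm, GSym.gen_cast]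
    have h2 : s (coneD V (GSym.gen A (Cone V) i (v, w)))
          = GSym.gen A (Cone V) i (0, w) := by
      rw [coneD_gen, hsg',
        cone_cast' (V := V) (add_sub_cancel_right i 1).symm, GSym.gen_cast]
    rw [h1, h2, ← map_add]
    simp
  have hd : ∀ x y : GSym A (Cone V), coneD V (x * y) =
      coneD V x * y + GSym.parity x * coneD V y :=
    GSym.diff_mul _
  have hdc : ∀ n x, x ∈ GSym.comp A (Cone V) n →
      coneD V x ∈ GSym.comp A (Cone V) (n + 1) :=
    fun n x hx => (acyclicSym (A := A) V).d_mem hx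
  intro l
  induction l with
  | nil =>
    have : coneD V (GSym.word []) = 0 := (acyclicSym (A := A) V).d_one
    rw [this, GSym.word_nil, hs1]
    simp
  | cons p l ih =>
    obtain ⟨i, v, w⟩ := p
    have hg := hgen i v w
    rw [GSym.word_cons]
    set x := GSym.gen A (Cone V) i (v, w) with hx
    set y : GSym A (Cone V) := GSym.word l
    have hxi : x ∈ GSym.comp A (Cone V) i := GSym.gen_mem i _
    have e1 := GSym.parity_of_mem hxi
    have e2 := GSym.parity_of_mem (hsc _ _ hxi)
    have e3 := GSym.parity_of_mem (hdc _ _ hxi)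
    rw [Int.negOnePow_sub, Int.negOnePow_one, mul_neg_one, Units.neg_smul] at e2
    rw [Int.negOnePow_succ, Units.neg_smul] at e3
    change coneD V (s (x * y)) + s (coneD V (x * y))
      = (l.length + 1) • (x * y)
    have e4 : coneD V (s (x * y)) + s (coneD V (x * y)) =
        (coneD V (s x) + s (coneD V x)) * y +
        x * (coneD V (s y) + s (coneD V y)) := by
      rw [hsm, hd, map_add, map_add, hd, hsm, e1, e2, e3]
      rcases Int.units_eq_one_or i.negOnePow with h | h
      · simp only [h, one_smul, hd, hsm, e1]
        rw [add_mul, mul_add, neg_mul, neg_mul]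
        abel
      · simp only [h, Units.neg_smul, one_smul, neg_mul, map_neg, hd, hsm, e1, neg_neg]
        rw [add_mul, mul_add]
        abel
    rw [e4, hg, ih, mul_smul_comm, add_smul, one_smul, add_comm]

/-- `Sym_A (V ⊕ V[1])` contracts to `A`. -/
theorem exists_contraction [Algebra ℚ A] :
    ∃ K : (acyclicSym (A := A) V).carrier →ₗ[A] (acyclicSym (A := A) V).carrier,
      (∀ n x, x ∈ (acyclicSym (A := A) V).comp n → K x ∈ (acyclicSym (A := A) V).comp (n - 1)) ∧
      ∀ x, (acyclicSym (A := A) V).d (K x) + K ((acyclicSym (A := A) V).d x)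
        = x - acyclicSymAug V x := by
  obtain ⟨s, hsc, hs⟩ := exists_homotopy (A := A) V
  -- `T` divides a word by its length. The convention `0⁻¹ = 0` makes it kill the empty word, which
  -- is why `N ∘ T` and `T ∘ N` below are both `1 - ε`.
  obtain ⟨T, hT⟩ := GSym.exists_length_operator (A := A) (V := Cone V)
    (fun m => algebraMap ℚ A (m : ℚ)⁻¹)
  have hTm : ∀ n x, x ∈ GSym.comp A (Cone V) n → T x ∈ GSym.comp A (Cone V) n := by
    intro n x hx
    refine GSym.comp_induction (P := fun x => T x ∈ GSym.comp A (Cone V) n) ?_ ?_ ?_ ?_ hx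
    · rintro l rfl
      rw [hT]
      exact Submodule.smul_mem _ _ (GSym.word_mem l)
    · rw [map_zero]
      exact zero_mem _
    · intro x y hx hy
      rw [map_add]
      exact add_mem hx hy
    · intro c x hx
      rw [map_smul]
      exact Submodule.smul_mem _ _ hx
  let D : GSym A (Cone V) →ₗ[A] GSym A (Cone V) := coneD V
  let ε : GSym A (Cone V) →ₗ[A] GSym A (Cone V) := (acyclicSymAug (A := A) V).toAlgHom.toLinearMap
  have hDD : D ∘ₗ D = 0 := LinearMap.ext (acyclicSym (A := A) V).d_d
  have hεD : ε ∘ₗ D = D ∘ₗ ε := LinearMap.ext (acyclicSymAug (A := A) V).map_d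
  let N : GSym A (Cone V) →ₗ[A] GSym A (Cone V) := D ∘ₗ s + s ∘ₗ D
  have hN : ∀ l : List (Σ i, Cone V i), N (GSym.word l) = l.length • GSym.word l := hs
  have hε0 : ε (GSym.word []) = GSym.word [] := acyclicSymAug_word_nil V
  have hε1 : ∀ p l, ε (GSym.word (p :: l)) = 0 := acyclicSymAug_word_cons V
  have hinv : ∀ (m : ℕ) (x : GSym A (Cone V)),
      algebraMap ℚ A ((m + 1 : ℕ) : ℚ)⁻¹ • (m + 1) • x = x := by
    intro m x
    rw [← Nat.cast_smul_eq_nsmul A (m + 1), smul_smul, ← map_natCast (algebraMap ℚ A), ← map_mul,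
      inv_mul_cancel₀ (by positivity), map_one, one_smul]
  have hNT : N ∘ₗ T = LinearMap.id - ε := by
    refine GSym.hom_ext_word fun l => ?_
    cases l with
    | nil =>
      rw [LinearMap.comp_apply, hT, map_smul, hN, LinearMap.sub_apply, hε0]
      simp
    | cons p l =>
      rw [LinearMap.comp_apply, hT, map_smul, hN, LinearMap.sub_apply, hε1, sub_zero]
      exact hinv _ _
  have hTN : T ∘ₗ N = LinearMap.id - ε := by
    refine GSym.hom_ext_word fun l => ?_
    cases l with
    | nil =>
      rw [LinearMap.comp_apply, hN, map_nsmul, hT, LinearMap.sub_apply, hε0]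
      simp
    | cons p l =>
      rw [LinearMap.comp_apply, hN, map_nsmul, hT, LinearMap.sub_apply, hε1, sub_zero,
        smul_comm]
      exact hinv _ _
  have hTε : T ∘ₗ ε = 0 := by
    refine GSym.hom_ext_word fun l => ?_
    cases l with
    | nil =>
      rw [LinearMap.comp_apply, hε0, hT]
      simp
    | cons p l => rw [LinearMap.comp_apply, hε1, map_zero, LinearMap.zero_apply]
  have hεT : ε ∘ₗ T = 0 := by
    refine GSym.hom_ext_word fun l => ?_
    cases l with
    | nil =>
      rw [LinearMap.comp_apply, hT]
      simp
    | cons p l =>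
      rw [LinearMap.comp_apply, hT, map_smul, hε1, smul_zero, LinearMap.zero_apply]
  have hND : N ∘ₗ D = D ∘ₗ N := by
    simp only [N, LinearMap.add_comp, LinearMap.comp_add, LinearMap.comp_assoc, hDD,
      LinearMap.comp_zero, add_zero]
    rw [← LinearMap.comp_assoc s D D, hDD, LinearMap.zero_comp, zero_add]
  -- Away from the constants `T` is the inverse of `N`, so it commutes with `D` because `N` does.
  -- Consequently `s ∘ T` is a contracting homotopy.
  have hTD : T ∘ₗ D = D ∘ₗ T := by
    have h1 : T ∘ₗ N ∘ₗ (D ∘ₗ T) = D ∘ₗ T := by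
      rw [← LinearMap.comp_assoc, hTN, LinearMap.sub_comp, LinearMap.id_comp,
        ← LinearMap.comp_assoc, hεD, LinearMap.comp_assoc, hεT, LinearMap.comp_zero, sub_zero]
    have h2 : T ∘ₗ N ∘ₗ (D ∘ₗ T) = T ∘ₗ D := by
      have e1 : T ∘ₗ N ∘ₗ (D ∘ₗ T) = T ∘ₗ (N ∘ₗ D) ∘ₗ T := rfl
      have e2 : T ∘ₗ (D ∘ₗ N) ∘ₗ T = T ∘ₗ D ∘ₗ (N ∘ₗ T) := rfl
      rw [e1, hND, e2, hNT, LinearMap.comp_sub, ← hεD, LinearMap.comp_sub, ← LinearMap.comp_assoc D,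
        hTε, LinearMap.zero_comp, sub_zero]
      rfl
    rw [← h2, h1]
  refine ⟨s ∘ₗ T, fun n x hx => hsc _ _ (hTm _ _ hx), fun x => ?_⟩
  have h3 : D ∘ₗ (s ∘ₗ T) + (s ∘ₗ T) ∘ₗ D = LinearMap.id - ε := by
    rw [LinearMap.comp_assoc, hTD, ← LinearMap.comp_assoc, ← LinearMap.comp_assoc,
      ← LinearMap.add_comp, hNT]
  exact LinearMap.congr_fun h3 x

end Contraction

end CDGA

/-! ### Stabilization preserves quasi-isomorphisms. -/

namespace CDGA

variable {A : Type u} [CommRing A]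

variable (A) in
/-- The identity. -/
def Hom.id (E : CDGA A) : Hom E E := ⟨AlgHom.id A _, fun h => h, fun _ => rfl⟩

theorem tensor_induction {E F : CDGA A} {Q : (tensor E F).carrier → Prop}
    (ht : ∀ i j x y, x ∈ E.comp i → y ∈ F.comp j → Q (inclLeft E F x * inclRight E F y))
    (h0 : Q 0) (ha : ∀ x y, Q x → Q y → Q (x + y)) (z : (tensor E F).carrier) : Q z :=
  tens_induction (P := Q)
    (fun i j x y hx hy => inclLeft_mul_inclRight E F x y ▸ ht i j x y hx hy) h0 ha z

theorem tensor_d_mul {E F : CDGA A} {i : ℤ} {x : E.carrier} (hx : x ∈ E.comp i) (y : F.carrier) :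
    (tensor E F).d (inclLeft E F x * inclRight E F y) =
      inclLeft E F (E.d x) * inclRight E F y +
        i.negOnePow • (inclLeft E F x * inclRight E F (F.d y)) := by
  rw [(tensor E F).leibniz _ ((inclLeft E F).map_mem hx), Hom.map_d, Hom.map_d]

/-- A contraction of the second factor of a tensor product induces one of the tensor product. -/
theorem exists_tensor_contraction (E : CDGA A) {F : CDGA A} (K : F.carrier →ₗ[A] F.carrier)
    (ε : Hom F F) (hK : ∀ n y, y ∈ F.comp n → K y ∈ F.comp (n - 1))
    (hd : ∀ y, F.d (K y) + K (F.d y) = y - ε y) :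
    ∃ L : (tensor E F).carrier →ₗ[A] (tensor E F).carrier,
      (∀ n z, z ∈ (tensor E F).comp n → L z ∈ (tensor E F).comp (n - 1)) ∧
      ∀ x y, (tensor E F).d (L (inclLeft E F x * inclRight E F y)) +
        L ((tensor E F).d (inclLeft E F x * inclRight E F y))
          = inclLeft E F x * inclRight E F (y - ε y) := by
  -- The parity of the first factor is the Koszul sign for moving `K` past `x`; with it the terms
  -- containing `d x` cancel in `d L + L d`.
  let L : (tensor E F).carrier →ₗ[A] (tensor E F).carrier :=
    (GradedTensorProduct.of A E.comp F.comp).toLinearMap ∘ₗ TensorProduct.map E.parity K ∘ₗ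
      (GradedTensorProduct.of A E.comp F.comp).symm.toLinearMap
  have hL : ∀ i x y, x ∈ E.comp i → L (inclLeft E F x * inclRight E F y)
      = i.negOnePow • (inclLeft E F x * inclRight E F (K y)) := by
    intro i x y hx
    rw [inclLeft_mul_inclRight]
    refine Eq.trans (b := tmul E F (E.parity x) (K y)) rfl ?_
    rw [E.parity_of_mem hx, ← inclLeft_mul_inclRight, Units.smul_def, map_zsmul, smul_mul_assoc,
      Units.smul_def]
  refine ⟨L, ?_, ?_⟩
  · intro n z hz
    refine tensor_comp_induction (Q := fun z => L z ∈ (tensor E F).comp (n - 1)) ?_ ?_ ?_ ?_ hz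
    · rintro i j x y hx hy rfl
      rw [hL i x y hx, Units.smul_def, add_sub_assoc]
      exact zsmul_mem (SetLike.mul_mem_graded ((inclLeft E F).map_mem hx)
        ((inclRight E F).map_mem (hK _ _ hy))) _
    · rw [map_zero]
      exact zero_mem _
    · intro x y hx hy
      rw [map_add]
      exact add_mem hx hy
    · intro c x hx
      rw [map_smul]
      exact Submodule.smul_mem _ _ hx
  · intro x y
    induction x using DirectSum.Decomposition.inductionOn E.comp with
    | zero => simp
    | add x x' hx hx' =>
      rw [map_add, add_mul, map_add, map_add, map_add, map_add, add_mul, ← hx, ← hx']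
      abel
    | @homogeneous i x =>
      obtain ⟨x, hx⟩ := x
      dsimp only
      rw [hL i x y hx, tensor_d_mul hx, Units.smul_def, Units.smul_def, map_zsmul, map_add,
        map_zsmul, tensor_d_mul hx, hL _ _ _ (E.d_mem hx), hL i x _ hx, ← hd, map_add, mul_add,
        Int.negOnePow_succ, ← Units.smul_def, ← Units.smul_def, smul_add, smul_smul, smul_smul,
        Int.units_mul_self, one_smul, one_smul, Units.neg_smul]
      abel

section Stab

variable (E : CDGA A) (V : ℤ → Type u) [∀ i, AddCommGroup (V i)] [∀ i, Module A (V i)]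

/-- The inclusion `Sym_A (V ⊕ V[1]) → E ⊗ Sym_A (V ⊕ V[1])`. -/
noncomputable def stabInclRight : Hom (acyclicSym V) (E.stab V) := inclRight E (acyclicSym V)

/-- The morphism from `Sym_A (V ⊕ V[1])` to `C` which sends the generators to zero. -/
noncomputable def acyclicSymZero (C : CDGA A) : Hom (acyclicSym V) C := symZero _ _ _ C

theorem acyclicSymZero_gen (C : CDGA A) (i : ℤ) (v : Cone V i) :
    acyclicSymZero V C (GSym.gen A (Cone V) i v) = 0 :=
  GSym.lift_gen (A := A) (V := Cone V) (fun _ => 0) (by simp) i v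

theorem stabInclRight_acyclicSymAug (y : (acyclicSym (A := A) V).carrier) :
    E.stabInclRight V (acyclicSymAug V y) = E.stabIncl V (acyclicSymZero V E y) := by
  have : (E.stabInclRight V).toAlgHom.comp (acyclicSymAug V).toAlgHom =
      (E.stabIncl V).toAlgHom.comp (acyclicSymZero V E).toAlgHom := by
    refine GSym.algHom_ext (V := Cone V) fun i v => ?_
    refine (congrArg (E.stabInclRight V).toAlgHom
      (acyclicSymZero_gen V (acyclicSym (A := A) V) i v)).trans ?_
    rw [map_zero]
    exact ((congrArg (E.stabIncl V).toAlgHom (acyclicSymZero_gen V E i v)).trans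
      (map_zero _)).symm
  exact AlgHom.congr_fun this y

variable {E} in
theorem stabProj_mul {C : CDGA A} (p : Hom E C) (x : E.carrier)
    (y : (acyclicSym (A := A) V).carrier) :
    stabProj p V (E.stabIncl V x * E.stabInclRight V y) = p x * acyclicSymZero V C y :=
  congrArg (stabProj p V) (inclLeft_mul_inclRight E (acyclicSym V) x y)

variable {E} in
theorem stabProj_stabIncl {C : CDGA A} (p : Hom E C) (x : E.carrier) :
    stabProj p V (E.stabIncl V x) = p x := by
  refine Eq.trans (b := p x * acyclicSymZero V C 1) rfl ?_
  rw [map_one, mul_one]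

variable {E V} in
theorem stab_induction {Q : (E.stab V).carrier → Prop}
    (ht : ∀ i j x y, x ∈ E.comp i → y ∈ (acyclicSym (A := A) V).comp j →
      Q (E.stabIncl V x * E.stabInclRight V y))
    (h0 : Q 0) (ha : ∀ x y, Q x → Q y → Q (x + y)) (z : (E.stab V).carrier) : Q z :=
  tensor_induction (Q := Q) ht h0 ha z

variable {V} in
/-- Every cocycle of `E ⊗ Sym_A (V ⊕ V[1])` is cohomologous to one of `E`. -/
theorem exists_cohomologous [Algebra ℚ A] {n : ℤ} {z : (E.stab V).carrier}
    (hz : z ∈ (E.stab V).comp n) (hd : (E.stab V).d z = 0) :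
    ∃ y ∈ (E.stab V).comp (n - 1),
      z = (E.stab V).d y + E.stabIncl V (stabProj (Hom.id A E) V z) := by
  obtain ⟨K, hK, hKd⟩ := exists_contraction (A := A) V
  obtain ⟨L, hL, hLd⟩ : ∃ L : (E.stab V).carrier →ₗ[A] (E.stab V).carrier,
      (∀ n z, z ∈ (E.stab V).comp n → L z ∈ (E.stab V).comp (n - 1)) ∧
      ∀ x y, (E.stab V).d (L (E.stabIncl V x * E.stabInclRight V y)) +
        L ((E.stab V).d (E.stabIncl V x * E.stabInclRight V y))
          = E.stabIncl V x * E.stabInclRight V (y - acyclicSymAug V y) :=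
    exists_tensor_contraction E K (acyclicSymAug V) hK hKd
  refine ⟨L z, hL n z hz, ?_⟩
  have key : ∀ z : (E.stab V).carrier, (E.stab V).d (L z) + L ((E.stab V).d z)
      = z - E.stabIncl V (stabProj (Hom.id A E) V z) := by
    intro z
    refine stab_induction (Q := fun z : (E.stab V).carrier => (E.stab V).d (L z) +
      L ((E.stab V).d z) = z - E.stabIncl V (stabProj (Hom.id A E) V z)) ?_ ?_ ?_ z
    · intro i j x y hx hy
      refine (hLd x y).trans ?_
      rw [stabProj_mul, map_sub, mul_sub, stabInclRight_acyclicSymAug, map_mul]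
      rfl
    · simp
    · intro x y hx hy
      rw [map_add, map_add, map_add, map_add, map_add, map_add, add_add_add_comm, hx, hy]
      abel
  have h := key z
  rw [hd, map_zero, add_zero] at h
  rw [h, sub_add_cancel]

variable {E} in
-- The composite `E → E ⊗ Sym (V ⊕ V[1]) → C` is `p`. By the contraction the first map is surjective
-- on cohomology, and since `p` is bijective there, this alone forces the second map to be
-- bijective.
theorem stabProj_isQuasiIso [Algebra ℚ A] {C : CDGA A} {p : Hom E C} (hp : p.IsQuasiIso) :
    (stabProj p V).IsQuasiIso := by
  intro i
  have hcomp : ∀ a, (stabProj p V).cohomologyMap i ((E.stabIncl V).cohomologyMap i a)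
      = p.cohomologyMap i a := by
    intro a
    obtain ⟨a, rfl⟩ := Submodule.Quotient.mk_surjective _ a
    simp only [Hom.cohomologyMap, Submodule.mapQ_apply]
    congr 1
    exact Subtype.ext (stabProj_stabIncl V p a)
  have hsurj : Function.Surjective ((E.stabIncl V).cohomologyMap i) := by
    intro a
    obtain ⟨⟨z, hz, hd⟩, rfl⟩ := Submodule.Quotient.mk_surjective _ a
    have hd' : (E.stab V).d z = 0 := hd
    obtain ⟨y, hy, e⟩ := E.exists_cohomologous hz hd'
    refine ⟨Submodule.Quotient.mk ⟨stabProj (Hom.id A E) V z, (Hom.map_mem _ hz), ?_⟩, ?_⟩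
    · change E.d _ = 0
      rw [← Hom.map_d, hd', map_zero]
    · simp only [Hom.cohomologyMap, Submodule.mapQ_apply]
      refine ((Submodule.Quotient.eq _).2 ?_).symm
      refine ⟨y, hy, ?_⟩
      change (E.stab V).d y = z - E.stabIncl V (stabProj (Hom.id A E) V z)
      exact eq_sub_of_add_eq e.symm
  constructor
  · intro a b hab
    obtain ⟨a, rfl⟩ := hsurj a
    obtain ⟨b, rfl⟩ := hsurj b
    rw [hcomp, hcomp] at hab
    rw [(hp i).1 hab]
  · intro c
    obtain ⟨a, rfl⟩ := (hp i).2 c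
    exact ⟨_, hcomp a⟩

end Stab

end CDGA

/-! ### Finiteness of generators and of components. -/

namespace GSym

variable {A : Type u} [CommRing A] {V : ℤ → Type u} [∀ i, AddCommGroup (V i)]
  [∀ i, Module A (V i)]

/-- Map to the square-zero extension `A ⊕ V i`, identically on `V i` and by zero on the other
generators. All products of images vanish there, so the relations hold for every choice of signs. -/
theorem gen_injective (i : ℤ) : Function.Injective (gen A V i) := by
  classical
  let _ : Module Aᵐᵒᵖ (V i) := Module.compHom _ ((RingHom.id A).fromOpposite mul_comm)
  have : IsCentralScalar A (V i) := ⟨fun _ _ => rfl⟩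
  let f : ∀ j, V j →ₗ[A] TrivSqZeroExt A (V i) := fun j =>
    if h : j = i then TrivSqZeroExt.inrHom A (V i) ∘ₗ CDGA.castComp h else 0
  have hf : ∀ j v, ∃ m, f j v = TrivSqZeroExt.inr m := by
    intro j v
    by_cases h : j = i
    · exact ⟨CDGA.castComp (A := A) h v, by simp only [f, dif_pos h]; rfl⟩
    · exact ⟨0, by simp only [f, dif_neg h]; simp⟩
  have h0 : ∀ j k v w, f j v * f k w = 0 := by
    intro j k v w
    obtain ⟨m, hm⟩ := hf j v
    obtain ⟨n, hn⟩ := hf k w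
    rw [hm, hn, TrivSqZeroExt.inr_mul_inr]
  have hi : ∀ v, f i v = TrivSqZeroExt.inr v := by
    intro v
    simp only [f, dif_pos]
    rfl
  intro v w hvw
  have h := congrArg (lift f fun j k v w => by rw [h0, h0, smul_zero]) hvw
  rw [lift_gen, lift_gen, hi, hi] at h
  exact TrivSqZeroExt.inr_injective h

/-- Removing the first letter of a non-zero word brings its degree closer to zero. So a component
lies in a finite sum of products of generator modules with components that are already known to be
finitely generated. -/
theorem comp_fg [IsNoetherianRing A] (hV : ∀ i, 0 ≤ i → Subsingleton (V i)) [∀ i, Module.Finite A (V i)] (n : ℤ) :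
    (comp A V n).FG := by
  obtain hn | hn := lt_or_ge 0 n
  · have : comp A V n = ⊥ := by
      rw [eq_bot_iff]
      exact fun x hx => eq_zero_of_mem_pos hV hn hx
    rw [this]
    exact Submodule.fg_bot
  obtain ⟨m, rfl⟩ : ∃ m : ℕ, n = -m := ⟨n.natAbs, by omega⟩
  clear hn
  induction m using Nat.strong_induction_on with
  | _ m ih =>
    -- `N` is only an upper bound, since it contains `1` in every degree in order to account for the
    -- empty word. Passing to the submodule below it is where the Noetherian hypothesis enters.
    let N : Submodule A (GSym A V) := Submodule.span A {1} ⊔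
      ⨆ j ∈ Finset.range m, LinearMap.range (gen A V (-((j + 1 : ℕ) : ℤ))) *
        comp A V (-((m - (j + 1) : ℕ) : ℤ))
    have hN : N.FG := by
      refine (Submodule.fg_span_singleton 1).sup (Submodule.fg_biSup _ _ fun j hj => ?_)
      rw [Finset.mem_range] at hj
      refine Submodule.FG.mul ?_ (ih _ (by omega))
      rw [LinearMap.range_eq_map]
      exact Module.Finite.fg_top.map _
    have key : ∀ l : List (Σ i, V i), wordDeg l = -(m : ℤ) → word l ∈ N := by
      intro l hl
      cases l with
      | nil => exact Submodule.mem_sup_left (Submodule.subset_span rfl)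
      | cons p l =>
        obtain ⟨i, v⟩ := p
        by_cases h0 : (word (⟨i, v⟩ :: l) : GSym A V) = 0
        · rw [h0]
          exact zero_mem _
        have hi : i < 0 := by
          by_contra hi
          have := hV i (by omega)
          apply h0
          rw [word_cons, Subsingleton.elim v 0, map_zero, zero_mul]
        have hl0 : wordDeg l ≤ 0 := by
          by_contra hl0
          apply h0
          rw [word_cons, eq_zero_of_mem_pos (A := A) hV (not_le.1 hl0) (word_mem l), mul_zero]
        rw [wordDeg_cons] at hl
        dsimp only at hl
        rw [word_cons]
        obtain ⟨j, rfl⟩ : ∃ j : ℕ, i = -((j + 1 : ℕ) : ℤ) := ⟨(-i - 1).toNat, by omega⟩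
        refine Submodule.mem_sup_right ?_
        refine Submodule.mem_iSup_of_mem j (Submodule.mem_iSup_of_mem
          (Finset.mem_range.2 (by omega)) (Submodule.mul_mem_mul ⟨v, rfl⟩ ?_))
        have : -((m - (j + 1) : ℕ) : ℤ) = wordDeg l := by omega
        rw [this]
        exact word_mem l
    have : comp A V (-(m : ℤ)) ≤ N := fun x hx =>
      comp_induction (P := fun x => x ∈ N) key (zero_mem _) (fun x y => add_mem)
        (fun a x => N.smul_mem a) hx
    exact hN.of_le this

end GSym

namespace CDGA

variable {A : Type u} [CommRing A]

section

variable {X Y : CDGA A} {P : ℤ → Type u} [∀ i, AddCommGroup (P i)] [∀ i, Module A (P i)]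

theorem Generators.ι_injective (G : X.Generators P) (i : ℤ) : Function.Injective (G.ι i) :=
  G.equiv.injective.comp (GSym.gen_injective i)

/-- The generators of degree `i` embed into the component of degree `i`, which is a Noetherian
module. -/
theorem Generators.finite [IsNoetherianRing A] (G : X.Generators P) (hX : X.InCA) (i : ℤ) :
    Module.Finite A (P i) := by
  have := hX.finite i
  exact Module.Finite.of_injective ((G.ι i).codRestrict (X.comp i) (G.ι_mem i)) fun p q h =>
    G.ι_injective i (congrArg Subtype.val h)

theorem Generators.inCA [IsNoetherianRing A] [∀ i, Module.Finite A (P i)] (G : X.Generators P) :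
    X.InCA where
  nonpos := G.comp_pos
  finite := by
    intro i
    have : X.comp i = (GSym.comp A P i).map G.equiv.toLinearMap := by
      ext x
      constructor
      · intro hx
        refine ⟨G.equiv.symm x, (G.mem_iff _ _).2 ?_, G.equiv.apply_symm_apply x⟩
        rwa [AlgEquiv.apply_symm_apply]
      · rintro ⟨y, hy, rfl⟩
        exact (G.mem_iff _ _).1 hy
    rw [Module.Finite.iff_fg, this]
    exact (GSym.comp_fg G.negative i).map _

theorem Generators.isSemiFreeOn [∀ i, Module.Projective A (P i)] (G : X.Generators P) :
    X.IsSemiFreeOn P where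
  negative := G.negative
  projective := inferInstance
  exists_equiv := ⟨G.equiv, G.mem_iff⟩

/-- Generators of `E ⊗ Sym_A (V ⊕ V[1])`. -/
theorem exists_stabGenerators {E : CDGA A} (G : E.Generators P) (V : ℤ → Type u)
    [∀ i, AddCommGroup (V i)] [∀ i, Module A (V i)] (hV : ∀ i, 0 ≤ i → Subsingleton (V i)) :
    ∃ K : (E.stab V).Generators (fun i => P i × V i × V (i + 1)),
      (∀ i p, K.ι i (p, 0) = E.stabIncl V (G.ι i p)) ∧
      ∀ i v, (E.stab V).d (K.ι i (0, v, 0)) = 0 := by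
  let H : (acyclicSym (A := A) V).Generators (fun i => V i × V (i + 1)) :=
    symGenerators _ _ _ fun i hi => by
      have := hV i hi
      have := hV (i + 1) (by omega)
      infer_instance
  obtain ⟨K, hK⟩ := exists_tensorGenerators G H
  refine ⟨K, fun i p => ?_, fun i v => ?_⟩
  · refine (hK i (p, 0)).trans ?_
    rw [map_zero, map_zero, add_zero]
    rfl
  · refine (congrArg (tensor E (acyclicSym V)).d (hK i (0, v, 0))).trans ?_
    rw [map_zero, map_zero, zero_add, ← Hom.map_d]
    have : (acyclicSym (A := A) V).d (H.ι i (v, 0)) = 0 :=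
      (coneD_gen V i v 0).trans (map_zero _)
    rw [this, map_zero]
    rfl

/-- The stabilization of a Tate resolution is a Tate resolution. -/
theorem isTateResolution_stabProj [IsNoetherianRing A] [Algebra ℚ A] {E C : CDGA A} {p : Hom E C}
    (hp : IsTateResolution p) (V : ℤ → Type u)
    [∀ i, AddCommGroup (V i)] [∀ i, Module A (V i)] (hV : ∀ i, 0 ≤ i → Subsingleton (V i))
    [∀ i, Module.Projective A (V i)] [∀ i, Module.Finite A (V i)] :
    IsTateResolution (stabProj p V) := by
  obtain ⟨P, _, _, hP⟩ := hp.semiFree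
  obtain ⟨G⟩ := hP.nonempty_generators
  have := hP.projective
  have := G.finite hp.inCA
  obtain ⟨K, -, -⟩ := exists_stabGenerators G V hV
  exact ⟨K.inCA, ⟨_, _, _, K.isSemiFreeOn⟩, stabProj_isQuasiIso V hp.quasiIso⟩

end

end CDGA

/-! ### The modules to be added: an Eilenberg swindle and a finite recursion. -/

section Swindle

variable {A : Type u} [CommRing A]

theorem Module.Projective.nonempty_prod_ker {K M : Type u} [AddCommGroup K] [Module A K]
    [AddCommGroup M] [Module A M] [Module.Projective A M] (π : K →ₗ[A] M)
    (hπ : Function.Surjective π) : Nonempty (K ≃ₗ[A] M × LinearMap.ker π) := by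
  obtain ⟨s, hs⟩ := Module.projective_lifting_property π LinearMap.id hπ
  have hs' : ∀ m, π (s m) = m := LinearMap.congr_fun hs
  have hm : ∀ x, (LinearMap.id - s ∘ₗ π : K →ₗ[A] K) x ∈ LinearMap.ker π := by
    intro x
    simp [hs']
  refine ⟨LinearEquiv.ofLinearMap (π.prod ((LinearMap.id - s ∘ₗ π).codRestrict _ hm))
    (s.coprod (LinearMap.ker π).subtype) ?_ ?_⟩
  · refine LinearMap.ext ?_
    rintro ⟨m, x, hx⟩
    have hx' : π x = 0 := hx
    refine Prod.ext ?_ (Subtype.ext ?_)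
    · simp [hs', hx']
    · simp [hs', hx']
  · refine LinearMap.ext fun x => ?_
    simp

/-- Finitely supported functions with values in a product. -/
noncomputable def finsuppProdEquiv (M N : Type u) [AddCommGroup M] [Module A M] [AddCommGroup N]
    [Module A N] : (ℕ →₀ M × N) ≃ₗ[A] (ℕ →₀ M) × (ℕ →₀ N) :=
  LinearEquiv.ofLinearMap
    ((Finsupp.mapRange.linearMap (LinearMap.fst A M N)).prod
      (Finsupp.mapRange.linearMap (LinearMap.snd A M N)))
    ((Finsupp.mapRange.linearMap (LinearMap.inl A M N)).coprod
      (Finsupp.mapRange.linearMap (LinearMap.inr A M N)))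
    (by
      refine LinearMap.ext ?_
      rintro ⟨f, g⟩
      refine Prod.ext ?_ ?_ <;> ext i <;> simp)
    (by
      refine LinearMap.ext fun f => ?_
      ext i <;> simp)

/-- The first value splits off. -/
noncomputable def finsuppNatEquiv (M : Type u) [AddCommGroup M] [Module A M] :
    (ℕ →₀ M) ≃ₗ[A] M × (ℕ →₀ M) :=
  (Finsupp.domLCongr Equiv.natSumPUnitEquivNat.{0}.symm).trans <|
    (Finsupp.sumFinsuppLEquivProdFinsupp A).trans <|
      (LinearEquiv.prodComm A _ _).trans <|
        (Finsupp.uniqueLinearEquiv A M PUnit.unit).prodCongr (LinearEquiv.refl A _)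

/-- The free module `K` on all elements of all `P i` and `Q i` maps onto each of these modules, so
each `P i` is a direct summand of `K`. Let `L` be the direct sum of countably many copies of `K`. It
contains countably many copies of `P i` as a summand, so one more makes no difference; and `L ≅ L ×
L` because `ℕ` is the disjoint union of two copies of itself. -/
theorem exists_absorbing (P Q : ℤ → Type u) [∀ i, AddCommGroup (P i)] [∀ i, Module A (P i)]
    [∀ i, AddCommGroup (Q i)] [∀ i, Module A (Q i)] [∀ i, Module.Projective A (P i)]
    [∀ i, Module.Projective A (Q i)] :
    ∃ (L : Type u) (_ : AddCommGroup L) (_ : Module A L), Module.Free A L ∧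
      Nonempty (L ≃ₗ[A] L × L) ∧ (∀ i, Nonempty (L ≃ₗ[A] P i × L)) ∧
      ∀ i, Nonempty (L ≃ₗ[A] Q i × L) := by
  classical
  have key : ∀ (K M : Type u) [AddCommGroup K] [Module A K] [AddCommGroup M]
      [Module A M] [Module.Projective A M] (π : K →ₗ[A] M) (_ : Function.Surjective π), Nonempty ((ℕ →₀ K) ≃ₗ[A] M × (ℕ →₀ K)) := by
    intro K M _ _ _ _ _ π hπ
    obtain ⟨e⟩ := Module.Projective.nonempty_prod_ker π hπ
    let e' : (ℕ →₀ K) ≃ₗ[A] (ℕ →₀ M) × (ℕ →₀ LinearMap.ker π) :=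
      (Finsupp.mapRange.linearEquiv e).trans (finsuppProdEquiv M (LinearMap.ker π))
    exact ⟨e'.trans <| ((finsuppNatEquiv M).prodCongr (LinearEquiv.refl A _)).trans <|
      (LinearEquiv.prodAssoc A _ _ _).trans <| (LinearEquiv.refl A _).prodCongr e'.symm⟩
  refine ⟨ℕ →₀ ((Σ i, P i ⊕ Q i) →₀ A), inferInstance, inferInstance, inferInstance, ?_, fun i => ?_, fun i => ?_⟩
  · exact ⟨(Finsupp.domLCongr Equiv.natSumNatEquivNat.symm).trans
      (Finsupp.sumFinsuppLEquivProdFinsupp A)⟩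
  · refine key _ (P i) (Finsupp.lsum A fun x => (LinearMap.toSpanSingleton A (P i)
      (if h : x.1 = i then Sum.elim (fun p => h ▸ p) (fun _ => 0) x.2 else 0))) fun p => ?_
    exact ⟨Finsupp.single ⟨i, Sum.inl p⟩ 1, by simp⟩
  · refine key _ (Q i) (Finsupp.lsum A fun x => (LinearMap.toSpanSingleton A (Q i)
      (if h : x.1 = i then Sum.elim (fun _ => 0) (fun p => h ▸ p) x.2 else 0))) fun p => ?_
    exact ⟨Finsupp.single ⟨i, Sum.inr p⟩ 1, by simp⟩

end Swindle

/-- The recursion for the modules which have to be added. -/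
theorem exists_alternating {A : Type u} [CommRing A] (P Q : ℤ → Type u) [∀ i, AddCommGroup (P i)]
    [∀ i, Module A (P i)] [∀ i, AddCommGroup (Q i)] [∀ i, Module A (Q i)] (k : ℤ) :
    ∃ V W : ℤ → ModuleCat.{u} A, (∀ i, k ≤ i → Subsingleton (V i) ∧ Subsingleton (W i)) ∧
      (∀ i, i < k → Nonempty (V i ≃ₗ[A] Q i × W (i + 1))) ∧
      (∀ i, i < k → Nonempty (W i ≃ₗ[A] P i × V (i + 1))) ∧
      ∀ R : ModuleCat.{u} A → Prop, R (ModuleCat.of A PUnit) →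
        (∀ M N : ModuleCat.{u} A, R M → R N → R (ModuleCat.of A (M × N))) →
        (∀ i, i < k → R (ModuleCat.of A (P i)) ∧ R (ModuleCat.of A (Q i))) →
        ∀ i, R (V i) ∧ R (W i) := by
  -- `S n` is the pair of modules in degree `k - n`, for `n = 0` the zero modules. Each of the two
  -- sequences takes its next term from the other one, one degree higher.
  let S : ℕ → ModuleCat.{u} A × ModuleCat.{u} A := fun n => Nat.rec
    (ModuleCat.of A PUnit, ModuleCat.of A PUnit)
    (fun n p => (ModuleCat.of A (Q (k - 1 - n) × p.2), ModuleCat.of A (P (k - 1 - n) × p.1))) n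
  have h1 : ∀ n : ℕ, (k - (k - 1 - n)).toNat = n + 1 := fun n => by omega
  have h2 : ∀ n : ℕ, (k - (k - 1 - n + 1)).toNat = n := fun n => by omega
  have h3 : ∀ i, i < k → ∃ n : ℕ, i = k - 1 - n := fun i hi => ⟨(k - 1 - i).toNat, by omega⟩
  have h4 : ∀ n m m' : ℕ, m = n + 1 → m' = n →
      Nonempty ((S m).1 ≃ₗ[A] Q (k - 1 - n) × (S m').2) := by
    rintro n _ _ rfl rfl
    exact ⟨LinearEquiv.refl A _⟩
  have h5 : ∀ n m m' : ℕ, m = n + 1 → m' = n →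
      Nonempty ((S m).2 ≃ₗ[A] P (k - 1 - n) × (S m').1) := by
    rintro n _ _ rfl rfl
    exact ⟨LinearEquiv.refl A _⟩
  refine ⟨fun i => (S (k - i).toNat).1, fun i => (S (k - i).toNat).2, ?_, ?_, ?_, ?_⟩
  · intro i hi
    have : (k - i).toNat = 0 := by omega
    simp only [this]
    exact ⟨inferInstanceAs (Subsingleton PUnit), inferInstanceAs (Subsingleton PUnit)⟩
  · intro i hi
    obtain ⟨n, rfl⟩ := h3 i hi
    exact h4 n _ _ (h1 n) (h2 n)
  · intro i hi
    obtain ⟨n, rfl⟩ := h3 i hi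
    exact h5 n _ _ (h1 n) (h2 n)
  -- A single induction for an arbitrary property stable under products; it will be used for
  -- projective, finite and free modules.
  · intro R h0 hp hPQ i
    have : ∀ n, R (S n).1 ∧ R (S n).2 := by
      intro n
      induction n with
      | zero => exact ⟨h0, h0⟩
      | succ n ih =>
        have := hPQ (k - 1 - n) (by omega)
        exact ⟨hp _ _ this.2 ih.2, hp _ _ this.1 ih.1⟩
    exact this _

/-! ### Matching the generators of two stabilizations. -/

namespace CDGA

variable {A : Type u} [CommRing A]

section

variable {E F C : CDGA A} {P Q : ℤ → Type u} [∀ i, AddCommGroup (P i)]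
  [∀ i, Module A (P i)] [∀ i, AddCommGroup (Q i)] [∀ i, Module A (Q i)]
  {V W L : ℤ → Type u} [∀ i, AddCommGroup (V i)] [∀ i, Module A (V i)]
  [∀ i, AddCommGroup (W i)] [∀ i, Module A (W i)]

/-- The homomorphism between stabilizations which is `f` on `E` and kills the new generators. -/
noncomputable def GradedHom.stab (f : GradedHom E F) (V W : ℤ → Type u) [∀ i, AddCommGroup (V i)]
    [∀ i, Module A (V i)] [∀ i, AddCommGroup (W i)] [∀ i, Module A (W i)] :
    GradedHom (E.stab V) (F.stab W) :=
  (F.stabIncl W).toGradedHom.comp (f.comp (stabProj (Hom.id A E) V).toGradedHom)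

theorem GradedHom.stab_apply (f : GradedHom E F) (z : (E.stab V).carrier) :
    f.stab V W z = F.stabIncl W (f (stabProj (Hom.id A E) V z)) := rfl

theorem GradedHom.stab_stabIncl (f : GradedHom E F) (x : E.carrier) :
    f.stab V W (E.stabIncl V x) = F.stabIncl W (f x) := by
  rw [GradedHom.stab_apply, stabProj_stabIncl]
  rfl

/-- Stabilization does not change the components above the degrees of the new generators. -/
theorem stabIncl_stabProj (G : E.Generators P) {k : ℤ} (hk : k ≤ 0)
    (hV : ∀ i, k ≤ i → Subsingleton (V i)) {i : ℤ} {z : (E.stab V).carrier} (hi : k ≤ i)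
    (hz : z ∈ (E.stab V).comp i) : E.stabIncl V (stabProj (Hom.id A E) V z) = z := by
  obtain ⟨K, hK, -⟩ := exists_stabGenerators G V fun i hi => hV i (hk.trans hi)
  refine K.ext (f := (E.stabIncl V).toGradedHom.comp (stabProj (Hom.id A E) V).toGradedHom)
    (g := GradedHom.id A (E.stab V)) (m := k) ?_ hi hz
  rintro j hj _ ⟨p, v⟩
  have := hV j hj
  have := hV (j + 1) (by omega)
  rw [Subsingleton.elim v 0, hK]
  change E.stabIncl V (stabProj (Hom.id A E) V (E.stabIncl V (G.ι j p))) = _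
  rw [stabProj_stabIncl]
  rfl

/-- The added generators of degree `i` are `V i × V (i + 1)`, which is zero for `i ≥ k`. In these
degrees `E` and its stabilization coincide, and the inverse pair is simply transported. -/
theorem InverseGE.stab (G : E.Generators P) (H : F.Generators Q) {k : ℤ} (hk : k ≤ 0)
    {f : GradedHom E F} {g : GradedHom F E} (h : InverseGE f g k)
    (hV : ∀ i, k ≤ i → Subsingleton (V i)) (hW : ∀ i, k ≤ i → Subsingleton (W i)) :
    InverseGE (f.stab V W) (g.stab W V) k where
  map_d i x hi hx := by
    rw [GradedHom.stab_apply, GradedHom.stab_apply, Hom.map_d, h.map_d i _ hi (Hom.map_mem _ hx),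
      Hom.map_d]
  map_d' i x hi hx := by
    rw [GradedHom.stab_apply, GradedHom.stab_apply, Hom.map_d, h.map_d' i _ hi (Hom.map_mem _ hx),
      Hom.map_d]
  left_inv i x hi hx := by
    rw [GradedHom.stab_apply f, GradedHom.stab_stabIncl, h.left_inv i _ hi (Hom.map_mem _ hx),
      stabIncl_stabProj G hk hV hi hx]
  right_inv i x hi hx := by
    rw [GradedHom.stab_apply g, GradedHom.stab_stabIncl, h.right_inv i _ hi (Hom.map_mem _ hx),
      stabIncl_stabProj H hk hW hi hx]

end

section

variable {P Q V V' W W' L : Type u} [AddCommGroup P] [Module A P] [AddCommGroup Q] [Module A Q]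
  [AddCommGroup V] [Module A V] [AddCommGroup V'] [Module A V']
  [AddCommGroup W] [Module A W] [AddCommGroup W'] [Module A W'] [AddCommGroup L] [Module A L]

/-- The splitting of the generators of the first stabilization. -/
def splitLeft (eV : V ≃ₗ[A] (Q × W') × L) (eW : W ≃ₗ[A] (P × V') × L) :
    (P × V × V') ≃ₗ[A] W × (Q × W') where
  -- The summand `L` of `V` is moved over to `W`. What remains of `V` is `Q × W'`, so this factor of
  -- the target comes entirely from the closed generators.
  toFun x := (eW.symm ((x.1, x.2.2), (eV x.2.1).2), (eV x.2.1).1)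
  invFun y := ((eW y.1).1.1, eV.symm (y.2, (eW y.1).2), (eW y.1).1.2)
  map_add' x y := by
    simp only [Prod.fst_add, Prod.snd_add, map_add, Prod.mk_add_mk, ← map_add eW.symm]
  map_smul' a x := by
    simp only [Prod.smul_fst, Prod.smul_snd, map_smul, Prod.smul_mk, RingHom.id_apply,
      ← map_smul eW.symm]
  left_inv x := by simp
  right_inv x := by simp

/-- The splitting of the generators of the second stabilization. -/
def splitRight : (Q × W × W') ≃ₗ[A] W × (Q × W') where
  toFun x := (x.2.1, x.1, x.2.2)
  invFun y := (y.2.1, y.1, y.2.2)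
  map_add' _ _ := rfl
  map_smul' _ _ := rfl
  left_inv _ := rfl
  right_inv _ := rfl

end

section

variable [Algebra ℚ A] {E F C : CDGA A} {P Q : ℤ → Type u} [∀ i, AddCommGroup (P i)]
  [∀ i, Module A (P i)] [∀ i, AddCommGroup (Q i)] [∀ i, Module A (Q i)]
  [∀ i, Module.Projective A (Q i)]
  {V W L : ℤ → Type u} [∀ i, AddCommGroup (V i)] [∀ i, Module A (V i)]
  [∀ i, AddCommGroup (W i)] [∀ i, Module A (W i)] [∀ i, AddCommGroup (L i)] [∀ i, Module A (L i)]
  [∀ i, Module.Projective A (W i)]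

/-- The isomorphisms `eV` and `eW` identify the generators of degree `i` on both sides with `W i ×
(Q i × W (i + 1))`. The second factor sits inside the closed summand `V i` on the left, and the
first factor is the closed summand `W i` on the right, as the inductive step requires. The free
parameter `L` serves the finite version, where it is zero, as well as the swindle. -/
theorem exists_iso_stab (hC : C.ConcentratedInDegreeZero) (G : E.Generators P)
    (H : F.Generators Q) {pE : Hom E C} {pF : Hom F C} (hE : pE.IsQuasiIso) (hF : pF.IsQuasiIso)
    {k : ℤ} (hk : k ≤ 0) {f : GradedHom E F} {g : GradedHom F E} (h : InverseGE f g k)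
    (hV : ∀ i, k ≤ i → Subsingleton (V i)) (hW : ∀ i, k ≤ i → Subsingleton (W i))
    (eV : ∀ i, i < k → V i ≃ₗ[A] (Q i × W (i + 1)) × L i)
    (eW : ∀ i, i < k → W i ≃ₗ[A] (P i × V (i + 1)) × L i) :
    ∃ Φ : Iso (E.stab V) (F.stab W), ∀ i x, k ≤ i → x ∈ E.comp i →
      Φ.hom (E.stabIncl V x) = F.stabIncl W (f x) := by
  obtain ⟨GX, hX, hdX⟩ := exists_stabGenerators G V fun i hi => hV i (hk.trans hi)
  obtain ⟨GY, hY, hdY⟩ := exists_stabGenerators H W fun i hi => hW i (hk.trans hi)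
  obtain ⟨Φ, hΦ⟩ := (h.stab G H hk hV hW).exists_iso hC GX GY
    (stabProj_isQuasiIso V hE).kernelAcyclic (stabProj_isQuasiIso W hF).kernelAcyclic
    (W := W) (V := fun i => Q i × W (i + 1))
    (fun i hi => splitLeft (eV i hi) (eW i hi)) (fun i hi => splitRight)
    (fun i hi v => by
      have : (splitLeft (eV i hi) (eW i hi)).symm (0, v) = (0, (eV i hi).symm (v, 0), 0) := by
        change (((eW i hi 0).1.1, (eV i hi).symm (v, (eW i hi 0).2), (eW i hi 0).1.2) : P i × _ × _)
          = _
        rw [map_zero]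
        rfl
      rw [this, hdX])
    (fun i hi w => hdY i w)
  refine ⟨Φ, fun i x hi hx => ?_⟩
  rw [hΦ i _ hi ((E.stabIncl V).map_mem hx), GradedHom.stab_stabIncl]

end

end CDGA

/-! ### Stable isomorphisms with projective, finite free and infinite free modules. -/

namespace CDGA

variable {A : Type u} [CommRing A] [Algebra ℚ A]

section

variable {E F C : CDGA A} {pE : Hom E C} {pF : Hom F C} {k : ℤ} {f : GradedHom E F}
  {g : GradedHom F E} {n : ℤ} {r : E.carrier → F.carrier → Prop}

/-- This is the case `L = 0`, solved by the recursion. Freeness is stated as an implication about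
the same `V` and `W`, since the recursion uses only generators of degree below `k` and makes the
added modules free as soon as those are. -/
theorem exists_finite_stableIso [IsNoetherianRing A] (hC : C.ConcentratedInDegreeZero)
    (hE : IsTateResolution pE) (hF : IsTateResolution pF) (hk : k ≤ 0) (h : InverseGE f g k)
    (hn : ∀ i, n < i ∨ 0 ≤ i → k ≤ i)
    (hr : ∀ x y, r x y → ∃ i, k ≤ i ∧ x ∈ E.comp i ∧ y = f x)
    {P Q : ℤ → Type u} [∀ i, AddCommGroup (P i)]
    [∀ i, Module A (P i)] [∀ i, AddCommGroup (Q i)] [∀ i, Module A (Q i)] (hP : E.IsSemiFreeOn P)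
    (hQ : F.IsSemiFreeOn Q) :
    ∃ V W : ℤ → ModuleCat.{u} A, (∀ i, Module.Projective A (V i) ∧ Module.Finite A (V i)) ∧
      (∀ i, Module.Projective A (W i) ∧ Module.Finite A (W i)) ∧
      ((∀ i, i < k → Module.Free A (P i) ∧ Module.Free A (Q i)) →
        ∀ i, Module.Free A (V i) ∧ Module.Free A (W i)) ∧
      (E.stab fun i => V i).InCA ∧ (F.stab fun i => W i).InCA ∧
      StableIso E F n r (fun i => V i) (fun i => W i) := by
  obtain ⟨G⟩ := hP.nonempty_generators
  obtain ⟨H⟩ := hQ.nonempty_generators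
  have := hP.projective
  have := hQ.projective
  have := G.finite hE.inCA
  have := H.finite hF.inCA
  obtain ⟨V, W, h0, hV, hW, hR⟩ := exists_alternating (A := A) P Q k
  have hproj := hR (fun M => Module.Projective A M) (inferInstanceAs (Module.Projective A PUnit.{u + 1}))
    (fun M N (_ : Module.Projective A M) (_ : Module.Projective A N) =>
      inferInstanceAs (Module.Projective A (M × N)))
    (fun i _ => ⟨inferInstanceAs (Module.Projective A (P i)),
      inferInstanceAs (Module.Projective A (Q i))⟩)
  have hfin := hR (fun M => Module.Finite A M) (inferInstanceAs (Module.Finite A PUnit.{u + 1}))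
    (fun M N (_ : Module.Finite A M) (_ : Module.Finite A N) =>
      inferInstanceAs (Module.Finite A (M × N)))
    (fun i _ => ⟨inferInstanceAs (Module.Finite A (P i)), inferInstanceAs (Module.Finite A (Q i))⟩)
  have hfree := hR (fun M => Module.Free A M) (inferInstanceAs (Module.Free A PUnit.{u + 1}))
    (fun M N (_ : Module.Free A M) (_ : Module.Free A N) =>
      inferInstanceAs (Module.Free A (M × N)))
  have := fun i => (hproj i).1
  have := fun i => (hproj i).2
  have := fun i => (hfin i).1
  have := fun i => (hfin i).2
  have h0V : ∀ i, k ≤ i → Subsingleton (V i) := fun i hi => (h0 i hi).1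
  have h0W : ∀ i, k ≤ i → Subsingleton (W i) := fun i hi => (h0 i hi).2
  obtain ⟨Φ, hΦ⟩ := exists_iso_stab (V := fun i => V i) (W := fun i => W i)
    (L := fun _ => PUnit) hC G H hE.quasiIso hF.quasiIso hk h h0V h0W
    (fun i hi => (hV i hi).some.trans LinearEquiv.prodUnique.symm)
    (fun i hi => (hW i hi).some.trans LinearEquiv.prodUnique.symm)
  obtain ⟨GX, -⟩ := exists_stabGenerators G (fun i => V i) fun i hi => h0V i (hk.trans hi)
  obtain ⟨GY, -⟩ := exists_stabGenerators H (fun i => W i) fun i hi => h0W i (hk.trans hi)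
  refine ⟨V, W, fun i => ⟨(hproj i).1, (hfin i).1⟩, fun i => ⟨(hproj i).2, (hfin i).2⟩,
    fun h => hfree h, GX.inCA, GY.inCA, fun i hi => h0 i (hn i hi), Φ, ?_⟩
  intro x y hxy
  obtain ⟨i, hi, hx, rfl⟩ := hr x y hxy
  exact hΦ i x hi hx

/-- Here `V = W` is the absorbing module in all degrees below `k` and zero from `k` on. -/
theorem exists_free_stableIso (hC : C.ConcentratedInDegreeZero) (hE : IsTateResolution pE)
    (hF : IsTateResolution pF) (hk : k ≤ 0) (h : InverseGE f g k)
    (hn : ∀ i, n < i ∨ 0 ≤ i → k ≤ i)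
    (hr : ∀ x y, r x y → ∃ i, k ≤ i ∧ x ∈ E.comp i ∧ y = f x) : StablyIsoFree E F n r := by
  obtain ⟨P, _, _, hP⟩ := hE.semiFree
  obtain ⟨Q, _, _, hQ⟩ := hF.semiFree
  obtain ⟨G⟩ := hP.nonempty_generators
  obtain ⟨H⟩ := hQ.nonempty_generators
  have := hP.projective
  have := hQ.projective
  obtain ⟨L, _, _, hL, ⟨eL⟩, hPL, hQL⟩ := exists_absorbing (A := A) P Q
  let V : ℤ → ModuleCat.{u} A := fun i => if i < k then ModuleCat.of A L else ModuleCat.of A PUnit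
  have hV1 : ∀ i, i < k → V i = ModuleCat.of A L := fun i hi => if_pos hi
  have hV0 : ∀ i, k ≤ i → V i = ModuleCat.of A PUnit := fun i hi => if_neg (not_lt.2 hi)
  have hsub : ∀ i, k ≤ i → Subsingleton (V i) := by
    intro i hi
    rw [hV0 i hi]
    exact inferInstanceAs (Subsingleton PUnit)
  have hfree : ∀ i, Module.Free A (V i) := by
    intro i
    rcases lt_or_ge i k with hi | hi
    · rw [hV1 i hi]
      exact hL
    · have := hsub i hi
      infer_instance
  have eV : ∀ i, i < k → Nonempty (V i ≃ₗ[A] L) := by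
    intro i hi
    rw [hV1 i hi]
    exact ⟨LinearEquiv.refl A _⟩
  -- Both cases are needed: just below `k` the neighbour `V (i + 1)` is zero, and further down it is
  -- a copy of `L`, absorbed by `L ≅ L × L`.
  have eVL : ∀ i, Nonempty ((V i × L) ≃ₗ[A] L) := by
    intro i
    rcases lt_or_ge i k with hi | hi
    · obtain ⟨e⟩ := eV i hi
      exact ⟨(e.prodCongr (LinearEquiv.refl A _)).trans eL.symm⟩
    · have := hsub i hi
      have : Unique (V i) := uniqueOfSubsingleton 0
      exact ⟨LinearEquiv.uniqueProd⟩
  have e : ∀ (M : Type u) [AddCommGroup M] [Module A M], Nonempty (L ≃ₗ[A] M × L) → ∀ i, i < k →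
      Nonempty (V i ≃ₗ[A] (M × V (i + 1)) × L) := by
    rintro M _ _ ⟨eM⟩ i hi
    obtain ⟨e1⟩ := eV i hi
    obtain ⟨e2⟩ := eVL (i + 1)
    exact ⟨(e1.trans eM).trans (((LinearEquiv.refl A M).prodCongr e2.symm).trans
      (LinearEquiv.prodAssoc A _ _ _).symm)⟩
  obtain ⟨Φ, hΦ⟩ := exists_iso_stab (V := fun i => V i) (W := fun i => V i)
    (L := fun _ => L) hC G H hE.quasiIso hF.quasiIso hk h hsub hsub
    (fun i hi => (e (Q i) (hQL i) i hi).some) (fun i hi => (e (P i) (hPL i) i hi).some)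
  refine ⟨fun i => V i, inferInstance, inferInstance, fun i => V i, inferInstance, inferInstance,
    hfree, hfree, fun i hi => ⟨hsub i (hn i hi), hsub i (hn i hi)⟩, Φ, ?_⟩
  intro x y hxy
  obtain ⟨i, hi, hx, rfl⟩ := hr x y hxy
  exact hΦ i x hi hx

/-- Isomorphisms in degrees at least `k` become stable isomorphisms. -/
theorem stablyIso_of_inverseGE [IsNoetherianRing A] (hC : C.ConcentratedInDegreeZero)
    (hE : IsTateResolution pE) (hF : IsTateResolution pF) (hk : k ≤ 0) (h : InverseGE f g k)
    (hn : ∀ i, n < i ∨ 0 ≤ i → k ≤ i)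
    (hr : ∀ x y, r x y → ∃ i, k ≤ i ∧ x ∈ E.comp i ∧ y = f x) {S : ℤ → Prop}
    (hS : ∀ i, i < k → S i) :
    StablyIsoProjective E F n r ∧ (HaveFreeGenerators E F S → StablyIsoFiniteFree E F n r) ∧
      StablyIsoFree E F n r := by
  refine ⟨?_, ?_, exists_free_stableIso hC hE hF hk h hn hr⟩
  · obtain ⟨P, _, _, hP⟩ := hE.semiFree
    obtain ⟨Q, _, _, hQ⟩ := hF.semiFree
    obtain ⟨V, W, hV, hW, -, h1, h2, h3⟩ :=
      exists_finite_stableIso hC hE hF hk h hn hr hP hQ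
    exact ⟨fun i => V i, inferInstance, inferInstance, fun i => W i, inferInstance, inferInstance,
      hV, hW, h1, h2, h3⟩
  · rintro ⟨P, _, _, Q, _, _, hP, hQ, hPQ⟩
    obtain ⟨V, W, hV, hW, hfree, h1, h2, h3⟩ :=
      exists_finite_stableIso hC hE hF hk h hn hr hP hQ
    have hfree := hfree fun i hi => hPQ i (hS i hi)
    exact ⟨fun i => V i, inferInstance, inferInstance, fun i => W i, inferInstance, inferInstance,
      fun i => ⟨(hfree i).1, (hV i).2⟩, fun i => ⟨(hfree i).2, (hW i).2⟩, h1, h2, h3⟩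

end

end CDGA

/-! ### Starting points of the induction, and the extension by one degree. -/

namespace CDGA

variable {A : Type u} [CommRing A]

section Start

variable {E F C : CDGA A} {P Q : ℤ → Type u} [∀ i, AddCommGroup (P i)]
  [∀ i, Module A (P i)] [∀ i, AddCommGroup (Q i)] [∀ i, Module A (Q i)]

/-- A morphism which is bijective in degrees at least `k` has an inverse there. -/
theorem exists_inverseGE (H : F.Generators Q) (f : Hom E F) {k : ℤ} (hf : f.IsIsoGE k) :
    ∃ g : GradedHom F E, InverseGE f.toGradedHom g k := by
  -- In degrees at least `k` the values on generators are forced by bijectivity. Below `k` any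
  -- values are admissible, and zero is taken.
  have key : ∀ i, ∃ φ : Q i →ₗ[A] E.carrier, (∀ q, φ q ∈ E.comp i) ∧
      (k ≤ i → ∀ q, f (φ q) = H.ι i q) := by
    intro i
    by_cases hi : k ≤ i
    · let e : E.comp i ≃ₗ[A] F.comp i := LinearEquiv.ofBijective
        (f.toAlgHom.toLinearMap.restrict fun x hx => f.map_mem hx)
        ⟨fun x y hxy => Subtype.ext ((hf i hi).injOn x.2 y.2 (congrArg Subtype.val hxy)),
          fun y => by
            obtain ⟨x, hx, e⟩ := (hf i hi).surjOn y.2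
            exact ⟨⟨x, hx⟩, Subtype.ext e⟩⟩
      refine ⟨(E.comp i).subtype ∘ₗ e.symm.toLinearMap ∘ₗ
        (H.ι i).codRestrict (F.comp i) (H.ι_mem i), fun q => Subtype.property _, fun _ q => ?_⟩
      exact congrArg Subtype.val (e.apply_symm_apply ⟨H.ι i q, H.ι_mem i q⟩)
    · exact ⟨0, fun q => zero_mem _, fun h => absurd h hi⟩
  choose φ hφ hfφ using key
  have hfg : ∀ i y, k ≤ i → y ∈ F.comp i → f (H.lift φ hφ y) = y := by
    intro i y hi hy
    refine H.ext (f := f.toGradedHom.comp (H.lift φ hφ)) (g := GradedHom.id A F) (m := k) ?_ hi hy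
    intro j hj _ q
    rw [GradedHom.comp_apply, H.lift_ι]
    exact hfφ j hj q
  have hgf : ∀ i x, k ≤ i → x ∈ E.comp i → H.lift φ hφ (f x) = x := fun i x hi hx =>
    (hf i hi).injOn ((H.lift φ hφ).map_mem (f.map_mem hx)) hx (hfg i _ hi (f.map_mem hx))
  refine ⟨H.lift φ hφ, fun i x _ _ => f.map_d x, ?_, hgf, hfg⟩
  intro i y hi hy
  have hd := hgf (i + 1) _ (by omega) (E.d_mem ((H.lift φ hφ).map_mem hy))
  rw [f.map_d, hfg i y hi hy] at hd
  exact hd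

/-- There are no generators of degree `≥ 0`, so in these degrees both algebras reduce to `A` and
every pair of graded homomorphisms is an inverse pair. -/
theorem exists_inverseGE_zero (G : E.Generators P) (H : F.Generators Q) :
    ∃ (f : GradedHom E F) (g : GradedHom F E), InverseGE f g 0 := by
  let f : GradedHom E F := G.lift (fun _ => 0) fun _ _ => zero_mem _
  let g : GradedHom F E := H.lift (fun _ => 0) fun _ _ => zero_mem _
  refine ⟨f, g, fun i x hi hx => ?_, fun i x hi hx => ?_, fun i x hi hx => ?_, fun i x hi hx => ?_⟩
  · exact G.map_d (m := 0) (fun j h1 h2 => absurd h2 (not_lt.2 h1)) hi hx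
  · exact H.map_d (m := 0) (fun j h1 h2 => absurd h2 (not_lt.2 h1)) hi hx
  · exact G.ext (f := g.comp f) (g := GradedHom.id A E) (m := 0)
      (fun j h1 h2 => absurd h2 (not_lt.2 h1)) hi hx
  · exact H.ext (f := f.comp g) (g := GradedHom.id A F) (m := 0)
      (fun j h1 h2 => absurd h2 (not_lt.2 h1)) hi hx

/-- A product of two or more generators of negative degree has degree at most `-2`. -/
theorem Generators.exists_eq_ι (G : E.Generators P) {x : E.carrier} (hx : x ∈ E.comp (-1)) :
    ∃ p, x = G.ι (-1) p := by
  obtain ⟨y, rfl⟩ := G.equiv.surjective x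
  suffices h : ∃ p, y = GSym.gen A P (-1) p by
    obtain ⟨p, rfl⟩ := h
    exact ⟨p, rfl⟩
  refine GSym.comp_induction (P := fun y => ∃ p, y = GSym.gen A P (-1) p) ?_ ?_ ?_ ?_
    ((G.mem_iff _ _).2 hx)
  · intro l hl
    by_cases h0 : (GSym.word l : GSym A P) = 0
    · exact ⟨0, by rw [h0, map_zero]⟩
    have hneg : ∀ l : List (Σ i, P i), (GSym.word l : GSym A P) ≠ 0 → ∀ p ∈ l, p.1 < 0 := by
      intro l hl p hp
      by_contra hp'
      have := G.negative p.1 (by omega)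
      refine hl (List.prod_eq_zero (List.mem_map.2 ⟨p, hp, ?_⟩))
      rw [Subsingleton.elim p.2 0, map_zero]
    have hl' := hneg l h0
    match l, hl, hl' with
    | [], hl, _ => simp [GSym.wordDeg] at hl
    | [⟨i, p⟩], hl, _ =>
      simp only [GSym.wordDeg, List.map_cons, List.map_nil, List.sum_cons, List.sum_nil,
        add_zero] at hl
      subst hl
      exact ⟨p, by simp [GSym.word]⟩
    | p :: q :: l, hl, hl' =>
      exfalso
      have h1 := hl' p (by simp)
      have h2 := hl' q (by simp)
      have h3 : ∀ l : List (Σ i, P i), (∀ p ∈ l, p.1 < 0) → GSym.wordDeg l ≤ 0 := by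
        intro l
        induction l with
        | nil => simp [GSym.wordDeg]
        | cons p l ih =>
          intro h
          rw [GSym.wordDeg_cons]
          have := h p (by simp)
          have := ih fun q hq => h q (by simp [hq])
          omega
      have h4 := h3 l fun r hr => hl' r (by simp [hr])
      rw [GSym.wordDeg_cons, GSym.wordDeg_cons] at hl
      omega
  · exact ⟨0, (map_zero _).symm⟩
  · rintro _ _ ⟨p, rfl⟩ ⟨q, rfl⟩
    exact ⟨p + q, (map_add _ _ _).symm⟩
  · rintro a _ ⟨p, rfl⟩
    exact ⟨a • p, (map_smul _ _ _).symm⟩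

variable {T : Type u} [AddCommGroup T] [Module A T]

theorem exists_extension_of_equiv (G : E.Generators P) (a : T ≃ₗ[A] E.comp (-1))
    (b : T ≃ₗ[A] F.comp (-1)) : ∃ f : GradedHom E F, ∀ t, f (a t) = b t := by
  obtain ⟨f, -, hf⟩ := G.exists_extension (G.lift (Y := F) (fun _ => 0) fun _ _ => zero_mem _) (-1)
    ((F.comp (-1)).subtype ∘ₗ b.toLinearMap ∘ₗ a.symm.toLinearMap ∘ₗ
      (G.ι (-1)).codRestrict (E.comp (-1)) (G.ι_mem (-1))) (fun p => Subtype.property _)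
  refine ⟨f, fun t => ?_⟩
  obtain ⟨p, hp⟩ := G.exists_eq_ι (a t).2
  rw [hp, hf]
  have : (G.ι (-1)).codRestrict (E.comp (-1)) (G.ι_mem (-1)) p = a t := Subtype.ext hp.symm
  simp only [LinearMap.comp_apply, this]
  simp

/-- Degree `-1` consists of generators only, so the identity of `T` may be prescribed there. That
both differentials are `δ` is exactly the compatibility with `d` in this degree. -/
theorem exists_inverseGE_of_equiv (G : E.Generators P) (H : F.Generators Q) (δ : T →ₗ[A] A)
    (a : T ≃ₗ[A] E.comp (-1)) (b : T ≃ₗ[A] F.comp (-1))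
    (ha : ∀ t, E.d (a t) = algebraMap A E.carrier (δ t))
    (hb : ∀ t, F.d (b t) = algebraMap A F.carrier (δ t)) :
    ∃ (f : GradedHom E F) (g : GradedHom F E), InverseGE f g (-1) ∧ ∀ t, f (a t) = b t := by
  obtain ⟨f, hf⟩ := exists_extension_of_equiv G a b
  obtain ⟨g, hg⟩ := exists_extension_of_equiv H b a
  have hG : ∀ j, -1 ≤ j → j < 0 → ∀ p, ∃ t, G.ι j p = a t := by
    intro j h1 h2 p
    obtain rfl : j = -1 := by omega
    exact ⟨a.symm ⟨_, G.ι_mem _ p⟩, by simp⟩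
  have hH : ∀ j, -1 ≤ j → j < 0 → ∀ p, ∃ t, H.ι j p = b t := by
    intro j h1 h2 p
    obtain rfl : j = -1 := by omega
    exact ⟨b.symm ⟨_, H.ι_mem _ p⟩, by simp⟩
  refine ⟨f, g, ⟨fun i x hi hx => G.map_d (m := -1) ?_ hi hx,
    fun i x hi hx => H.map_d (m := -1) ?_ hi hx,
    fun i x hi hx => G.ext (f := g.comp f) (g := GradedHom.id A E) (m := -1) ?_ hi hx,
    fun i x hi hx => H.ext (f := f.comp g) (g := GradedHom.id A F) (m := -1) ?_ hi hx⟩, hf⟩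
  · intro j h1 h2 p
    obtain ⟨t, ht⟩ := hG j h1 h2 p
    rw [ht, ha, hf, hb, AlgHom.commutes]
  · intro j h1 h2 p
    obtain ⟨t, ht⟩ := hH j h1 h2 p
    rw [ht, hb, hg, ha, AlgHom.commutes]
  · intro j h1 h2 p
    obtain ⟨t, ht⟩ := hG j h1 h2 p
    rw [ht, GradedHom.comp_apply, hf, hg]
    rfl
  · intro j h1 h2 p
    obtain ⟨t, ht⟩ := hH j h1 h2 p
    rw [ht, GradedHom.comp_apply, hg, hf]
    rfl

/-- A morphism which is bijective on the subalgebras generated in degrees at least `k` is bijective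
in these degrees. -/
theorem isIsoGE_of_bijOn_subalgebraGE (f : Hom E F) {k : ℤ}
    (hf : Set.BijOn f (E.subalgebraGE k) (F.subalgebraGE k)) : f.IsIsoGE k := by
  intro i hi
  have hE : ∀ x ∈ E.comp i, x ∈ E.subalgebraGE k := fun x hx => Algebra.subset_adjoin ⟨i, hi, hx⟩
  have hF : ∀ x ∈ F.comp i, x ∈ F.subalgebraGE k := fun x hx => Algebra.subset_adjoin ⟨i, hi, hx⟩
  refine ⟨fun x hx => f.map_mem hx, fun x hx y hy h => hf.injOn (hE x hx) (hE y hy) h, ?_⟩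
  intro y hy
  obtain ⟨x, -, rfl⟩ := hf.surjOn (hF y hy)
  -- The preimage `x` from the subalgebra is not known to be homogeneous, but `f` respects degrees,
  -- so its component of degree `i` also maps to the homogeneous element.
  refine ⟨DirectSum.decompose E.comp x i, Subtype.property _, ?_⟩
  have key : ∀ x, f (DirectSum.decompose E.comp x i) = DirectSum.decompose F.comp (f x) i := by
    intro x
    induction x using DirectSum.Decomposition.inductionOn E.comp with
    | zero => simp
    | add x y hx hy =>
      rw [DirectSum.decompose_add, map_add, DirectSum.decompose_add, DirectSum.add_apply,
        DirectSum.add_apply, Submodule.coe_add, Submodule.coe_add, map_add, hx, hy]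
    | @homogeneous j x =>
      by_cases hj : j = i
      · subst hj
        rw [DirectSum.decompose_of_mem_same _ x.2,
          DirectSum.decompose_of_mem_same _ (f.map_mem x.2)]
      · rw [DirectSum.decompose_of_mem_ne _ x.2 hj,
          DirectSum.decompose_of_mem_ne _ (f.map_mem x.2) hj, map_zero]
  change f (DirectSum.decompose E.comp x i) = f x
  rw [key, DirectSum.decompose_of_mem_same _ hy]

end Start

section Extends

theorem exists_concentrated (M : Type u) [AddCommGroup M] [Module A M] (k : ℤ) :
    ∃ V : ℤ → ModuleCat.{u} A, (∀ i, i ≠ k → Subsingleton (V i)) ∧ Nonempty (V k ≃ₗ[A] M) := by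
  let V : ℤ → ModuleCat.{u} A := fun i => if i = k then ModuleCat.of A M else ModuleCat.of A PUnit
  have h1 : V k = ModuleCat.of A M := if_pos rfl
  have h0 : ∀ i, i ≠ k → V i = ModuleCat.of A PUnit := fun i hi => if_neg hi
  refine ⟨V, fun i hi => ?_, ?_⟩
  · rw [h0 i hi]
    exact inferInstanceAs (Subsingleton PUnit)
  · rw [h1]
    exact ⟨LinearEquiv.refl A _⟩

section

variable {k : ℤ} {V : ℤ → ModuleCat.{u} A} {M : Type u} [AddCommGroup M] [Module A M]

theorem projective_finite_of_concentrated [Module.Projective A M] [Module.Finite A M]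
    (hV : ∀ i, i ≠ k → Subsingleton (V i)) (e : V k ≃ₗ[A] M) (i : ℤ) :
    Module.Projective A (V i) ∧ Module.Finite A (V i) := by
  by_cases hi : i = k
  · subst hi
    exact ⟨Module.Projective.of_equiv e.symm, Module.Finite.equiv e.symm⟩
  · have := hV i hi
    exact ⟨inferInstance, inferInstance⟩

theorem free_of_concentrated [Module.Free A M] (hV : ∀ i, i ≠ k → Subsingleton (V i))
    (e : V k ≃ₗ[A] M) (i : ℤ) : Module.Free A (V i) := by
  by_cases hi : i = k
  · subst hi
    exact Module.Free.of_equiv e.symm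
  · have := hV i hi
    infer_instance

end

variable [IsNoetherianRing A] [Algebra ℚ A]
  {E F C : CDGA A} {P Q : ℤ → Type u} [∀ i, AddCommGroup (P i)]
  [∀ i, Module A (P i)] [∀ i, AddCommGroup (Q i)] [∀ i, Module A (Q i)]
  {V W : ℤ → Type u} [∀ i, AddCommGroup (V i)] [∀ i, Module A (V i)]
  [∀ i, AddCommGroup (W i)] [∀ i, Module A (W i)]
  [∀ i, Module.Projective A (V i)] [∀ i, Module.Projective A (W i)]
  [∀ i, Module.Finite A (V i)] [∀ i, Module.Finite A (W i)]

/-- This is one inductive step in degree `-d`. Since `V` and `W` vanish in degree `-d + 1`, the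
matching conditions reduce to `V ≅ Q` and `W ≅ P` in degree `-d`: each algebra receives the
generators of the other one. -/
theorem extendsInDegree (hC : C.ConcentratedInDegreeZero) {pE : Hom E C} {pF : Hom F C}
    (hE : IsTateResolution pE) (hF : IsTateResolution pF) (hP : E.IsSemiFreeOn P)
    (hQ : F.IsSemiFreeOn Q) {d : ℕ} (hd : 0 < d) (f : Hom E F)
    (hf : f.IsIsoGE (-((d : ℤ) - 1))) (hV : ∀ i, i ≠ -(d : ℤ) → Subsingleton (V i))
    (hW : ∀ i, i ≠ -(d : ℤ) → Subsingleton (W i)) (eV : V (-(d : ℤ)) ≃ₗ[A] Q (-(d : ℤ)))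
    (eW : W (-(d : ℤ)) ≃ₗ[A] P (-(d : ℤ))) : ExtendsInDegree pE pF f d V W := by
  obtain ⟨G⟩ := hP.nonempty_generators
  obtain ⟨H⟩ := hQ.nonempty_generators
  have := hP.projective
  have := hQ.projective
  obtain ⟨k, hk⟩ : ∃ k, k = -(d : ℤ) := ⟨_, rfl⟩
  have hk1 : -((d : ℤ) - 1) = k + 1 := by omega
  rw [hk1] at hf
  rw [← hk] at eV eW
  have hV0 : ∀ i, k + 1 ≤ i → Subsingleton (V i) := fun i hi => hV i (by omega)
  have hW0 : ∀ i, k + 1 ≤ i → Subsingleton (W i) := fun i hi => hW i (by omega)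
  have hV1 : ∀ i, 0 ≤ i → Subsingleton (V i) := fun i hi => hV i (by omega)
  have hW1 : ∀ i, 0 ≤ i → Subsingleton (W i) := fun i hi => hW i (by omega)
  have hTE := isTateResolution_stabProj hE V hV1
  have hTF := isTateResolution_stabProj hF W hW1
  obtain ⟨g, hfg⟩ := exists_inverseGE H f hf
  obtain ⟨GX, -, hdX⟩ := exists_stabGenerators G V hV1
  obtain ⟨GY, -, hdY⟩ := exists_stabGenerators H W hW1
  have := hV0 (k + 1) le_rfl
  have := hW0 (k + 1) le_rfl
  have : Unique (V (k + 1)) := uniqueOfSubsingleton 0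
  have : Unique (W (k + 1)) := uniqueOfSubsingleton 0
  let eV' : V k ≃ₗ[A] (Q k × W (k + 1)) × PUnit.{u + 1} :=
    (eV.trans LinearEquiv.prodUnique.symm).trans LinearEquiv.prodUnique.symm
  let eW' : W k ≃ₗ[A] (P k × V (k + 1)) × PUnit.{u + 1} :=
    (eW.trans LinearEquiv.prodUnique.symm).trans LinearEquiv.prodUnique.symm
  obtain ⟨f', g', hfg', hf', -⟩ := (hfg.stab G H (by omega) hV0 hW0).exists_step hC GX GY
    hTE.quasiIso.kernelAcyclic hTF.quasiIso.kernelAcyclic (splitLeft eV' eW') splitRight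
    (fun v => by
      have : (splitLeft eV' eW').symm (0, v) = (0, eV'.symm (v, 0), 0) := by
        change (((eW' 0).1.1, eV'.symm (v, (eW' 0).2), (eW' 0).1.2) : P k × _ × _) = _
        rw [map_zero]
        rfl
      rw [this, hdX])
    (fun w => hdY k w)
  -- The step controls `f'` only in degrees at least `k`. Further down it is replaced by a map
  -- commuting with `d`, which need not be bijective there.
  obtain ⟨Φ, hΦ⟩ := GX.exists_hom hC (stabProj pE V) hTF.quasiIso.kernelAcyclic f' hfg'.map_d
  refine ⟨fun i hi => ⟨hV i hi, hW i hi⟩, hTE, hTF, Φ, ?_, ?_, ?_⟩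
  · exact GX.isOver hC (stabProj pE V) (stabProj pF W) Φ.toGradedHom
  · intro i hi
    rw [← hk] at hi
    refine ⟨fun x hx => Φ.map_mem hx, fun x hx y hy hxy => ?_, fun y hy => ?_⟩
    · rw [hΦ i x hi hx, hΦ i y hi hy] at hxy
      rw [← hfg'.left_inv i x hi hx, hxy, hfg'.left_inv i y hi hy]
    · exact ⟨g' y, g'.map_mem hy, (hΦ i _ hi (g'.map_mem hy)).trans (hfg'.right_inv i y hi hy)⟩
  · intro x hx
    rw [hk1] at hx
    have : Set.EqOn (Φ.toAlgHom.comp (E.stabIncl V).toAlgHom)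
        ((F.stabIncl W).toAlgHom.comp f.toAlgHom) {x | ∃ i, k + 1 ≤ i ∧ x ∈ E.comp i} := by
      rintro x ⟨i, hi, hx⟩
      have hx' := (E.stabIncl V).map_mem hx
      exact (hΦ i _ (by omega) hx').trans ((hf' i _ (by omega) hx').trans
        (GradedHom.stab_stabIncl f.toGradedHom x))
    exact AlgHom.eqOn_adjoin_iff.2 this hx

end Extends

end CDGA

/-! ### The four statements. -/

theorem mainTheorem6 {A : Type u} [CommRing A] [IsNoetherianRing A] [Algebra ℚ A]
    (C : CDGA A) (hC : C.InCA) (hC0 : C.ConcentratedInDegreeZero)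
    {E F : CDGA A} (pE : CDGA.Hom E C) (pF : CDGA.Hom F C)
    (hE : CDGA.IsTateResolution pE) (hF : CDGA.IsTateResolution pF) :
    -- a morphism which is an isomorphism in degrees `≥ -d + 1` becomes a stable isomorphism
    (∀ (d : ℕ) (f : CDGA.Hom E F), CDGA.IsOver pE pF f → f.IsIsoGE (-(d : ℤ) + 1) →
      CDGA.StablyIsoProjective E F (-(d : ℤ)) (f.graphGE (-(d : ℤ) + 1)) ∧
      (CDGA.HaveFreeGenerators E F (fun i => i ≤ -(d : ℤ)) →
        CDGA.StablyIsoFiniteFree E F (-(d : ℤ)) (f.graphGE (-(d : ℤ) + 1))) ∧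
      CDGA.StablyIsoFree E F (-(d : ℤ)) (f.graphGE (-(d : ℤ) + 1))) ∧
    -- the inductive step
    (∀ (d : ℕ) (f : CDGA.Hom E F), 0 < d → CDGA.IsOver pE pF f →
      Set.BijOn f (E.subalgebraGE (-((d : ℤ) - 1))) (F.subalgebraGE (-((d : ℤ) - 1))) →
      (∃ (V : ℤ → Type u) (_ : ∀ i, AddCommGroup (V i)) (_ : ∀ i, Module A (V i))
        (W : ℤ → Type u) (_ : ∀ i, AddCommGroup (W i)) (_ : ∀ i, Module A (W i)),
        (∀ i, Module.Projective A (V i) ∧ Module.Finite A (V i)) ∧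
        (∀ i, Module.Projective A (W i) ∧ Module.Finite A (W i)) ∧
        CDGA.ExtendsInDegree pE pF f d V W) ∧
      (CDGA.HaveFreeGenerators E F (fun i => i = -(d : ℤ)) →
        ∃ (V : ℤ → Type u) (_ : ∀ i, AddCommGroup (V i)) (_ : ∀ i, Module A (V i))
          (W : ℤ → Type u) (_ : ∀ i, AddCommGroup (W i)) (_ : ∀ i, Module A (W i)),
          (∀ i, Module.Free A (V i) ∧ Module.Finite A (V i)) ∧
          (∀ i, Module.Free A (W i) ∧ Module.Finite A (W i)) ∧
          CDGA.ExtendsInDegree pE pF f d V W)) ∧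
    -- any two Tate resolutions are stably isomorphic
    (CDGA.StablyIsoProjective E F (-1) (fun _ _ => False) ∧
      (CDGA.HaveFreeGenerators E F (fun _ => True) →
        CDGA.StablyIsoFiniteFree E F (-1) (fun _ _ => False)) ∧
      CDGA.StablyIsoFree E F (-1) (fun _ _ => False)) ∧
    -- Tate resolutions extending the same `δ : T → A` in degree `-1` are stably isomorphic by an
    -- isomorphism that is the identity in degree `-1` (and `0`)
    (∀ (T : Type u) [AddCommGroup T] [Module A T] (δ : T →ₗ[A] A)
      (a : T ≃ₗ[A] E.comp (-1)) (b : T ≃ₗ[A] F.comp (-1)),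
      (∀ t, E.d (a t) = algebraMap A E.carrier (δ t)) →
      (∀ t, F.d (b t) = algebraMap A F.carrier (δ t)) →
      CDGA.StablyIsoProjective E F (-2) (fun x y => ∃ t, x = a t ∧ y = b t) ∧
      (CDGA.HaveFreeGenerators E F (fun i => i ≤ -2) →
        CDGA.StablyIsoFiniteFree E F (-2) (fun x y => ∃ t, x = a t ∧ y = b t)) ∧
      CDGA.StablyIsoFree E F (-2) (fun x y => ∃ t, x = a t ∧ y = b t)) := by
  obtain ⟨P, _, _, hP⟩ := hE.semiFree
  obtain ⟨Q, _, _, hQ⟩ := hF.semiFree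
  obtain ⟨G⟩ := hP.nonempty_generators
  obtain ⟨H⟩ := hQ.nonempty_generators
  refine ⟨?_, ?_, ?_, ?_⟩
  · intro d f _ hf
    rcases Nat.eq_zero_or_pos d with rfl | hd
    -- For `d = 0` the bound on degrees is `1`, but `V` and `W` have to vanish in degree `0` too, so
    -- the induction starts from `k = 0` with an arbitrary pair. Agreement with `f` is demanded only
    -- in degrees `≥ 1`, where both algebras are zero.
    · obtain ⟨f₀, g₀, h⟩ := CDGA.exists_inverseGE_zero G H
      refine CDGA.stablyIso_of_inverseGE hC0 hE hF le_rfl h (fun i hi => by omega) ?_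
        (fun i hi => by omega)
      rintro x y ⟨i, hi, hx, rfl⟩
      have hx' := hx
      rw [G.comp_pos i (by omega), Submodule.mem_bot] at hx'
      exact ⟨i, by omega, hx, by rw [hx', map_zero, map_zero]⟩
    · obtain ⟨g, h⟩ := CDGA.exists_inverseGE H f hf
      exact CDGA.stablyIso_of_inverseGE hC0 hE hF (by omega) h (fun i hi => by omega)
        (fun x y h => h) (fun i hi => by omega)
  · intro d f hd _ hf
    have hf' := CDGA.isIsoGE_of_bijOn_subalgebraGE f hf
    refine ⟨?_, ?_⟩
    · have := hP.projective
      have := hQ.projective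
      have := G.finite hE.inCA
      have := H.finite hF.inCA
      obtain ⟨V, hV, ⟨eV⟩⟩ := CDGA.exists_concentrated (A := A) (Q (-(d : ℤ))) (-(d : ℤ))
      obtain ⟨W, hW, ⟨eW⟩⟩ := CDGA.exists_concentrated (A := A) (P (-(d : ℤ))) (-(d : ℤ))
      have hV' := CDGA.projective_finite_of_concentrated hV eV
      have hW' := CDGA.projective_finite_of_concentrated hW eW
      have := fun i => (hV' i).1
      have := fun i => (hV' i).2
      have := fun i => (hW' i).1
      have := fun i => (hW' i).2
      exact ⟨fun i => V i, inferInstance, inferInstance, fun i => W i, inferInstance,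
        inferInstance, hV', hW', CDGA.extendsInDegree hC0 hE hF hP hQ hd f hf' hV hW eV eW⟩
    · rintro ⟨P, _, _, Q, _, _, hP, hQ, hPQ⟩
      obtain ⟨G⟩ := hP.nonempty_generators
      obtain ⟨H⟩ := hQ.nonempty_generators
      have := hP.projective
      have := hQ.projective
      have := G.finite hE.inCA
      have := H.finite hF.inCA
      obtain ⟨V, hV, ⟨eV⟩⟩ := CDGA.exists_concentrated (A := A) (Q (-(d : ℤ))) (-(d : ℤ))
      obtain ⟨W, hW, ⟨eW⟩⟩ := CDGA.exists_concentrated (A := A) (P (-(d : ℤ))) (-(d : ℤ))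
      have hV' := CDGA.projective_finite_of_concentrated hV eV
      have hW' := CDGA.projective_finite_of_concentrated hW eW
      have := fun i => (hV' i).1
      have := fun i => (hV' i).2
      have := fun i => (hW' i).1
      have := fun i => (hW' i).2
      have := (hPQ _ rfl).1
      have := (hPQ _ rfl).2
      exact ⟨fun i => V i, inferInstance, inferInstance, fun i => W i, inferInstance,
        inferInstance, fun i => ⟨CDGA.free_of_concentrated hV eV i, (hV' i).2⟩,
        fun i => ⟨CDGA.free_of_concentrated hW eW i, (hW' i).2⟩,
        CDGA.extendsInDegree hC0 hE hF hP hQ hd f hf' hV hW eV eW⟩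
  -- No given morphism is needed: the induction starts from the common degree-zero part `A`.
  · obtain ⟨f, g, h⟩ := CDGA.exists_inverseGE_zero G H
    exact CDGA.stablyIso_of_inverseGE hC0 hE hF le_rfl h (fun i hi => by omega)
      (fun x y h => h.elim) (fun i hi => trivial)
  · intro T _ _ δ a b ha hb
    -- Starting at `k = -1` keeps `V` and `W` in degrees `≤ -2` and leaves the given identification
    -- in degree `-1` untouched.
    obtain ⟨f, g, h, hf⟩ := CDGA.exists_inverseGE_of_equiv G H δ a b ha hb
    refine CDGA.stablyIso_of_inverseGE hC0 hE hF (by omega) h (fun i hi => by omega) ?_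
      (fun i hi => by omega)
    rintro x y ⟨t, rfl, rfl⟩
    exact ⟨-1, le_rfl, (a t).2, (hf t).symm⟩
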